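/- Let $R$ be a unital associative ring and $A\subseteq R$ a two-sided ideal. (For a nonunital ring $A$ one may take $R=\tilde A=\mathbb Z\ltimes A$, or any other unital ring containing $A$ as a two-sided ideal.) A left $R$-module $M$ is \emph{h-unitary} if the evaluation map $A\otimes_R M\to M$, $a\otimes m\mapsto am$, is an isomorphism and $\mathrm{Tor}_i^R(A,M)=0$ for all $i\ge 1$; let $\mathfrak M(A)$ be the full subcategory of h-unitary modules. Let $\mathcal F$ be the class of h-unitary modules that are flat over $R$, and let $\mathcal C$ be the class of h-unitary modules $C$ with $\mathrm{Ext}^1_{\mathfrak M(A)}(F,C)=0$ for all $F\in\mathcal F$, that is, such that every short exact sequence $0\to C\to N\to F\to 0$ of $R$-modules with $F\in\mathcal F$ and $N$ h-unitary splits. Let $\mathbb C(\mathfrak M(A))$ be the category of unbounded complexes $M=(M^n,\delta^n)_{n\in\mathbb Z}$ of $R$-modules such that $\ker\delta^n$, $M^n$ and $\mathrm{Im}\,\delta^n$ are h-unitary for all $n$. Write $Z_nM=\ker\delta^n$, and let $\mathcal E$ be the class of exact complexes in $\mathbb C(\mathfrak M(A))$ (those with $\ker\delta^n=\mathrm{Im}\,\delta^{n-1}$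 for all $n$). For complexes $M,N$ let $Hom(M,N)$ be the complex of abelian groups with $Hom(M,N)^n=\prod_{t}\mathrm{Hom}_R(M^t,N^{n+t})$ and $(\delta^n f)^m=\delta_N^{m+n}f^m-(-1)^n f^{m+1}\delta_M^m$. Define the following classes of complexes in $\mathbb C(\mathfrak M(A))$: \begin{itemize} \item $\widetilde{\mathcal F}$ (h-unitary flat complexes): $X\in\mathcal E$ with $Z_nX\in\mathcal F$ for all $n$; \item $\widetilde{\mathcal C}$ ($\mathcal F$-cotorsion complexes): $Y\in\mathcal E$ with $Z_nY\in\mathcal C$ for all $n$; \item $dg\widetilde{\mathcal F}$: complexes $X$ with $X^n\in\mathcal F$ for all $n$ and $Hom(X,C)$ exact for every $C\in\widetilde{\mathcal C}$; \item $dg\widetilde{\mathcal C}$: complexes $Y$ with $Y^n\in\mathcal C$ for all $n$ and $Hom(X,Y)$ exact for every $X\in\widetilde{\mathcal F}$. \end{itemize} Then $$dg\widetilde{\mathcal F}\cap\mathcal E=\widetilde{\mathcal F}\qquad\text{and}\qquad dg\widetilde{\mathcal C}\cap\mathcal E=\widetilde{\mathcal C}.$$ -/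

import Mathlib

open CategoryTheory

universe u

noncomputable section

namespace HUnitary

section Tensor

variable (R : Type u) [Ring R]

/-- The subgroup of `N ⊗[ℤ] M` generated by the elements `n r ⊗ m - n ⊗ r m`, for a right
`R`-module `N` and a left `R`-module `M`. -/
def balancingSubgroup (N M : Type u) [AddCommGroup N] [Module Rᵐᵒᵖ N]
    [AddCommGroup M] [Module R M] : AddSubgroup (TensorProduct ℤ N M) :=
  AddSubgroup.closure {t | ∃ (n : N) (r : R) (m : M),
    t = TensorProduct.tmul ℤ (MulOpposite.op r • n) m - TensorProduct.tmul ℤ n (r • m)}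

/-- The tensor product `N ⊗_R M` of a right and a left module over a (noncommutative) ring,
an abelian group. -/
abbrev Tensor (N M : Type u) [AddCommGroup N] [Module Rᵐᵒᵖ N]
    [AddCommGroup M] [Module R M] : Type u :=
  TensorProduct ℤ N M ⧸ balancingSubgroup R N M

variable {N N' M M' : Type u} [AddCommGroup N] [Module Rᵐᵒᵖ N] [AddCommGroup N']
  [Module Rᵐᵒᵖ N'] [AddCommGroup M] [Module R M] [AddCommGroup M'] [Module R M']

/-- The pure tensor `n ⊗ m` in `N ⊗_R M`. -/
def tmul (n : N) (m : M) : Tensor R N M :=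
  QuotientAddGroup.mk (TensorProduct.tmul ℤ n m)

variable {R} in
theorem tensor_hom_ext {P : Type u} [AddCommGroup P] {f g : Tensor R N M →+ P}
    (h : ∀ n m, f (tmul R n m) = g (tmul R n m)) : f = g := by
  apply QuotientAddGroup.addMonoidHom_ext
  ext t
  induction t using TensorProduct.induction_on with
  | zero => simp
  | tmul n m => exact h n m
  | add x y hx hy => rw [map_add, map_add, hx, hy]

/-- The homomorphism `f ⊗ g : N ⊗_R M → N' ⊗_R M'`. -/
def tensorMap (f : N →ₗ[Rᵐᵒᵖ] N') (g : M →ₗ[R] M') : Tensor R N M →+ Tensor R N' M' :=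
  QuotientAddGroup.map (balancingSubgroup R N M) (balancingSubgroup R N' M')
    (TensorProduct.map f.toAddMonoidHom.toIntLinearMap
      g.toAddMonoidHom.toIntLinearMap).toAddMonoidHom (by
    refine (AddSubgroup.closure_le _).2 ?_
    rintro _ ⟨n, r, m, rfl⟩
    refine AddSubgroup.subset_closure ⟨f n, r, g m, ?_⟩
    simp)

@[simp]
theorem tensorMap_tmul (f : N →ₗ[Rᵐᵒᵖ] N') (g : M →ₗ[R] M') (n : N) (m : M) :
    tensorMap R f g (tmul R n m) = tmul R (f n) (g m) := rfl

variable (N) in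
/-- The functor `N ⊗_R -` from left `R`-modules to abelian groups. -/
def tensorFunctor : ModuleCat.{u} R ⥤ AddCommGrpCat.{u} where
  obj M := AddCommGrpCat.of (Tensor R N M)
  map f := AddCommGrpCat.ofHom (tensorMap R LinearMap.id f.hom)
  map_id M := by
    apply AddCommGrpCat.hom_ext
    apply tensor_hom_ext
    intro n m
    rfl
  map_comp f g := by
    apply AddCommGrpCat.hom_ext
    apply tensor_hom_ext
    intro n m
    rfl

instance tensorFunctor_additive : (tensorFunctor R N).Additive where
  map_add {X Y f g} := by
    apply AddCommGrpCat.hom_ext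
    apply tensor_hom_ext
    intro n m
    change (QuotientAddGroup.mk (TensorProduct.tmul ℤ n (f.hom m + g.hom m)) : Tensor R N Y) =
      QuotientAddGroup.mk (TensorProduct.tmul ℤ n (f.hom m)) +
        QuotientAddGroup.mk (TensorProduct.tmul ℤ n (g.hom m))
    rw [TensorProduct.tmul_add]
    rfl

variable (N) in
/-- `Tor_i^R(N, M)`: the value at `M` of the `i`-th left derived functor of `N ⊗_R -`. -/
def tor (i : ℕ) (M : ModuleCat.{u} R) : AddCommGrpCat.{u} :=
  ((tensorFunctor R N).leftDerived i).obj M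

variable {R} in
/-- A left `R`-module `M` is flat if `- ⊗_R M` preserves injectivity. -/
def IsFlat (M : ModuleCat.{u} R) : Prop :=
  ∀ (N N' : Type u) [AddCommGroup N] [Module Rᵐᵒᵖ N] [AddCommGroup N'] [Module Rᵐᵒᵖ N']
    (f : N →ₗ[Rᵐᵒᵖ] N'), Function.Injective f →
      Function.Injective (tensorMap R f (LinearMap.id : M →ₗ[R] M))

end Tensor

section Modules

variable {R : Type u} [Ring R] (A : TwoSidedIdeal R)

/-- The evaluation map `A ⊗_R M → M`, `a ⊗ m ↦ a m`. -/
def evaluation (M : ModuleCat.{u} R) : Tensor R A M →+ M :=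
  QuotientAddGroup.lift (balancingSubgroup R A M)
    (TensorProduct.liftAddHom
      (AddMonoidHom.mk' (fun a : A => DistribSMul.toAddMonoidHom M (a : R)) (by
        intro a b
        ext m
        exact add_smul (a : R) (b : R) m))
      (by
        intro z a m
        change ((z • a : A) : R) • m = (a : R) • (z • m)
        rw [show ((z • a : A) : R) = z • (a : R) from rfl, smul_assoc, smul_comm])) (by
    refine (AddSubgroup.closure_le _).2 ?_
    rintro _ ⟨a, r, m, rfl⟩
    change _ = _
    rw [map_sub, sub_eq_zero]
    change ((MulOpposite.op r • a : A) : R) • m = (a : R) • (r • m)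
    rw [show ((MulOpposite.op r • a : A) : R) = (a : R) * r from rfl, mul_smul])

@[simp]
theorem evaluation_tmul (M : ModuleCat.{u} R) (a : A) (m : M) :
    evaluation A M (tmul R a m) = (a : R) • m := rfl

/-- h-unitary modules for the pair `(R, A)`: the evaluation map `A ⊗_R M → M` is an isomorphism
and `Tor_i^R(A, M) = 0` for all `i ≥ 1`. -/
def IsHUnitary (M : ModuleCat.{u} R) : Prop :=
  Function.Bijective (evaluation A M) ∧ ∀ i : ℕ, 1 ≤ i → Limits.IsZero (tor R A i M)

/-- The class of h-unitary flat modules. -/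
def IsHUnitaryFlat (M : ModuleCat.{u} R) : Prop :=
  IsHUnitary A M ∧ IsFlat M

/-- The vanishing of the relative group of extensions `Ext¹(F, C)` in the category of h-unitary
modules: every short exact sequence `0 → C → N → F → 0` of `R`-modules with `N` h-unitary
splits. (It is applied to h-unitary `F` and `C` only.) -/
def RelExtOneVanishes (F C : ModuleCat.{u} R) : Prop :=
  ∀ (N : ModuleCat.{u} R), IsHUnitary A N → ∀ (i : C →ₗ[R] N) (p : N →ₗ[R] F),
    Function.Injective i → Function.Exact i p → Function.Surjective p →
      ∃ s : F →ₗ[R] N, p ∘ₗ s = LinearMap.id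

/-- The class of h-unitary cotorsion modules. -/
def IsHUnitaryCotorsion (C : ModuleCat.{u} R) : Prop :=
  IsHUnitary A C ∧ ∀ F : ModuleCat.{u} R, IsHUnitaryFlat A F → RelExtOneVanishes A F C

end Modules

section Complexes

variable {R : Type u} [Ring R]

/-- The cycle module `Z_n X = ker δⁿ`. -/
def cycleModule (X : CochainComplex (ModuleCat.{u} R) ℤ) (n : ℤ) : ModuleCat.{u} R :=
  ModuleCat.of R (LinearMap.ker (X.d n (n + 1)).hom)

/-- The module `Im δⁿ`, that is, `B_{n+1} X`. -/
def imageModule (X : CochainComplex (ModuleCat.{u} R) ℤ) (n : ℤ) : ModuleCat.{u} R :=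
  ModuleCat.of R (LinearMap.range (X.d n (n + 1)).hom)

variable (A : TwoSidedIdeal R)

/-- Complexes of h-unitary modules: unbounded complexes such that every
`0 → ker δⁿ → Xⁿ → Im δⁿ → 0` is a short exact sequence of h-unitary modules. -/
def complexes : ObjectProperty (CochainComplex (ModuleCat.{u} R) ℤ) := fun X =>
  ∀ n : ℤ, IsHUnitary A (cycleModule X n) ∧ IsHUnitary A (X.X n) ∧
    IsHUnitary A (imageModule X n)

/-- The class `ℰ` of exact complexes of h-unitary modules. -/
def exactComplexes : ObjectProperty (CochainComplex (ModuleCat.{u} R) ℤ) := fun X =>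
  complexes A X ∧ X.Acyclic

/-- h-unitary flat complexes: exact complexes of h-unitary modules all of whose cycle modules
are h-unitary flat. -/
def flatComplexes : ObjectProperty (CochainComplex (ModuleCat.{u} R) ℤ) := fun X =>
  exactComplexes A X ∧ ∀ n : ℤ, IsHUnitaryFlat A (cycleModule X n)

/-- `ℱ`-cotorsion complexes: exact complexes of h-unitary modules all of whose cycle modules
are h-unitary cotorsion. -/
def cotorsionComplexes : ObjectProperty (CochainComplex (ModuleCat.{u} R) ℤ) := fun X =>
  exactComplexes A X ∧ ∀ n : ℤ, IsHUnitaryCotorsion A (cycleModule X n)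

/-- dg-h-unitary flat complexes. -/
def dgFlatComplexes : ObjectProperty (CochainComplex (ModuleCat.{u} R) ℤ) := fun X =>
  complexes A X ∧ (∀ n : ℤ, IsHUnitaryFlat A (X.X n)) ∧
    ∀ C, cotorsionComplexes A C → (CochainComplex.HomComplex X C).Acyclic

/-- dg-cotorsion complexes. -/
def dgCotorsionComplexes : ObjectProperty (CochainComplex (ModuleCat.{u} R) ℤ) := fun Y =>
  complexes A Y ∧ (∀ n : ℤ, IsHUnitaryCotorsion A (Y.X n)) ∧
    ∀ X, flatComplexes A X → (CochainComplex.HomComplex X Y).Acyclic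

end Complexes

end HUnitary

end

/-! Two reductions make the classes tractable. A module is h-unitary and flat exactly when it is
flat and `A M = M` (`isHUnitaryFlat_iff`); such modules are called firm flat. And `M` is h-unitary
exactly when `P / A P` is acyclic for a projective resolution `P` of `M` (`isHUnitary_iff`). A
mapping cone then shows that in a short exact sequence with h-unitary cokernel, the kernel is
h-unitary if and only if the middle term is (`isHUnitary_two_of_three`).

Firm flat and cotorsion modules behave as a complete hereditary cotorsion pair among the h-unitary
modules. A telescope of free modules covers every module with `A M = M` by a firm flat one. A small
object argument against a set of inclusions with firm flat cokernel embeds an h-unitary module in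
one with an extension property for small modules, again with firm flat cokernel; small pure
submodules and Zorn's lemma upgrade that property to cotorsion (`HU.exists_special_preenvelope`).
Salce's pushout gives precovers (`HU.exists_special_precover`), and quotients are handled by
`IsCotorsion.of_coresolution`.

One inclusion in each equality holds because a cocycle in the Hom complex from an exact complex with
firm flat cycles to one with cotorsion cycles is a coboundary (`exists_nullhomotopy`); the terms are
in the right class by closure under extensions.

For the other inclusion, a map from a firm flat module to cycles of an exact complex `Y` is grown
into a chain map from an h-unitary flat complex. If `Y` is dg-cotorsion this map is null-homotopic,
and the homotopy in one degree lifts the given map along the differential. Combined with cotorsion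
of the terms, this splits every extension of a firm flat module by a cycle module. Dually, maps from
cycles of a dg-flat exact complex to a cotorsion module extend to the whole term, which makes each
cycle module a retract of its firm flat precover. -/

noncomputable section

namespace HUnitary

/-! ### The equational criterion and closure properties of flat modules -/

section EquationalFlatness

variable {R : Type*} [Ring R]

/-- A linear map whose kernel contains the kernel of a surjection factors through it. -/
theorem exists_comp_eq_of_ker_le {X Y Z : Type*} [AddCommGroup X] [Module R X]
    [AddCommGroup Y] [Module R Y] [AddCommGroup Z] [Module R Z] {π : X →ₗ[R] Y}
    (hπ : Function.Surjective π) (φ : X →ₗ[R] Z) (h : ∀ x, π x = 0 → φ x = 0) :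
    ∃ ψ : Y →ₗ[R] Z, ∀ x, ψ (π x) = φ x := by
  refine ⟨(π.ker.liftQ φ h) ∘ₗ (π.quotKerEquivOfSurjective hπ).symm.toLinearMap, fun x => ?_⟩
  have : (π.quotKerEquivOfSurjective hπ).symm (π x) = π.ker.mkQ x := by
    rw [LinearEquiv.symm_apply_eq]; rfl
  simp only [LinearMap.comp_apply, LinearEquiv.coe_coe, this]
  rfl

/-- A linear map from a finite free module lifts along a surjection. -/
theorem exists_lift_of_surjective {X Y P : Type*} [AddCommGroup X] [Module R X]
    [AddCommGroup Y] [Module R Y] [AddCommGroup P] [Module R P] [Module.Projective R P]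
    {π : X →ₗ[R] Y}
    (hπ : Function.Surjective π) (φ : P →ₗ[R] Y) : ∃ ψ : P →ₗ[R] X, ∀ x, π (ψ x) = φ x := by
  obtain ⟨ψ, hψ⟩ := Module.projective_lifting_property π φ hπ
  exact ⟨ψ, fun x => LinearMap.congr_fun hψ x⟩

/-- A linear map with values in the range of an injective map lifts along it. -/
theorem exists_lift_of_injective {X Y P : Type*} [AddCommGroup X] [Module R X]
    [AddCommGroup Y] [Module R Y] [AddCommGroup P] [Module R P]
    {i : X →ₗ[R] Y} (hi : Function.Injective i) (φ : P →ₗ[R] Y) (h : ∀ y, ∃ x, i x = φ y) :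
    ∃ ψ : P →ₗ[R] X, ∀ y, i (ψ y) = φ y := by
  choose k hk using h
  exact ⟨{ toFun := k
           map_add' := fun y z => hi (by simp only [map_add, hk])
           map_smul' := fun r y => hi (by simp only [map_smul, hk, RingHom.id_apply]) }, hk⟩

/-- The equational criterion for flatness, as a definition. -/
def EqFlat (R M : Type*) [Ring R] [AddCommGroup M] [Module R M] : Prop :=
  ∀ (m : ℕ) (f : (Fin m → R) →ₗ[R] M) (x : Fin m → R), f x = 0 →
    ∃ (n : ℕ) (a : (Fin m → R) →ₗ[R] (Fin n → R)) (g : (Fin n → R) →ₗ[R] M),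
      (∀ y, g (a y) = f y) ∧ a x = 0

variable {M M' M'' Q : Type*} [AddCommGroup M] [Module R M] [AddCommGroup M'] [Module R M']
  [AddCommGroup M''] [Module R M''] [AddCommGroup Q] [Module R Q]

/-- The images of the finitely many standard vectors involve only finitely many basis elements, and
the coordinates along these already give the factorisation. -/
theorem EqFlat.of_free [Module.Free R Q] : EqFlat R Q := by
  intro m f x hx
  classical
  let b := Module.Free.chooseBasis R Q
  let S : Finset (Module.Free.ChooseBasisIndex R Q) :=
    Finset.univ.biUnion fun i : Fin m => (b.repr (f (Pi.single i 1))).support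
  let a : (Fin m → R) →ₗ[R] (Fin S.card → R) :=
    LinearMap.pi fun k =>
      (Finsupp.lapply (S.equivFin.symm k : Module.Free.ChooseBasisIndex R Q)) ∘ₗ
        b.repr.toLinearMap ∘ₗ f
  let g : (Fin S.card → R) →ₗ[R] Q :=
    Fintype.linearCombination R fun k => b (S.equivFin.symm k)
  refine ⟨S.card, a, g, ?_, ?_⟩
  · suffices g ∘ₗ a = f from fun y => LinearMap.congr_fun this y
    refine LinearMap.pi_ext' fun i => LinearMap.ext_ring ?_
    have hsub : (b.repr (f (Pi.single i 1))).support ⊆ S :=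
      Finset.subset_biUnion_of_mem (fun i : Fin m => (b.repr (f (Pi.single i 1))).support)
        (Finset.mem_univ i)
    have h1 : g (a (Pi.single i 1)) =
        ∑ s ∈ S, b.repr (f (Pi.single i 1)) s • b s := by
      simp only [g, a, Fintype.linearCombination_apply, LinearMap.pi_apply, LinearMap.comp_apply,
        Finsupp.lapply_apply, LinearEquiv.coe_coe]
      rw [Equiv.sum_comp S.equivFin.symm
        (fun s : S => b.repr (f (Pi.single i 1)) (s : _) • b (s : _)),
        Finset.sum_coe_sort S (fun s => b.repr (f (Pi.single i 1)) s • b s)]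
    have h2 := b.linearCombination_repr (f (Pi.single i 1))
    rw [Finsupp.linearCombination_apply, Finsupp.sum_of_support_subset _ hsub _ (by simp)] at h2
    simp only [LinearMap.comp_apply, LinearMap.single_apply]
    rw [h1, h2]
  · ext k
    simp [a, hx]

/-- A module is flat as soon as each relation becomes trivial in some flat module mapping to it. -/
theorem EqFlat.of_factor
    (h : ∀ (m : ℕ) (f : (Fin m → R) →ₗ[R] M) (x : Fin m → R), f x = 0 →
      ∃ (Q : Type u) (_ : AddCommGroup Q) (_ : Module R Q) (a : (Fin m → R) →ₗ[R] Q)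
        (g : Q →ₗ[R] M), EqFlat R Q ∧ (∀ y, g (a y) = f y) ∧ a x = 0) : EqFlat R M := by
  intro m f x hx
  obtain ⟨Q, _, _, a, g, hQ, hga, hax⟩ := h m f x hx
  obtain ⟨n, a', g', h', hx'⟩ := hQ m a x hax
  exact ⟨n, a', g ∘ₗ g', fun y => by simp [h', hga], hx'⟩

theorem EqFlat.of_retract (hM : EqFlat R M) (i : Q →ₗ[R] M) (r : M →ₗ[R] Q)
    (h : ∀ x, r (i x) = x) : EqFlat R Q := by
  intro m f x hx
  obtain ⟨n, a, g, hg, ha⟩ := hM m (i ∘ₗ f) x (by simp [hx])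
  exact ⟨n, a, r ∘ₗ g, fun y => by simp [hg, h], ha⟩

theorem EqFlat.of_equiv (hM : EqFlat R M) (e : M ≃ₗ[R] Q) : EqFlat R Q :=
  hM.of_retract e.symm.toLinearMap e.toLinearMap (by simp)

/-- Finitely many relations in a flat module become trivial simultaneously. -/
theorem EqFlat.exists_factor_finset (hM : EqFlat R M) {m : ℕ} (f : (Fin m → R) →ₗ[R] M)
    (S : Finset (Fin m → R)) (hS : ∀ x ∈ S, f x = 0) :
    ∃ (n : ℕ) (a : (Fin m → R) →ₗ[R] (Fin n → R)) (g : (Fin n → R) →ₗ[R] M),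
      (∀ y, g (a y) = f y) ∧ ∀ x ∈ S, a x = 0 := by
  classical
  induction S using Finset.induction_on with
  | empty => exact ⟨m, LinearMap.id, f, by simp, by simp⟩
  | insert x S hx ih =>
    obtain ⟨n, a, g, hg, ha⟩ := ih fun y hy => hS y (Finset.mem_insert_of_mem hy)
    obtain ⟨n', a', g', hg', ha'⟩ := hM n g (a x)
      (by rw [hg]; exact hS x (Finset.mem_insert_self x S))
    refine ⟨n', a' ∘ₗ a, g', fun y => by simp [hg', hg], fun y hy => ?_⟩
    rcases Finset.mem_insert.1 hy with rfl | hy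
    · exact ha'
    · simp [ha y hy]

theorem EqFlat.exists_factor_of_free (hM : EqFlat R M) {P : Type*} [AddCommGroup P] [Module R P]
    [Module.Free R P] [Module.Finite R P] (f : P →ₗ[R] M)
    (S : Finset P) (hS : ∀ x ∈ S, f x = 0) :
    ∃ (n : ℕ) (a : P →ₗ[R] (Fin n → R)) (g : (Fin n → R) →ₗ[R] M),
      (∀ y, g (a y) = f y) ∧ ∀ x ∈ S, a x = 0 := by
  classical
  let b := Module.Free.chooseBasis R P
  let e : P ≃ₗ[R] (Fin (Fintype.card (Module.Free.ChooseBasisIndex R P)) → R) :=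
    b.equivFun.trans (LinearEquiv.funCongrLeft R R (Fintype.equivFin _).symm)
  obtain ⟨n, a, g, hg, ha⟩ := hM.exists_factor_finset (f ∘ₗ e.symm.toLinearMap) (S.image e) (by
    simpa using hS)
  exact ⟨n, a ∘ₗ e.toLinearMap, g, fun y => by simp [hg],
    fun x hx => ha _ (Finset.mem_image_of_mem _ hx)⟩

/-- Extensions of flat modules are flat. -/
theorem EqFlat.of_extension {i : M' →ₗ[R] M} {p : M →ₗ[R] M''}
    (hi : Function.Injective i) (hip : ∀ x, p x = 0 ↔ ∃ y, i y = x) (hp : Function.Surjective p)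
    (h' : EqFlat R M') (h'' : EqFlat R M'') : EqFlat R M := by
  intro m f x hx
  obtain ⟨n, a, g, hg, ha⟩ := h'' m (p ∘ₗ f) x (by simp [hx])
  obtain ⟨g₁, hg₁⟩ := exists_lift_of_surjective hp g
  -- After subtracting the lifted factorisation, what remains of `f` takes values in `M'` and still
  -- kills `x`, so flatness of `M'` handles it.
  have hk : ∀ y, ∃ z, i z = f y - g₁ (a y) := fun y => (hip _).1 (by simp [hg₁, hg])
  obtain ⟨k, hk⟩ := exists_lift_of_injective hi (f - g₁ ∘ₗ a) hk
  have hkx : k x = 0 := hi (by rw [hk]; simp [hx, ha])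
  obtain ⟨n', a', g', hg', ha'⟩ := h' m k x hkx
  have h1 : ∀ y, (g₁.coprod (i ∘ₗ g')) ((a.prod a') y) = f y := fun y => by
    change g₁ (a y) + i (g' (a' y)) = _
    rw [hg', hk]
    simp
  obtain ⟨N, c, d, hd, hc⟩ := EqFlat.of_free (R := R) (Q := (Fin n → R) × (Fin n' → R)) m
    (a.prod a') x (by simp [ha, ha'])
  exact ⟨N, c, (g₁.coprod (i ∘ₗ g')) ∘ₗ d, fun y => by rw [LinearMap.comp_apply, hd, h1], hc⟩

/-- The kernel of a surjection between flat modules is flat. -/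
theorem EqFlat.of_ker {i : M' →ₗ[R] M} {p : M →ₗ[R] M''}
    (hi : Function.Injective i) (hip : ∀ x, p x = 0 ↔ ∃ y, i y = x) (hp : Function.Surjective p)
    (h : EqFlat R M) (h'' : EqFlat R M'') : EqFlat R M' := by
  classical
  intro m f x hx
  obtain ⟨n, a, g, hg, ha⟩ := h m (i ∘ₗ f) x (by simp [hx])
  -- The images under `a` of the standard vectors are relations for `p ∘ₗ g`. Killing them all by
  -- `a'` lets `g` be corrected into `M'` without changing it on the range of `a`.
  obtain ⟨n', a', g', hg', ha'⟩ := h''.exists_factor_finset (p ∘ₗ g)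
    (Finset.univ.image fun j : Fin m => a (Pi.single j 1)) (by
      simp only [Finset.mem_image, Finset.mem_univ, true_and, forall_exists_index]
      rintro _ j rfl
      simp only [LinearMap.comp_apply, hg]
      exact (hip _).2 ⟨_, rfl⟩)
  obtain ⟨g₁, hg₁⟩ := exists_lift_of_surjective hp g'
  have haa : ∀ y, a' (a y) = 0 := by
    suffices a' ∘ₗ a = 0 from fun y => LinearMap.congr_fun this y
    refine LinearMap.pi_ext' fun j => LinearMap.ext_ring ?_
    simpa using ha' _ (Finset.mem_image_of_mem _ (Finset.mem_univ j))
  have hk : ∀ y, ∃ z, i z = g y - g₁ (a' y) := fun y => (hip _).1 (by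
    have := hg' y
    simp only [LinearMap.comp_apply] at this
    simp [hg₁, this])
  obtain ⟨k, hk⟩ := exists_lift_of_injective hi (g - g₁ ∘ₗ a') hk
  exact ⟨n, a, k, fun y => hi (by rw [hk]; simp [haa, hg]), ha⟩

end EquationalFlatness

end HUnitary
end

noncomputable section

namespace HUnitary

/-! ### Equivalence of tensor flatness and the equational criterion -/

section TensorFlat

variable {R : Type u} [Ring R] {N N' M M' P : Type u} [AddCommGroup N] [Module Rᵐᵒᵖ N]
  [AddCommGroup N'] [Module Rᵐᵒᵖ N'] [AddCommGroup M] [Module R M] [AddCommGroup M'] [Module R M']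

variable (R M) in
/-- The pure tensors `n ⊗ -`, as an additive map. -/
def tmulHom (n : N) : M →+ Tensor R N M :=
  (QuotientAddGroup.mk' (balancingSubgroup R N M)).comp
    (TensorProduct.mk ℤ N M n).toAddMonoidHom

@[simp]
theorem tmulHom_apply (n : N) (m : M) : tmulHom R M n m = tmul R n m := rfl

theorem tmul_add (n : N) (m m' : M) : tmul R n (m + m') = tmul R n m + tmul R n m' :=
  (tmulHom R M n).map_add m m'

theorem tmul_zero (n : N) : tmul R n (0 : M) = 0 := (tmulHom R M n).map_zero

theorem add_tmul (n n' : N) (m : M) : tmul R (n + n') m = tmul R n m + tmul R n' m := by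
  simp only [tmul, TensorProduct.add_tmul, QuotientAddGroup.mk_add]

theorem smul_tmul (r : R) (n : N) (m : M) :
    tmul R (MulOpposite.op r • n) m = tmul R n (r • m) := by
  rw [← sub_eq_zero]
  exact (QuotientAddGroup.eq_zero_iff _).2 (AddSubgroup.subset_closure ⟨n, r, m, rfl⟩)

theorem tensor_induction {p : Tensor R N M → Prop} (t : Tensor R N M) (h0 : p 0)
    (ht : ∀ n m, p (tmul R n m)) (ha : ∀ s t, p s → p t → p (s + t)) : p t := by
  obtain ⟨t, rfl⟩ := QuotientAddGroup.mk_surjective t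
  induction t using TensorProduct.induction_on with
  | zero => exact h0
  | tmul n m => exact ht n m
  | add x y hx hy => exact ha _ _ hx hy

/-- The homomorphism out of `N ⊗_R M` induced by a balanced biadditive map. -/
def tensorLift {T : Type*} [AddCommGroup T] (φ : N →+ M →+ T)
    (h : ∀ (r : R) n m, φ (MulOpposite.op r • n) m = φ n (r • m)) : Tensor R N M →+ T :=
  QuotientAddGroup.lift (balancingSubgroup R N M)
    (TensorProduct.liftAddHom φ (fun z n m => by simp)) (by
      refine (AddSubgroup.closure_le _).2 ?_
      rintro _ ⟨n, r, m, rfl⟩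
      change _ = _
      rw [map_sub, sub_eq_zero]
      exact h r n m)

@[simp]
theorem tensorLift_tmul {T : Type*} [AddCommGroup T] (φ : N →+ M →+ T)
    (h : ∀ (r : R) n m, φ (MulOpposite.op r • n) m = φ n (r • m)) (n : N) (m : M) :
    tensorLift φ h (tmul R n m) = φ n m := rfl

theorem tensorMap_comp_apply {M'' : Type u} [AddCommGroup M''] [Module R M'']
    (g : M →ₗ[R] M') (h : M' →ₗ[R] M'') (t : Tensor R N M) :
    tensorMap R (LinearMap.id : N →ₗ[Rᵐᵒᵖ] N) h (tensorMap R LinearMap.id g t) =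
      tensorMap R LinearMap.id (h ∘ₗ g) t := by
  induction t using tensor_induction with
  | h0 => simp
  | ht n m => simp
  | ha s t hs ht => simp [hs, ht]

theorem tensorMap_swap (f : N →ₗ[Rᵐᵒᵖ] N') (g : M →ₗ[R] M') (t : Tensor R N M) :
    tensorMap R (LinearMap.id : N' →ₗ[Rᵐᵒᵖ] N') g (tensorMap R f LinearMap.id t) =
      tensorMap R f LinearMap.id (tensorMap R LinearMap.id g t) := by
  induction t using tensor_induction with
  | h0 => simp
  | ht n m => simp
  | ha s t hs ht => simp [hs, ht]

variable {ι : Type*}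

variable (R M) in
/-- The homomorphism `w ↦ ∑ i, ν i ⊗ w i`. -/
def sumTmul (ν : ι → N) : (ι →₀ M) →+ Tensor R N M :=
  Finsupp.liftAddHom fun i => tmulHom R M (ν i)

@[simp]
theorem sumTmul_single (ν : ι → N) (i : ι) (m : M) :
    sumTmul R M ν (Finsupp.single i m) = tmul R (ν i) m := by
  rw [sumTmul, Finsupp.liftAddHom_apply_single, tmulHom_apply]

theorem sumTmul_mapRange (ν : ι → N) (g : M →ₗ[R] M') (w : ι →₀ M) :
    sumTmul R M' ν (Finsupp.mapRange.linearMap g w) =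
      tensorMap R LinearMap.id g (sumTmul R M ν w) := by
  induction w using Finsupp.induction_linear with
  | zero => simp
  | add w w' h h' => simp only [map_add, h, h']
  | single i m => simp

/-- The families `w` for which `∑ i, ν i ⊗ w i` vanishes for a trivial reason. -/
def trivialRelations (R : Type u) [Ring R] {N : Type u} [AddCommGroup N] [Module Rᵐᵒᵖ N]
    (M : Type u) [AddCommGroup M] [Module R M] (ν : ι → N) :
    AddSubgroup (ι →₀ M) where
  carrier := {w | ∃ (Q : Type u) (_ : AddCommGroup Q) (_ : Module R Q) (_ : Module.Free R Q)
    (_ : Module.Finite R Q) (g : Q →ₗ[R] M) (u : ι →₀ Q),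
      Finsupp.mapRange.linearMap g u = w ∧ sumTmul R Q ν u = 0}
  zero_mem' := ⟨Fin 0 → R, inferInstance, inferInstance, inferInstance, inferInstance, 0, 0,
    by simp, by simp⟩
  neg_mem' := by
    rintro _ ⟨Q, _, _, _, _, g, u, rfl, hu⟩
    exact ⟨Q, inferInstance, inferInstance, inferInstance, inferInstance, g, -u,
      map_neg _ _, by simp [hu]⟩
  add_mem' := by
    rintro _ _ ⟨Q, _, _, _, _, g, u, rfl, hu⟩ ⟨Q', _, _, _, _, g', u', rfl, hu'⟩
    refine ⟨Q × Q', inferInstance, inferInstance, inferInstance, inferInstance, g.coprod g',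
      Finsupp.mapRange.linearMap (LinearMap.inl R Q Q') u +
        Finsupp.mapRange.linearMap (LinearMap.inr R Q Q') u', ?_, ?_⟩
    · ext i; simp
    · rw [map_add, sumTmul_mapRange, sumTmul_mapRange, hu, hu']; simp

theorem mapRange_mem_trivialRelations (ν : ι → N) (m : M) (k : ι →₀ R)
    (hk : sumTmul R R ν k = 0) :
    Finsupp.mapRange.linearMap (LinearMap.toSpanSingleton R M m) k ∈ trivialRelations R M ν :=
  ⟨R, inferInstance, inferInstance, inferInstance, inferInstance, _, k, rfl, hk⟩

/-- If `ν` generates `N`, then a relation `∑ i, ν i ⊗ w i = 0` is trivial. -/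
theorem mem_trivialRelations_of_sumTmul_eq_zero (ν : ι → N)
    (hν : ∀ n, ∃ k : ι →₀ R, sumTmul R R ν k = tmul R n (1 : R)) (w : ι →₀ M)
    (hw : sumTmul R M ν w = 0) : w ∈ trivialRelations R M ν := by
  choose k hk using hν
  let s (m : M) : (ι →₀ R) →ₗ[ℕ] (ι →₀ M) :=
    (Finsupp.mapRange.linearMap (LinearMap.toSpanSingleton R M m)).restrictScalars ℕ
  -- Modulo trivial relations, the family `k n • m` depends only on the tensor that `k n`
  -- represents. Hence `n ⊗ m ↦ k n • m` is well defined and balanced, and it sends `∑ i, ν i ⊗ w i`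
  -- to the class of `w`.
  have key : ∀ (m : M) (a b : ι →₀ R), sumTmul R R ν a = sumTmul R R ν b →
      (QuotientAddGroup.mk (s m a) : (ι →₀ M) ⧸ trivialRelations R M ν) =
        QuotientAddGroup.mk (s m b) := by
    intro m a b hab
    rw [QuotientAddGroup.eq, ← map_neg (s m), ← map_add]
    exact mapRange_mem_trivialRelations ν m _ (by simp [hab])
  let φ : N →+ M →+ (ι →₀ M) ⧸ trivialRelations R M ν := AddMonoidHom.mk' (fun n =>
      AddMonoidHom.mk' (fun m => QuotientAddGroup.mk (s m (k n))) (by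
        intro m m'
        rw [← QuotientAddGroup.mk_add]
        congr 1
        ext i
        simp [s])) (by
      intro n n'
      ext m
      change (QuotientAddGroup.mk (s m (k (n + n'))) : (ι →₀ M) ⧸ trivialRelations R M ν) =
        QuotientAddGroup.mk (s m (k n)) + QuotientAddGroup.mk (s m (k n'))
      rw [← QuotientAddGroup.mk_add, ← map_add]
      refine key m _ _ ?_
      rw [map_add, hk, hk, hk, add_tmul])
  have hφ : ∀ (r : R) n m, φ (MulOpposite.op r • n) m = φ n (r • m) := by
    intro r n m
    have h1 : s (r • m) (k n) =
        s m (Finsupp.mapRange.linearMap (LinearMap.toSpanSingleton R R r) (k n)) := by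
      ext i
      simp [s, mul_smul]
    change (QuotientAddGroup.mk (s m (k (MulOpposite.op r • n))) :
      (ι →₀ M) ⧸ trivialRelations R M ν) = QuotientAddGroup.mk (s (r • m) (k n))
    rw [h1]
    refine key m _ _ ?_
    rw [sumTmul_mapRange, hk, hk, smul_tmul]
    simp
  have h2 : ∀ w : ι →₀ M, tensorLift φ hφ (sumTmul R M ν w) = QuotientAddGroup.mk w := by
    intro w
    induction w using Finsupp.induction_linear with
    | zero => simp
    | add w w' h h' => simp only [map_add, h, h', QuotientAddGroup.mk_add]
    | single i m =>
      rw [sumTmul_single, tensorLift_tmul]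
      have h3 : Finsupp.single i m = s m (Finsupp.single i 1) := by simp [s]
      rw [h3]
      exact key m _ _ (by rw [hk, sumTmul_single])
  rw [← QuotientAddGroup.eq_zero_iff, ← h2, hw, map_zero]

theorem exists_sumTmul_eq (t : Tensor R N M) : ∃ w : N →₀ M, sumTmul R M id w = t := by
  induction t using tensor_induction with
  | h0 => exact ⟨0, by simp⟩
  | ht n x => exact ⟨Finsupp.single n x, by simp⟩
  | ha s t hs ht =>
    obtain ⟨w, rfl⟩ := hs
    obtain ⟨w', rfl⟩ := ht
    exact ⟨w + w', by simp⟩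

theorem exists_free_tensorMap_eq (t : Tensor R N M) :
    ∃ (m : ℕ) (h : (Fin m → R) →ₗ[R] M) (s : Tensor R N (Fin m → R)),
      tensorMap R LinearMap.id h s = t := by
  suffices ∃ (Q : Type u) (_ : AddCommGroup Q) (_ : Module R Q) (_ : Module.Free R Q)
      (_ : Module.Finite R Q) (h : Q →ₗ[R] M) (s : Tensor R N Q),
      tensorMap R LinearMap.id h s = t by
    obtain ⟨Q, _, _, _, _, h, s, hs⟩ := this
    let e : Q ≃ₗ[R] (Fin (Fintype.card (Module.Free.ChooseBasisIndex R Q)) → R) :=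
      (Module.Free.chooseBasis R Q).equivFun.trans
        (LinearEquiv.funCongrLeft R R (Fintype.equivFin _).symm)
    refine ⟨_, h ∘ₗ e.symm.toLinearMap, tensorMap R LinearMap.id e.toLinearMap s, ?_⟩
    rw [tensorMap_comp_apply, LinearMap.comp_assoc, LinearEquiv.symm_comp]
    exact hs
  induction t using tensor_induction with
  | h0 => exact ⟨R, inferInstance, inferInstance, inferInstance, inferInstance, 0, 0, by simp⟩
  | ht n m =>
    exact ⟨R, inferInstance, inferInstance, inferInstance, inferInstance,
      LinearMap.toSpanSingleton R M m, tmul R n 1, by simp⟩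
  | ha s t hs ht =>
    obtain ⟨Q, _, _, _, _, h, s, rfl⟩ := hs
    obtain ⟨Q', _, _, _, _, h', s', rfl⟩ := ht
    refine ⟨Q × Q', inferInstance, inferInstance, inferInstance, inferInstance, h.coprod h',
      tensorMap R LinearMap.id (LinearMap.inl R Q Q') s +
        tensorMap R LinearMap.id (LinearMap.inr R Q Q') s', ?_⟩
    rw [map_add, tensorMap_comp_apply, tensorMap_comp_apply, LinearMap.coprod_inl,
      LinearMap.coprod_inr]

/-- If a tensor over a finite free module dies in `N ⊗_R M` with `M` flat, then it dies over some
finite free module mapping to `M`. -/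
theorem EqFlat.exists_tensorMap_eq_zero (hM : EqFlat R M) {m : ℕ} (h : (Fin m → R) →ₗ[R] M)
    (s : Tensor R N (Fin m → R)) (hs : tensorMap R LinearMap.id h s = 0) :
    ∃ (n : ℕ) (a : (Fin m → R) →ₗ[R] (Fin n → R)) (g : (Fin n → R) →ₗ[R] M),
      (∀ y, g (a y) = h y) ∧ tensorMap R LinearMap.id a s = 0 := by
  classical
  obtain ⟨w, rfl⟩ := exists_sumTmul_eq s
  rw [← sumTmul_mapRange] at hs
  obtain ⟨Q, _, _, _, _, g, u, hu, hu0⟩ := mem_trivialRelations_of_sumTmul_eq_zero (M := M)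
    (id : N → N) (fun n => ⟨Finsupp.single n 1, by simp⟩) _ hs
  -- Triviality gives `h (w ν) = g (u ν)`, so the finitely many pairs `(w ν, u ν)` are relations for
  -- `(h, -g)`. Once they are killed, `a` turns `w` into minus the image of `u`, whose tensor
  -- vanishes.
  obtain ⟨n, a, g', hg', ha⟩ := hM.exists_factor_of_free (h.coprod (-g))
    ((w.support ∪ u.support).image fun ν => (w ν, u ν)) (by
      simp only [Finset.mem_image, forall_exists_index, and_imp]
      rintro _ ν - rfl
      have := DFunLike.congr_fun hu ν
      simp only [Finsupp.mapRange.linearMap_apply, Finsupp.mapRange_apply] at this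
      simp [this])
  have ha' : ∀ ν, a (w ν, 0) = - a (0, u ν) := by
    intro ν
    rw [eq_neg_iff_add_eq_zero, ← map_add]
    by_cases hν : ν ∈ w.support ∪ u.support
    · simpa using ha _ (Finset.mem_image_of_mem _ hν)
    · simp only [Finset.mem_union, Finsupp.mem_support_iff, not_or, not_not] at hν
      rw [hν.1, hν.2, Prod.mk_add_mk, add_zero, add_zero]
      exact map_zero a
  refine ⟨n, a ∘ₗ LinearMap.inl R _ _, g', fun y => by simp [hg'], ?_⟩
  have h3 : Finsupp.mapRange.linearMap (a ∘ₗ LinearMap.inl R (Fin m → R) Q) w =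
      - Finsupp.mapRange.linearMap (a ∘ₗ LinearMap.inr R (Fin m → R) Q) u := by
    ext1 ν
    simpa using ha' ν
  rw [← sumTmul_mapRange, h3, map_neg, sumTmul_mapRange, hu0]
  simp

variable (R N) in
/-- The coordinates of a tensor over a finite free module. -/
def tensorCoord (m : ℕ) : Tensor R N (Fin m → R) →+ (Fin m → N) :=
  tensorLift (AddMonoidHom.mk' (fun n => AddMonoidHom.mk'
      (fun x j => MulOpposite.op (x j) • n) (by
        intro x y; ext j; simp [add_smul])) (by
      intro n n'; ext x j; simp))
    (by intro r n x; ext j; simp [mul_smul])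

theorem tensorCoord_injective (m : ℕ) : Function.Injective (tensorCoord R N m) := by
  classical
  have h : ∀ t, ∑ j, tmul R (tensorCoord R N m t j) (Pi.single j (1 : R)) = t := by
    intro t
    induction t using tensor_induction with
    | h0 => simp [tmul, TensorProduct.zero_tmul]
    | ht n x =>
      have h1 : ∀ j, tensorCoord R N m (tmul R n x) j = MulOpposite.op (x j) • n := fun _ => rfl
      simp only [h1, smul_tmul]
      simp only [← tmulHom_apply]
      rw [← map_sum]
      congr 1
      ext j
      simp [Finset.sum_apply, Pi.single_apply]
    | ha s t hs ht =>
      simp only [map_add, Pi.add_apply, add_tmul, Finset.sum_add_distrib, hs, ht]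
  exact Function.LeftInverse.injective 
    (g := fun v : Fin m → N => ∑ j, tmul R (v j) (Pi.single j (1 : R))) h

/-- An element of the kernel comes from a finite free module, and its image dies over another finite
free module mapping to `M`. Over finite free modules tensoring preserves injectivity, by
coordinates, so the element itself dies there. -/
theorem EqFlat.isFlat {M : ModuleCat.{u} R} (hM : EqFlat R M) : IsFlat M := by
  intro N N' _ _ _ _ f hf
  rw [injective_iff_map_eq_zero]
  intro t ht
  obtain ⟨m, h, s, rfl⟩ := exists_free_tensorMap_eq t
  rw [← tensorMap_swap] at ht
  obtain ⟨n, a, g, hg, ha⟩ := hM.exists_tensorMap_eq_zero h _ ht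
  have h1 : tensorMap R LinearMap.id a s = 0 := by
    rw [tensorMap_swap] at ha
    apply tensorCoord_injective
    have h2 : ∀ t : Tensor R N (Fin n → R),
        tensorCoord R N' n (tensorMap R f LinearMap.id t) = fun j => f (tensorCoord R N n t j) := by
      intro t
      induction t using tensor_induction with
      | h0 => ext; simp
      | ht n x =>
        ext j
        exact (f.map_smul (MulOpposite.op (x j)) n).symm
      | ha s t hs ht => ext j; simp [hs, ht]
    have h3 := h2 (tensorMap R LinearMap.id a s)
    rw [ha, map_zero] at h3
    rw [map_zero]
    ext j
    exact hf (by simpa using (congrFun h3 j).symm)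
  have h4 : h = g ∘ₗ a := LinearMap.ext fun y => (hg y).symm
  rw [h4, ← tensorMap_comp_apply, h1, map_zero]

/-- Flatness is tested on the right ideal `I` generated by the coordinates of `x`. The tensor `∑ x i
⊗ f (e i)` vanishes in `R ⊗ M`, hence in `I ⊗ M`, and a trivial reason for this is the desired
factorisation. -/
theorem IsFlat.eqFlat {M : ModuleCat.{u} R} (hM : IsFlat M) : EqFlat R M := by
  classical
  intro m f x hx
  let I : Submodule Rᵐᵒᵖ R := Submodule.span Rᵐᵒᵖ (Set.range x)
  let ν : Fin m → I := fun i => ⟨x i, Submodule.subset_span ⟨i, rfl⟩⟩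
  have hν : ∀ n : I, ∃ k : Fin m →₀ R, sumTmul R R ν k = tmul R n (1 : R) := by
    rintro ⟨n, hn⟩
    obtain ⟨c, hc⟩ := (Submodule.mem_span_range_iff_exists_fun Rᵐᵒᵖ).1 hn
    refine ⟨∑ i, Finsupp.single i (MulOpposite.unop (c i)), ?_⟩
    have h1 : (⟨n, hn⟩ : I) = ∑ i, c i • ν i := by
      ext
      simp [ν, ← hc]
    rw [map_sum, h1]
    have h2 : ∀ S : Finset (Fin m), tmul R (∑ i ∈ S, c i • ν i) (1 : R) =
        ∑ i ∈ S, tmul R (ν i) (MulOpposite.unop (c i)) := by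
      intro S
      induction S using Finset.induction_on with
      | empty => simp [tmul, TensorProduct.zero_tmul]
      | insert i S hi ih =>
        rw [Finset.sum_insert hi, Finset.sum_insert hi, add_tmul, ih]
        congr 1
        have := smul_tmul (MulOpposite.unop (c i)) (ν i) (1 : R)
        simpa using this
    rw [h2]
    simp
  have h0 : sumTmul R M ν (Finsupp.equivFunOnFinite.symm fun i => f (Pi.single i 1)) = 0 := by
    apply hM I R I.subtype (Submodule.subtype_injective I)
    rw [map_zero, ← Finsupp.univ_sum_single (Finsupp.equivFunOnFinite.symm _)]
    simp only [map_sum, sumTmul_single, tensorMap_tmul, Submodule.subtype_apply,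
      LinearMap.id_apply, Finsupp.equivFunOnFinite_symm_apply_apply]
    have h1 : ∀ i, tmul R (x i) (f (Pi.single i (1 : R))) =
        tmulHom R M (1 : R) (f (Pi.single i (x i))) := by
      intro i
      have := smul_tmul (x i) (1 : R) (f (Pi.single i (1 : R)))
      rw [← map_smul, ← Pi.single_smul] at this
      simpa using this
    simp only [ν, h1]
    rw [← map_sum, ← map_sum, Finset.univ_sum_single, hx, map_zero]
  obtain ⟨Q, _, _, _, _, g, u, hu, hu0⟩ :=
    mem_trivialRelations_of_sumTmul_eq_zero (M := M) ν hν _ h0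
  let a : (Fin m → R) →ₗ[R] Q := Fintype.linearCombination R u
  have ha : ∀ y, g (a y) = f y := by
    suffices g ∘ₗ a = f from fun y => LinearMap.congr_fun this y
    refine LinearMap.pi_ext' fun i => LinearMap.ext_ring ?_
    have := DFunLike.congr_fun hu i
    simpa [a, Fintype.linearCombination_apply_single] using this
  have hax : a x = 0 := by
    let e : Q ≃ₗ[R] (Fin (Fintype.card (Module.Free.ChooseBasisIndex R Q)) → R) :=
      (Module.Free.chooseBasis R Q).equivFun.trans
        (LinearEquiv.funCongrLeft R R (Fintype.equivFin _).symm)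
    have h5 : ∀ w : Fin m →₀ Q, ∀ j, ∑ i, x i * e (w i) j =
        (tensorCoord R I _ (tensorMap R LinearMap.id e.toLinearMap (sumTmul R Q ν w)) j : R) := by
      intro w j
      induction w using Finsupp.induction_linear with
      | zero => simp
      | add w w' h h' => simp [mul_add, Finset.sum_add_distrib, h, h']
      | single i q =>
        rw [sumTmul_single, tensorMap_tmul, Finset.sum_eq_single i]
        · rw [Finsupp.single_eq_same]; rfl
        · intro b _ hb
          rw [Finsupp.single_eq_of_ne hb]; simp
        · simp
    apply e.injective
    ext j
    have := h5 u j
    rw [hu0] at this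
    simpa [a, Fintype.linearCombination_apply, Finset.sum_apply] using this
  obtain ⟨n, c, d, hd, hc⟩ := EqFlat.of_free (R := R) (Q := Q) m a x hax
  exact ⟨n, c, g ∘ₗ d, fun y => by rw [LinearMap.comp_apply, hd, ha], hc⟩

end TensorFlat

end HUnitary
end

noncomputable section

namespace HUnitary

/-! ### The submodule `A M` and firm flat modules -/

section IdealSpan

variable {R : Type u} [Ring R] (A : TwoSidedIdeal R) {M M' M'' N : Type*} [AddCommGroup M]
  [Module R M] [AddCommGroup M'] [Module R M'] [AddCommGroup M''] [Module R M''] [AddCommGroup N]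
  [Module R N]

variable (M) in
/-- The submodule `A M` of `M`. -/
def idealSpan : Submodule R M := Submodule.span R {x | ∃ a ∈ A, ∃ m : M, x = a • m}

variable {A}

theorem smul_mem_idealSpan {a : R} (ha : a ∈ A) (m : M) : a • m ∈ idealSpan A M :=
  Submodule.subset_span ⟨a, ha, m, rfl⟩

theorem idealSpan_induction {p : M → Prop} {x : M} (hx : x ∈ idealSpan A M) (h0 : p 0)
    (hs : ∀ a ∈ A, ∀ m, p (a • m)) (ha : ∀ x y, p x → p y → p (x + y)) : p x := by
  suffices ∀ r : R, p (r • x) by simpa using this 1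
  induction hx using Submodule.span_induction with
  | mem x hx =>
    obtain ⟨a, ha, m, rfl⟩ := hx
    intro r
    rw [← mul_smul]
    exact hs _ (A.mul_mem_left r a ha) m
  | zero => simpa using h0
  | add x y _ _ hx hy => exact fun r => by simpa [smul_add] using ha _ _ (hx r) (hy r)
  | smul r x _ hx => exact fun r' => by simpa [mul_smul] using hx (r' * r)

theorem map_mem_idealSpan (f : M →ₗ[R] N) {x : M} (hx : x ∈ idealSpan A M) :
    f x ∈ idealSpan A N := by
  refine idealSpan_induction (p := fun x => f x ∈ idealSpan A N) hx (by simp)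
    (fun a ha m => ?_) fun x y hx hy => ?_
  · rw [map_smul]; exact smul_mem_idealSpan ha _
  · rw [map_add]; exact add_mem hx hy

theorem exists_mem_idealSpan_of_surjective {f : M →ₗ[R] N} (hf : Function.Surjective f) {y : N}
    (hy : y ∈ idealSpan A N) : ∃ x ∈ idealSpan A M, f x = y := by
  refine idealSpan_induction (p := fun y => ∃ x ∈ idealSpan A M, f x = y) hy
    ⟨0, zero_mem _, map_zero f⟩ (fun a ha m => ?_) fun x y hx hy => ?_
  · obtain ⟨m, rfl⟩ := hf m
    exact ⟨a • m, smul_mem_idealSpan ha _, map_smul _ _ _⟩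
  · obtain ⟨x, hx, rfl⟩ := hx
    obtain ⟨y, hy, rfl⟩ := hy
    exact ⟨x + y, add_mem hx hy, map_add _ _ _⟩

/-- Writing elements of `A M` as values of finite free maps at vectors with entries in `A` makes
them accessible to the equational criterion. -/
theorem exists_linearMap_of_mem_idealSpan {x : M} (hx : x ∈ idealSpan A M) :
    ∃ (n : ℕ) (a : Fin n → R) (f : (Fin n → R) →ₗ[R] M), (∀ i, a i ∈ A) ∧ f a = x := by
  refine idealSpan_induction (p := fun x => ∃ (n : ℕ) (a : Fin n → R) (f : (Fin n → R) →ₗ[R] M),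
    (∀ i, a i ∈ A) ∧ f a = x) hx ⟨0, 0, 0, fun i => i.elim0, map_zero _⟩ (fun a ha m => ?_)
    fun x y hx hy => ?_
  · exact ⟨1, fun _ => a, LinearMap.toSpanSingleton R M m ∘ₗ LinearMap.proj 0, fun _ => ha, rfl⟩
  · obtain ⟨n, a, f, ha, rfl⟩ := hx
    obtain ⟨n', a', f', ha', rfl⟩ := hy
    refine ⟨n + n', Fin.append a a', f ∘ₗ LinearMap.funLeft R R (Fin.castAdd n') +
      f' ∘ₗ LinearMap.funLeft R R (Fin.natAdd n), fun i => ?_, ?_⟩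
    · induction i using Fin.addCases with
      | left i => simpa using ha i
      | right i => simpa using ha' i
    · simp only [LinearMap.add_apply, LinearMap.comp_apply]
      congr 2 <;> ext i <;> simp [LinearMap.funLeft_apply]

theorem map_mem_idealSpan_of_coord {n : ℕ} (f : (Fin n → R) →ₗ[R] M) {a : Fin n → R}
    (ha : ∀ i, a i ∈ A) : f a ∈ idealSpan A M := by
  classical
  have h : f a = ∑ i, a i • f (Pi.single i 1) := by
    conv_lhs => rw [← Finset.univ_sum_single a, map_sum]
    refine Finset.sum_congr rfl fun i _ => ?_
    rw [← map_smul, ← Pi.single_smul, smul_eq_mul, mul_one]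
  rw [h]
  exact sum_mem fun i _ => smul_mem_idealSpan (ha i) _

theorem idealSpan_eq_top_of_surjective {f : M →ₗ[R] N} (hf : Function.Surjective f)
    (h : idealSpan A M = ⊤) : idealSpan A N = ⊤ := by
  refine eq_top_iff.2 fun y _ => ?_
  obtain ⟨x, rfl⟩ := hf y
  exact map_mem_idealSpan f (h ▸ Submodule.mem_top)

theorem idealSpan_eq_top_of_extension {i : M' →ₗ[R] M} {p : M →ₗ[R] M''}
    (hip : ∀ x, p x = 0 → ∃ y, i y = x) (hp : Function.Surjective p)
    (h' : idealSpan A M' = ⊤) (h'' : idealSpan A M'' = ⊤) : idealSpan A M = ⊤ := by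
  refine eq_top_iff.2 fun x _ => ?_
  obtain ⟨y, hy, hyx⟩ := exists_mem_idealSpan_of_surjective (A := A) hp (y := p x)
    (h'' ▸ Submodule.mem_top)
  obtain ⟨z, hz⟩ := hip (x - y) (by simp [hyx])
  rw [← sub_add_cancel x y, ← hz]
  exact add_mem (map_mem_idealSpan i (h' ▸ Submodule.mem_top)) hy

theorem mem_idealSpan_prod {x : M} {y : N} :
    (x, y) ∈ idealSpan A (M × N) ↔ x ∈ idealSpan A M ∧ y ∈ idealSpan A N := by
  refine ⟨fun h => ⟨map_mem_idealSpan (LinearMap.fst R M N) h,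
    map_mem_idealSpan (LinearMap.snd R M N) h⟩, fun ⟨hx, hy⟩ => ?_⟩
  have := add_mem (map_mem_idealSpan (LinearMap.inl R M N) hx)
    (map_mem_idealSpan (LinearMap.inr R M N) hy)
  simpa using this

/-- The kernel of a map onto a flat module is pure: it meets `A M` in `A` times itself. -/
theorem EqFlat.exists_mem_idealSpan_of_map_eq_zero {i : M' →ₗ[R] M} {p : M →ₗ[R] M''}
    (hi : Function.Injective i) (hip : ∀ x, p x = 0 → ∃ y, i y = x) (hp : Function.Surjective p)
    (h'' : EqFlat R M'') {x : M} (hx : x ∈ idealSpan A M) (hpx : p x = 0) :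
    ∃ y ∈ idealSpan A M', i y = x := by
  -- The vector `a` is a relation for `p ∘ₗ f`. Trivialising it in `M''` and subtracting a lift
  -- changes `f` into a map to `M'` with the same value at `a`.
  obtain ⟨n, a, f, ha, rfl⟩ := exists_linearMap_of_mem_idealSpan hx
  obtain ⟨k, b, g, hg, hb⟩ := h'' n (p ∘ₗ f) a hpx
  obtain ⟨g₁, hg₁⟩ := exists_lift_of_surjective hp g
  obtain ⟨c, hc⟩ := exists_lift_of_injective hi (f - g₁ ∘ₗ b) fun y => hip _ (by
    have := hg y
    simp only [LinearMap.comp_apply] at this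
    simp [hg₁, this])
  exact ⟨c a, map_mem_idealSpan_of_coord c ha, by rw [hc]; simp [hb]⟩

variable (A) in
/-- Flat modules `M` with `A M = M`. -/
def IsFirmFlat (M : Type*) [AddCommGroup M] [Module R M] : Prop :=
  EqFlat R M ∧ idealSpan A M = ⊤

theorem IsFirmFlat.of_equiv (h : IsFirmFlat A M) (e : M ≃ₗ[R] N) : IsFirmFlat A N :=
  ⟨h.1.of_equiv e, idealSpan_eq_top_of_surjective (f := e.toLinearMap) e.surjective h.2⟩

theorem IsFirmFlat.of_extension {i : M' →ₗ[R] M} {p : M →ₗ[R] M''}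
    (hi : Function.Injective i) (hip : ∀ x, p x = 0 ↔ ∃ y, i y = x) (hp : Function.Surjective p)
    (h' : IsFirmFlat A M') (h'' : IsFirmFlat A M'') : IsFirmFlat A M :=
  ⟨.of_extension hi hip hp h'.1 h''.1,
    idealSpan_eq_top_of_extension (fun x => (hip x).1) hp h'.2 h''.2⟩

theorem IsFirmFlat.of_ker {i : M' →ₗ[R] M} {p : M →ₗ[R] M''}
    (hi : Function.Injective i) (hip : ∀ x, p x = 0 ↔ ∃ y, i y = x) (hp : Function.Surjective p)
    (h : IsFirmFlat A M) (h'' : EqFlat R M'') : IsFirmFlat A M' := by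
  refine ⟨.of_ker hi hip hp h.1 h'', eq_top_iff.2 fun y _ => ?_⟩
  obtain ⟨z, hz, hzy⟩ := h''.exists_mem_idealSpan_of_map_eq_zero hi (fun x => (hip x).1) hp
    (x := i y) (h.2 ▸ Submodule.mem_top) ((hip _).2 ⟨y, rfl⟩)
  exact hi hzy ▸ hz

/-- A jointly surjective family of maps from modules `M` with `A M = M` forces `A N = N`. -/
theorem idealSpan_eq_top_of_jointly_surjective
    (h : ∀ y : N, ∃ (M : Type u) (_ : AddCommGroup M) (_ : Module R M) (f : M →ₗ[R] N) (x : M),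
      idealSpan A M = ⊤ ∧ f x = y) : idealSpan A N = ⊤ := by
  refine eq_top_iff.2 fun y _ => ?_
  obtain ⟨M, _, _, f, x, hM, rfl⟩ := h y
  exact map_mem_idealSpan f (hM ▸ Submodule.mem_top)

theorem isFirmFlat_of_subsingleton [Subsingleton M] : IsFirmFlat A M :=
  ⟨EqFlat.of_free, Subsingleton.elim _ _⟩

end IdealSpan

end HUnitary
end

noncomputable section

namespace HUnitary

/-! ### h-unitarity in terms of projective resolutions -/

section Resolutions

variable {R : Type u} [Ring R] {A : TwoSidedIdeal R}

section Evaluation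

variable {M M' P₀ P₁ : ModuleCat.{u} R}

theorem evaluation_tensorMap (f : M →ₗ[R] M') (t : Tensor R A M) :
    evaluation A M' (tensorMap R LinearMap.id f t) = f (evaluation A M t) := by
  induction t using tensor_induction with
  | h0 => simp
  | ht n m => simp
  | ha s t hs ht => simp [hs, ht]

theorem exists_evaluation_eq_iff {x : M} :
    (∃ t, evaluation A M t = x) ↔ x ∈ idealSpan A M := by
  refine ⟨?_, fun hx => ?_⟩
  · rintro ⟨t, rfl⟩
    induction t using tensor_induction with
    | h0 => simp
    | ht n m => exact smul_mem_idealSpan n.2 m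
    | ha s t hs ht => rw [map_add]; exact add_mem hs ht
  · refine idealSpan_induction (p := fun x => ∃ t, evaluation A M t = x) hx ⟨0, map_zero _⟩
      (fun a ha m => ⟨tmul R ⟨a, ha⟩ m, rfl⟩) ?_
    rintro _ _ ⟨s, rfl⟩ ⟨t, rfl⟩
    exact ⟨s + t, map_add _ _ _⟩

theorem evaluation_surjective_iff :
    Function.Surjective (evaluation A M) ↔ idealSpan A M = ⊤ := by
  rw [eq_top_iff]
  exact ⟨fun h x _ => exists_evaluation_eq_iff.1 (h x), fun h x =>
    exists_evaluation_eq_iff.2 (h Submodule.mem_top)⟩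

/-- Evaluation is `A ⊗ M → R ⊗ M` followed by the isomorphism `R ⊗ M ≅ M`. On projectives it
therefore identifies `A ⊗ P` with `A P`. -/
theorem evaluation_injective (hM : EqFlat R M) : Function.Injective (evaluation A M) := by
  let i : A →ₗ[Rᵐᵒᵖ] R :=
    { toFun := fun a => (a : R)
      map_add' := fun _ _ => rfl
      map_smul' := fun _ _ => rfl }
  let φ : Tensor R R M →+ M := tensorLift (AddMonoidHom.mk' (fun r : R =>
      DistribSMul.toAddMonoidHom M r) (by intro a b; ext m; exact add_smul a b m))
    (fun r n m => mul_smul n r m)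
  have hφ : Function.Injective φ := by
    have h : ∀ t, tmul R (1 : R) (φ t) = t := by
      intro t
      induction t using tensor_induction with
      | h0 => simp [tmul_zero]
      | ht n m =>
        change tmul R (1 : R) (n • m) = _
        rw [← smul_tmul]
        simp
      | ha s t hs ht => rw [map_add, tmul_add, hs, ht]
    exact Function.LeftInverse.injective (g := fun m => tmul R (1 : R) m) h
  have h : ∀ t, evaluation A M t = φ (tensorMap R i LinearMap.id t) := by
    intro t
    induction t using tensor_induction with
    | h0 => simp
    | ht n m => rfl
    | ha s t hs ht => simp [hs, ht]
  intro s t hst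
  rw [h, h] at hst
  exact hM.isFlat A R i Subtype.val_injective (hφ hst)

theorem tensorMap_surjective {p : P₀ →ₗ[R] M} (hp : Function.Surjective p) :
    Function.Surjective (tensorMap R (LinearMap.id : A →ₗ[Rᵐᵒᵖ] A) p) := by
  intro t
  induction t using tensor_induction with
  | h0 => exact ⟨0, map_zero _⟩
  | ht n m =>
    obtain ⟨m, rfl⟩ := hp m
    exact ⟨tmul R n m, rfl⟩
  | ha s t hs ht =>
    obtain ⟨s, rfl⟩ := hs
    obtain ⟨t, rfl⟩ := ht
    exact ⟨s + t, map_add _ _ _⟩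

/-- Right exactness: choosing preimages under `p` gives a well-defined map from `A ⊗ M` back to the
cokernel of `A ⊗ P₁ → A ⊗ P₀`. -/
theorem tensorMap_exact {d : P₁ →ₗ[R] P₀} {p : P₀ →ₗ[R] M} (hp : Function.Surjective p)
    (hpd : ∀ x, p x = 0 → ∃ y, d y = x) (t : Tensor R A P₀)
    (ht : tensorMap R LinearMap.id p t = 0) : ∃ s, tensorMap R LinearMap.id d s = t := by
  choose l hl using hp
  let S := (tensorMap R (LinearMap.id : A →ₗ[Rᵐᵒᵖ] A) d).range
  have key : ∀ (a : A) x y, p x = p y →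
      (QuotientAddGroup.mk (tmul R a x) : Tensor R A P₀ ⧸ S) =
        QuotientAddGroup.mk (tmul R a y) := by
    intro a x y hxy
    obtain ⟨z, hz⟩ := hpd (-x + y) (by simp [hxy])
    rw [QuotientAddGroup.eq]
    refine ⟨tmul R a z, ?_⟩
    rw [tensorMap_tmul, hz]
    simp only [← tmulHom_apply, map_add, map_neg, LinearMap.id_apply]
  let φ : Tensor R A M →+ Tensor R A P₀ ⧸ S := tensorLift (AddMonoidHom.mk' (fun a =>
      AddMonoidHom.mk' (fun m => QuotientAddGroup.mk (tmul R a (l m))) (by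
        intro m m'
        rw [← QuotientAddGroup.mk_add, ← tmul_add]
        exact key _ _ _ (by simp [hl]))) (by
      intro a a'
      ext m
      simp [add_tmul])) (by
    intro r a m
    change (QuotientAddGroup.mk (tmul R _ (l m)) : Tensor R A P₀ ⧸ S) =
      QuotientAddGroup.mk (tmul R a (l (r • m)))
    rw [smul_tmul]
    exact key _ _ _ (by simp [hl]))
  have hφ : ∀ t, φ (tensorMap R LinearMap.id p t) = QuotientAddGroup.mk t := by
    intro t
    induction t using tensor_induction with
    | h0 => simp
    | ht a x => exact key a _ _ (by simp [hl])
    | ha s t hs ht => simp [hs, ht]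
  have h := hφ t
  rw [ht, map_zero, eq_comm, QuotientAddGroup.eq_zero_iff] at h
  exact h

end Evaluation

variable {M : ModuleCat.{u} R}

theorem isZero_tor_succ_iff (P : ProjectiveResolution M) (n : ℕ) :
    Limits.IsZero (tor R A (n + 1) M) ↔ ∀ t : Tensor R A (P.complex.X (n + 1)),
      tensorMap R LinearMap.id (P.complex.d (n + 1) n).hom t = 0 →
        ∃ s, tensorMap R LinearMap.id (P.complex.d (n + 2) (n + 1)).hom s = t := by
  rw [tor, (P.isoLeftDerivedObj (tensorFunctor R A) (n + 1)).isZero_iff]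
  refine (HomologicalComplex.exactAt_iff_isZero_homology _ _).symm.trans ?_
  rw [HomologicalComplex.exactAt_iff' _ (n + 2) (n + 1) n (by simp) (by simp),
    ShortComplex.ab_exact_iff]
  rfl

/-- The augmentation of a projective resolution. -/
def augmentation (P : ProjectiveResolution M) : P.complex.X 0 →ₗ[R] M := (P.π.f 0).hom

theorem resolution_π_surjective (P : ProjectiveResolution M) :
    Function.Surjective (augmentation P) :=
  (ModuleCat.epi_iff_surjective (P.π.f 0)).1 inferInstance

theorem resolution_exact_zero (P : ProjectiveResolution M) (x : P.complex.X 0)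
    (hx : (augmentation P) x = 0) : ∃ y, (P.complex.d 1 0).hom y = x :=
  (ShortComplex.moduleCat_exact_iff _).1 P.exact₀ x hx

theorem resolution_exact_succ (P : ProjectiveResolution M) (n : ℕ) (x : P.complex.X (n + 1))
    (hx : (P.complex.d (n + 1) n).hom x = 0) : ∃ y, (P.complex.d (n + 2) (n + 1)).hom y = x :=
  (ShortComplex.moduleCat_exact_iff _).1 (P.exact_succ n) x hx

theorem resolution_d_comp_d (P : ProjectiveResolution M) (n : ℕ) (x : P.complex.X (n + 2)) :
    (P.complex.d (n + 1) n).hom ((P.complex.d (n + 2) (n + 1)).hom x) = 0 := by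
  have := P.complex.d_comp_d (n + 2) (n + 1) n
  exact LinearMap.congr_fun (congrArg ModuleCat.Hom.hom this) x

theorem resolution_π_comp_d (P : ProjectiveResolution M) (x : P.complex.X 1) :
    (augmentation P) ((P.complex.d 1 0).hom x) = 0 :=
  LinearMap.congr_fun (congrArg ModuleCat.Hom.hom P.complex_d_comp_π_f_zero) x

theorem eqFlat_of_projective (P : ModuleCat.{u} R) [Projective P] : EqFlat R P := by
  have : Module.Projective R P := IsProjective.iff_projective P |>.2 inferInstance
  obtain ⟨s, hs⟩ := Module.projective_def'.1 this
  exact (EqFlat.of_free (R := R) (Q := P →₀ R)).of_retract s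
    (Finsupp.linearCombination R id) (LinearMap.congr_fun hs)

variable (A) in
/-- Acyclicity of the complex `P / A P`. -/
def ExactModIdeal (P : ChainComplex (ModuleCat.{u} R) ℕ) : Prop :=
  (∀ x : P.X 0, ∃ y : P.X 1, x - (P.d 1 0).hom y ∈ idealSpan A (P.X 0)) ∧
    ∀ (n : ℕ) (x : P.X (n + 1)), (P.d (n + 1) n).hom x ∈ idealSpan A (P.X n) →
      ∃ y : P.X (n + 2), x - (P.d (n + 2) (n + 1)).hom y ∈ idealSpan A (P.X (n + 1))

theorem isZero_tor_succ_iff_idealSpan (P : ProjectiveResolution M) (n : ℕ) :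
    Limits.IsZero (tor R A (n + 1) M) ↔ ∀ x ∈ idealSpan A (P.complex.X (n + 1)),
      (P.complex.d (n + 1) n).hom x = 0 →
        ∃ y ∈ idealSpan A (P.complex.X (n + 2)), (P.complex.d (n + 2) (n + 1)).hom y = x := by
  rw [isZero_tor_succ_iff P]
  have hinj : ∀ n, Function.Injective (evaluation A (P.complex.X n)) := fun n =>
    evaluation_injective (eqFlat_of_projective _)
  refine ⟨fun h x hx hx0 => ?_, fun h t ht => ?_⟩
  · obtain ⟨t, rfl⟩ := exists_evaluation_eq_iff.2 hx
    obtain ⟨s, rfl⟩ := h t (hinj _ (by rw [evaluation_tensorMap, hx0, map_zero]))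
    exact ⟨_, exists_evaluation_eq_iff.1 ⟨s, rfl⟩, (evaluation_tensorMap _ _).symm⟩
  · obtain ⟨y, hy, hyt⟩ := h _ (exists_evaluation_eq_iff.1 ⟨t, rfl⟩)
      (by rw [← evaluation_tensorMap, ht, map_zero])
    obtain ⟨s, rfl⟩ := exists_evaluation_eq_iff.2 hy
    exact ⟨s, hinj _ (by rw [evaluation_tensorMap, hyt])⟩

/-- A module is h-unitary if and only if `P / A P` is acyclic for a projective resolution `P`. -/
theorem isHUnitary_iff (P : ProjectiveResolution M) :
    IsHUnitary A M ↔ ExactModIdeal A P.complex := by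
  have hinj : ∀ n, Function.Injective (evaluation A (P.complex.X n)) := fun n =>
    evaluation_injective (eqFlat_of_projective _)
  constructor
  · rintro ⟨⟨hi, hs⟩, ht⟩
    refine ⟨fun x => ?_, fun n x hx => ?_⟩
    · obtain ⟨z, hz, hzx⟩ := exists_mem_idealSpan_of_surjective (A := A)
        (resolution_π_surjective P) (y := (augmentation P) x)
        (evaluation_surjective_iff.1 hs ▸ Submodule.mem_top)
      obtain ⟨y, hy⟩ := resolution_exact_zero P (x - z) (by rw [map_sub, hzx, sub_self])
      exact ⟨y, by rw [hy]; simpa using hz⟩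
    · suffices ∃ z ∈ idealSpan A (P.complex.X (n + 1)),
          (P.complex.d (n + 1) n).hom z = (P.complex.d (n + 1) n).hom x by
        obtain ⟨z, hz, hzx⟩ := this
        obtain ⟨y, hy⟩ := resolution_exact_succ P n (x - z) (by rw [map_sub, hzx, sub_self])
        exact ⟨y, by rw [hy]; simpa using hz⟩
      cases n with
      | zero =>
        obtain ⟨t, ht⟩ := exists_evaluation_eq_iff.2 hx
        obtain ⟨s, rfl⟩ := tensorMap_exact (d := (P.complex.d 1 0).hom)
          (resolution_π_surjective P) (resolution_exact_zero P) t
          (hi (by rw [evaluation_tensorMap, ht, map_zero]; exact resolution_π_comp_d P x))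
        exact ⟨_, exists_evaluation_eq_iff.1 ⟨s, rfl⟩, by rw [← ht, evaluation_tensorMap]⟩
      | succ n =>
        exact (isZero_tor_succ_iff_idealSpan P n).1 (ht (n + 1) (by omega)) _ hx
          (resolution_d_comp_d P n x)
  · rintro ⟨h0, h1⟩
    have h2 : ∀ n, ∀ x : P.complex.X (n + 1),
        (P.complex.d (n + 1) n).hom x ∈ idealSpan A (P.complex.X n) →
        ∃ z ∈ idealSpan A (P.complex.X (n + 1)),
          (P.complex.d (n + 1) n).hom z = (P.complex.d (n + 1) n).hom x := by
      intro n x hx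
      obtain ⟨y, hy⟩ := h1 n x hx
      exact ⟨_, hy, by rw [map_sub, resolution_d_comp_d, sub_zero]⟩
    refine ⟨⟨?_, evaluation_surjective_iff.2 (eq_top_iff.2 fun m _ => ?_)⟩, fun i hi => ?_⟩
    · rw [injective_iff_map_eq_zero]
      intro t ht
      obtain ⟨t, rfl⟩ := tensorMap_surjective (resolution_π_surjective P) t
      rw [evaluation_tensorMap] at ht
      obtain ⟨x, hx⟩ := resolution_exact_zero P _ ht
      obtain ⟨z, hz, hzx⟩ := h2 0 x (hx ▸ exists_evaluation_eq_iff.1 ⟨t, rfl⟩)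
      obtain ⟨s, rfl⟩ := exists_evaluation_eq_iff.2 hz
      have h3 : t = tensorMap R LinearMap.id (P.complex.d 1 0).hom s :=
        hinj 0 (by rw [evaluation_tensorMap, hzx, hx])
      rw [h3, tensorMap_comp_apply]
      have h4 : (augmentation P) ∘ₗ (P.complex.d 1 0).hom = 0 :=
        LinearMap.ext (resolution_π_comp_d P)
      rw [h4]
      clear * -
      induction s using tensor_induction with
      | h0 => simp
      | ht n m => simp [tmul_zero]
      | ha s t hs ht => rw [map_add, hs, ht, add_zero]
    · obtain ⟨x, rfl⟩ := resolution_π_surjective P m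
      obtain ⟨y, hy⟩ := h0 x
      have := map_mem_idealSpan (augmentation P) hy
      rwa [map_sub, resolution_π_comp_d, sub_zero] at this
    · obtain ⟨n, rfl⟩ := Nat.exists_eq_add_of_le' hi
      refine (isZero_tor_succ_iff_idealSpan P n).2 fun x hx hx0 => ?_
      obtain ⟨y, rfl⟩ := resolution_exact_succ P n x hx0
      exact h2 (n + 1) y hx

end Resolutions

end HUnitary
end

noncomputable section

namespace HUnitary

/-! ### Mapping cones of maps of projective resolutions -/

section Cones

variable {R : Type u} [Ring R] {A : TwoSidedIdeal R}

/-- An elementwise exact sequence of projective modules is a projective resolution. -/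
theorem exists_projectiveResolution {M : ModuleCat.{u} R} (X : ℕ → ModuleCat.{u} R)
    (d : ∀ n, X (n + 1) ⟶ X n) (sq : ∀ n, d (n + 1) ≫ d n = 0) (ε : X 0 ⟶ M)
    (hX : ∀ n, Projective (X n)) (hε : Function.Surjective ε.hom) (hdε : d 0 ≫ ε = 0)
    (h0 : ∀ x, ε.hom x = 0 → ∃ y, (d 0).hom y = x)
    (h1 : ∀ n x, (d n).hom x = 0 → ∃ y, (d (n + 1)).hom y = x) :
    ∃ P : ProjectiveResolution M, P.complex = ChainComplex.of X d sq := by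
  have e0 : (ShortComplex.mk (d 0) ε hdε).Exact := (ShortComplex.moduleCat_exact_iff _).2 h0
  have epi : Epi ε := (ModuleCat.epi_iff_surjective _).2 hε
  have h10 : (ChainComplex.of X d sq).d 1 0 ≫ ε = 0 := by
    rw [show (ChainComplex.of X d sq).d 1 0 = d 0 from ChainComplex.of_d X d 0]
    exact hdε
  have hf := ChainComplex.toSingle₀Equiv_symm_apply_f_zero (C := ChainComplex.of X d sq) ε h10
  refine ⟨{ complex := ChainComplex.of X d sq
            projective := hX
            π := (ChainComplex.toSingle₀Equiv _ _).symm ⟨ε, h10⟩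
            quasiIso := ⟨fun n => ?_⟩ }, rfl⟩
  cases n with
  | zero =>
    rw [ChainComplex.quasiIsoAt₀_iff, ShortComplex.quasiIso_iff_of_zeros']
    · dsimp
      refine (ShortComplex.exact_and_epi_g_iff_of_iso ?_).2 ⟨e0, epi⟩
      exact ShortComplex.isoMk (Iso.refl _) (Iso.refl _) (Iso.refl _)
        ((Category.id_comp _).trans
          ((ChainComplex.of_d X d 0).symm.trans (Category.comp_id _).symm))
        ((Category.id_comp ε).trans (Eq.trans hf.symm (Category.comp_id _).symm))
    all_goals rfl
  | succ n =>
    rw [quasiIsoAt_iff_exactAt']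
    · rw [HomologicalComplex.exactAt_iff' _ (n + 1 + 1) (n + 1) n (by simp) (by simp)]
      refine (ShortComplex.moduleCat_exact_iff _).2 ?_
      change ∀ x, (ChainComplex.of.d X d (n + 1) n).hom x = 0 →
        ∃ y, (ChainComplex.of.d X d (n + 1 + 1) (n + 1)).hom y = x
      rw [ChainComplex.of_d, ChainComplex.of_d]
      exact h1 n
    · apply ChainComplex.exactAt_succ_single_obj

variable {M' M : ModuleCat.{u} R} (P' : ProjectiveResolution M') (P : ProjectiveResolution M)
  (φ : P'.complex ⟶ P.complex)

/-- The terms of the mapping cone. -/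
def coneX : ℕ → ModuleCat.{u} R
  | 0 => P.complex.X 0
  | n + 1 => ModuleCat.of R (P.complex.X (n + 1) × P'.complex.X n)

/-- The differential of the mapping cone. -/
def coneD : ∀ n, coneX P' P (n + 1) ⟶ coneX P' P n
  | 0 => ModuleCat.ofHom ((P.complex.d 1 0).hom.coprod (φ.f 0).hom)
  | n + 1 => ModuleCat.ofHom (((P.complex.d (n + 2) (n + 1)).hom.coprod (φ.f (n + 1)).hom).prod
      ((-(P'.complex.d (n + 1) n).hom) ∘ₗ LinearMap.snd R _ _))

theorem coneD_zero_apply (x : P.complex.X 1) (y : P'.complex.X 0) :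
    (coneD P' P φ 0).hom ((x, y) : P.complex.X 1 × P'.complex.X 0) =
      (P.complex.d 1 0).hom x + (φ.f 0).hom y := rfl

theorem coneD_succ_apply (n : ℕ) (x : P.complex.X (n + 2)) (y : P'.complex.X (n + 1)) :
    (coneD P' P φ (n + 1)).hom ((x, y) : P.complex.X (n + 2) × P'.complex.X (n + 1)) =
      (((P.complex.d (n + 2) (n + 1)).hom x + (φ.f (n + 1)).hom y,
        -(P'.complex.d (n + 1) n).hom y) : P.complex.X (n + 1) × P'.complex.X n) := rfl

theorem chainMap_comm (n : ℕ) (y : P'.complex.X (n + 1)) :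
    (P.complex.d (n + 1) n).hom ((φ.f (n + 1)).hom y) =
      (φ.f n).hom ((P'.complex.d (n + 1) n).hom y) :=
  LinearMap.congr_fun (congrArg ModuleCat.Hom.hom (φ.comm (n + 1) n)) y

theorem coneD_comp_coneD (n : ℕ) : coneD P' P φ (n + 1) ≫ coneD P' P φ n = 0 := by
  apply ModuleCat.hom_ext
  refine LinearMap.ext fun z => ?_
  obtain ⟨x, y⟩ : P.complex.X (n + 2) × P'.complex.X (n + 1) := z
  change (coneD P' P φ n).hom ((coneD P' P φ (n + 1)).hom (x, y)) = 0
  rw [coneD_succ_apply]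
  cases n with
  | zero =>
    rw [coneD_zero_apply, map_add, resolution_d_comp_d, chainMap_comm, map_neg]
    simp
    rfl
  | succ n =>
    rw [coneD_succ_apply, map_add, resolution_d_comp_d, chainMap_comm, map_neg, map_neg,
      resolution_d_comp_d]
    simp
    rfl

/-- The mapping cone of a lift of an injective map is a resolution of the cokernel. -/
theorem exists_resolution_cone {M'' : ModuleCat.{u} R} {f : M' →ₗ[R] M} {g : M →ₗ[R] M''}
    (hf : Function.Injective f) (hfg : ∀ x, g x = 0 ↔ ∃ y, f y = x)
    (hg : Function.Surjective g)
    (hφ : ∀ x, augmentation P ((φ.f 0).hom x) = f (augmentation P' x)) :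
    ∃ P'' : ProjectiveResolution M'',
      P''.complex = ChainComplex.of (coneX P' P) (coneD P' P φ) (coneD_comp_coneD P' P φ) := by
  -- If `y = d y'`, then `x + φ y'` is a cycle of the resolution `P`, hence some `d x'`, and `(x',
  -- -y')` bounds `(x, y)`.
  have key : ∀ (n : ℕ) (x : P.complex.X (n + 1)) (y : P'.complex.X n),
      (P.complex.d (n + 1) n).hom x + (φ.f n).hom y = 0 →
      (∃ y', (P'.complex.d (n + 1) n).hom y' = y) →
      ∃ (x' : P.complex.X (n + 2)) (y' : P'.complex.X (n + 1)),
        (P.complex.d (n + 2) (n + 1)).hom x' + (φ.f (n + 1)).hom y' = x ∧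
          -(P'.complex.d (n + 1) n).hom y' = y := by
    rintro n x _ hxy ⟨y', rfl⟩
    rw [← chainMap_comm, ← map_add] at hxy
    obtain ⟨x', hx'⟩ := resolution_exact_succ P n _ hxy
    exact ⟨x', -y', by rw [hx', map_neg]; abel, by rw [map_neg, neg_neg]⟩
  refine exists_projectiveResolution _ _ _ (ModuleCat.ofHom (g ∘ₗ augmentation P)) ?_
    (hg.comp (resolution_π_surjective P)) ?_ ?_ ?_
  · rintro (_ | n)
    · exact P.projective 0
    · have h1 : Module.Projective R (P.complex.X (n + 1)) :=
        (IsProjective.iff_projective _).2 (P.projective _)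
      have h2 : Module.Projective R (P'.complex.X n) :=
        (IsProjective.iff_projective _).2 (P'.projective _)
      exact (IsProjective.iff_projective (R := R) (P.complex.X (n + 1) × P'.complex.X n)).1
        inferInstance
  · apply ModuleCat.hom_ext
    refine LinearMap.ext fun z => ?_
    obtain ⟨x, y⟩ : P.complex.X 1 × P'.complex.X 0 := z
    change g (augmentation P ((coneD P' P φ 0).hom (x, y))) = 0
    rw [coneD_zero_apply, map_add, resolution_π_comp_d, zero_add, hφ, hfg]
    exact ⟨_, rfl⟩
  · intro (x : P.complex.X 0) hx
    obtain ⟨m, hm⟩ := (hfg _).1 hx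
    obtain ⟨y, rfl⟩ := resolution_π_surjective P' m
    obtain ⟨z, hz⟩ := resolution_exact_zero P (x - (φ.f 0).hom y)
      (by rw [map_sub, hφ, hm]; exact sub_self _)
    refine ⟨(z, y), ?_⟩
    rw [coneD_zero_apply, hz]
    exact sub_add_cancel _ _
  · intro n z hz
    cases n with
    | zero =>
      obtain ⟨x, y⟩ : P.complex.X 1 × P'.complex.X 0 := z
      rw [coneD_zero_apply] at hz
      have h1 : augmentation P' y = 0 := hf (by
        have := congrArg (augmentation P) hz
        rw [map_add, resolution_π_comp_d, zero_add, hφ] at this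
        rw [map_zero, this]
        exact map_zero _)
      obtain ⟨x', y', hx', hy'⟩ := key 0 x y hz (resolution_exact_zero P' y h1)
      exact ⟨(x', y'), (coneD_succ_apply P' P φ 0 x' y').trans (Prod.ext hx' hy')⟩
    | succ n =>
      obtain ⟨x, y⟩ : P.complex.X (n + 2) × P'.complex.X (n + 1) := z
      rw [coneD_succ_apply] at hz
      have hz1 := congrArg Prod.fst hz
      have hz2 := congrArg Prod.snd hz
      obtain ⟨x', y', hx', hy'⟩ := key (n + 1) x y hz1
        (resolution_exact_succ P' n y (neg_eq_zero.1 hz2))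
      exact ⟨(x', y'), (coneD_succ_apply P' P φ (n + 1) x' y').trans (Prod.ext hx' hy')⟩

/-- The cone modulo `A` is the cone of `P' / A P' → P / A P`. The quantifier over `k` with `k + 1 =
n` treats uniformly degree 0, where `P'` has no outgoing differential, and the positive degrees. -/
theorem exactModIdeal_cone_iff :
    ExactModIdeal A (ChainComplex.of (coneX P' P) (coneD P' P φ) (coneD_comp_coneD P' P φ)) ↔
      (∀ x : P.complex.X 0, ∃ (x' : P.complex.X 1) (y' : P'.complex.X 0),
        x - ((P.complex.d 1 0).hom x' + (φ.f 0).hom y') ∈ idealSpan A (P.complex.X 0)) ∧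
      ∀ (n : ℕ) (x : P.complex.X (n + 1)) (y : P'.complex.X n),
        (P.complex.d (n + 1) n).hom x + (φ.f n).hom y ∈ idealSpan A (P.complex.X n) →
        (∀ k, k + 1 = n → (P'.complex.d n k).hom y ∈ idealSpan A (P'.complex.X k)) →
        ∃ (x' : P.complex.X (n + 2)) (y' : P'.complex.X (n + 1)),
          x - ((P.complex.d (n + 2) (n + 1)).hom x' + (φ.f (n + 1)).hom y') ∈
            idealSpan A (P.complex.X (n + 1)) ∧
          y + (P'.complex.d (n + 1) n).hom y' ∈ idealSpan A (P'.complex.X n) := by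
  have hd : ∀ n, ChainComplex.of.d (coneX P' P) (coneD P' P φ) (n + 1) n = coneD P' P φ n :=
    fun n =>
    ChainComplex.of_d _ _ n
  unfold ExactModIdeal
  simp only [hd]
  refine and_congr ?_ ?_
  · constructor
    · intro h x
      obtain ⟨⟨x', y'⟩, h⟩ := h x
      exact ⟨x', y', h⟩
    · intro h x
      obtain ⟨x', y', h⟩ := h x
      exact ⟨(x', y'), h⟩
  · have e : ∀ n (x : P.complex.X (n + 1)) (y : P'.complex.X n),
        (∃ z, (show coneX P' P (n + 1) from (x, y)) - (coneD P' P φ (n + 1)).hom z ∈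
          idealSpan A (coneX P' P (n + 1))) ↔
        ∃ (x' : P.complex.X (n + 2)) (y' : P'.complex.X (n + 1)),
          x - ((P.complex.d (n + 2) (n + 1)).hom x' + (φ.f (n + 1)).hom y') ∈
            idealSpan A (P.complex.X (n + 1)) ∧
          y + (P'.complex.d (n + 1) n).hom y' ∈ idealSpan A (P'.complex.X n) := by
      intro n x y
      constructor
      · rintro ⟨⟨x', y'⟩, h⟩
        have h' := (mem_idealSpan_prod (x := x - ((P.complex.d (n + 2) (n + 1)).hom x' +
          (φ.f (n + 1)).hom y')) (y := y - -(P'.complex.d (n + 1) n).hom y')).1 h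
        rw [sub_neg_eq_add] at h'
        exact ⟨x', y', h'⟩
      · rintro ⟨x', y', h⟩
        refine ⟨(x', y'), ?_⟩
        refine (mem_idealSpan_prod (x := x - ((P.complex.d (n + 2) (n + 1)).hom x' +
          (φ.f (n + 1)).hom y')) (y := y - -(P'.complex.d (n + 1) n).hom y')).2 ?_
        rw [sub_neg_eq_add]
        exact h
    have e' : ∀ n, ∀ z : P.complex.X (n + 1) × P'.complex.X n,
        ((coneD P' P φ n).hom z ∈ idealSpan A (coneX P' P n) ↔
        (P.complex.d (n + 1) n).hom z.1 + (φ.f n).hom z.2 ∈ idealSpan A (P.complex.X n) ∧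
        (∀ k, k + 1 = n → (P'.complex.d n k).hom z.2 ∈ idealSpan A (P'.complex.X k))) := by
      intro n z
      cases n with
      | zero => exact ⟨fun h => ⟨h, fun k hk => by omega⟩, fun h => h.1⟩
      | succ n =>
        refine mem_idealSpan_prod.trans (and_congr Iff.rfl ?_)
        change -(P'.complex.d (n + 1) n).hom z.2 ∈ _ ↔ _
        rw [neg_mem_iff]
        constructor
        · rintro h k hk
          obtain rfl : k = n := by omega
          exact h
        · exact fun h => h n rfl
    constructor
    · intro h n x y h1 h2
      exact (e n x y).1 (h n (x, y) ((e' n (x, y)).2 ⟨h1, h2⟩))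
    · rintro h n ⟨x, y⟩ h1
      have h1' := (e' n (x, y)).1 h1
      exact (e n x y).2 (h n x y h1'.1 h1'.2)

end Cones

/-! ### Two-out-of-three for h-unitary modules and the description of flat ones -/

section TwoOfThree

variable {R : Type u} [Ring R] {A : TwoSidedIdeal R} {M' M M'' : ModuleCat.{u} R}

/-- Extensions of h-unitary modules are h-unitary, and so is the kernel of a surjection between
h-unitary modules. -/
theorem isHUnitary_two_of_three {f : M' →ₗ[R] M} {g : M →ₗ[R] M''}
    (hf : Function.Injective f) (hfg : ∀ x, g x = 0 ↔ ∃ y, f y = x)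
    (hg : Function.Surjective g) (h'' : IsHUnitary A M'') :
    IsHUnitary A M' ↔ IsHUnitary A M := by
  let P' := projectiveResolution M'
  let P := projectiveResolution M
  let φ := ProjectiveResolution.lift (ModuleCat.ofHom f) P' P
  have hφ : ∀ x, augmentation P ((φ.f 0).hom x) = f (augmentation P' x) := fun x =>
    LinearMap.congr_fun (congrArg ModuleCat.Hom.hom
      (ProjectiveResolution.lift_commutes_zero (ModuleCat.ofHom f) P' P)) x
  -- Since the cone resolves `M''`, the cone of `P' / A P' → P / A P` is acyclic. Both implications
  -- chase acyclicity from one side of this map to the other.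
  obtain ⟨P'', hP''⟩ := exists_resolution_cone P' P φ hf hfg hg hφ
  rw [isHUnitary_iff P'', hP'', exactModIdeal_cone_iff] at h''
  obtain ⟨c0, c1⟩ := h''
  rw [isHUnitary_iff P', isHUnitary_iff P]
  have hS : ∀ n, ∀ y : P'.complex.X n, y ∈ idealSpan A (P'.complex.X n) →
      (φ.f n).hom y ∈ idealSpan A (P.complex.X n) := fun n y hy => map_mem_idealSpan _ hy
  constructor
  · rintro ⟨h0, h1⟩
    refine ⟨fun x => ?_, fun n x hx => ?_⟩
    · obtain ⟨x', y', hx'⟩ := c0 x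
      obtain ⟨y, hy⟩ := h0 y'
      refine ⟨x' + (φ.f 1).hom y, ?_⟩
      have := add_mem hx' (hS 0 _ hy)
      rw [map_sub, ← chainMap_comm P' P φ] at this
      rw [map_add]
      convert this using 1
      abel
    · obtain ⟨x', y', hx', hy'⟩ := c1 n x 0 (by simpa using hx) (by simp)
      rw [zero_add] at hy'
      obtain ⟨y, hy⟩ := h1 n y' hy'
      refine ⟨x' + (φ.f (n + 2)).hom y, ?_⟩
      have := add_mem hx' (hS _ _ hy)
      rw [map_sub, ← chainMap_comm P' P φ] at this
      rw [map_add]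
      convert this using 1
      abel
  · rintro ⟨h0, h1⟩
    refine ⟨fun y => ?_, fun n y hy => ?_⟩
    · obtain ⟨x, hx⟩ := h0 ((φ.f 0).hom y)
      obtain ⟨x', y', -, hy'⟩ := c1 0 (-x) y (by rw [map_neg]; convert hx using 1; abel)
        (fun k hk => by omega)
      exact ⟨-y', by rwa [map_neg, sub_neg_eq_add]⟩
    · obtain ⟨x, hx⟩ := h1 n ((φ.f (n + 1)).hom y) (by
        rw [chainMap_comm]; exact hS n _ hy)
      obtain ⟨x', y', -, hy'⟩ := c1 (n + 1) (-x) y (by rw [map_neg]; convert hx using 1; abel)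
        (fun k hk => by obtain rfl : k = n := by omega
                        exact hy)
      exact ⟨-y', by rwa [map_neg, sub_neg_eq_add]⟩

/-- All syzygies of a flat module are flat, so each image of a differential is pure in the term
containing it. If `d x` lies in `A P`, it then lies in `A` times that image, and lifts to `A P` one
degree higher. -/
theorem isHUnitary_of_isFirmFlat (h : IsFirmFlat A M) : IsHUnitary A M := by
  let P := projectiveResolution M
  have hZ : ∀ n, EqFlat R (LinearMap.range (P.complex.d (n + 1) n).hom) := by
    intro n
    induction n with
    | zero =>
      refine EqFlat.of_ker (i := Submodule.subtype _) (p := augmentation P)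
        (Submodule.subtype_injective _) (fun x => ?_) (resolution_π_surjective P)
        (eqFlat_of_projective _) h.1
      constructor
      · intro hx
        exact ⟨⟨x, resolution_exact_zero P x hx⟩, rfl⟩
      · rintro ⟨⟨_, ⟨z, rfl⟩⟩, rfl⟩
        exact resolution_π_comp_d P z
    | succ n ih =>
      refine EqFlat.of_ker (i := Submodule.subtype _)
        (p := (P.complex.d (n + 1) n).hom.rangeRestrict)
        (Submodule.subtype_injective _) (fun x => ?_) (LinearMap.surjective_rangeRestrict _)
        (eqFlat_of_projective _) ih
      rw [← Subtype.coe_inj]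
      constructor
      · intro hx
        exact ⟨⟨x, resolution_exact_succ P n x hx⟩, rfl⟩
      · rintro ⟨⟨_, ⟨z, rfl⟩⟩, rfl⟩
        exact resolution_d_comp_d P n z
  refine (isHUnitary_iff P).2 ⟨fun x => ?_, fun n x hx => ?_⟩
  · obtain ⟨z, hz, hzx⟩ := exists_mem_idealSpan_of_surjective (A := A)
      (resolution_π_surjective P) (y := augmentation P x) (h.2 ▸ Submodule.mem_top)
    obtain ⟨y, hy⟩ := resolution_exact_zero P (x - z) (by rw [map_sub, hzx, sub_self])
    exact ⟨y, by rw [hy]; simpa using hz⟩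
  · obtain ⟨w, hw, hwx⟩ : ∃ w ∈ idealSpan A (LinearMap.range (P.complex.d (n + 1) n).hom),
        (w : P.complex.X n) = (P.complex.d (n + 1) n).hom x := by
      cases n with
      | zero =>
        exact h.1.exists_mem_idealSpan_of_map_eq_zero (i := Submodule.subtype _)
          (p := augmentation P) (Submodule.subtype_injective _)
          (fun x hx => ⟨⟨x, resolution_exact_zero P x hx⟩, rfl⟩) (resolution_π_surjective P) hx
          (resolution_π_comp_d P x)
      | succ n =>
        exact (hZ n).exists_mem_idealSpan_of_map_eq_zero (i := Submodule.subtype _)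
          (p := (P.complex.d (n + 1) n).hom.rangeRestrict) (Submodule.subtype_injective _)
          (fun x hx => ⟨⟨x, resolution_exact_succ P n x (congrArg Subtype.val hx)⟩, rfl⟩)
          (LinearMap.surjective_rangeRestrict _) hx (Subtype.ext (resolution_d_comp_d P n x))
    obtain ⟨z, hz, rfl⟩ := exists_mem_idealSpan_of_surjective
      (f := (P.complex.d (n + 1) n).hom.rangeRestrict) (LinearMap.surjective_rangeRestrict _) hw
    obtain ⟨y, hy⟩ := resolution_exact_succ P n (x - z) (by
      rw [map_sub, ← hwx]; exact sub_self _)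
    exact ⟨y, by rw [hy]; simpa using hz⟩

theorem IsHUnitary.idealSpan_eq_top (h : IsHUnitary A M) : idealSpan A M = ⊤ :=
  evaluation_surjective_iff.1 h.1.2

theorem isHUnitaryFlat_iff : IsHUnitaryFlat A M ↔ IsFirmFlat A M :=
  ⟨fun h => ⟨h.2.eqFlat, h.1.idealSpan_eq_top⟩,
    fun h => ⟨isHUnitary_of_isFirmFlat h, h.1.isFlat⟩⟩

theorem isHUnitary_of_linearEquiv (e : M' ≃ₗ[R] M) (h : IsHUnitary A M') : IsHUnitary A M :=
  (isHUnitary_two_of_three (f := e.toLinearMap) (g := (0 : M →ₗ[R] ModuleCat.of R PUnit.{u + 1}))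
    e.injective (fun x => by simpa using e.surjective x) (fun _ => ⟨0, Subsingleton.elim _ _⟩)
    (isHUnitary_of_isFirmFlat (isFirmFlat_of_subsingleton (M := PUnit.{u + 1})))).1 h

end TwoOfThree

end HUnitary
end

noncomputable section

namespace HUnitary

/-! ### Directed colimits of flat modules -/

section DirectedColimits

variable {R : Type*} [Ring R] {M : Type*} [AddCommGroup M] [Module R M]

/-- A directed colimit of flat modules is flat. -/
theorem EqFlat.of_directed {J : Type*} [Preorder J] [IsDirected J (· ≤ ·)] [Nonempty J]
    (Q : J → Type u) [∀ j, AddCommGroup (Q j)] [∀ j, Module R (Q j)]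
    (t : ∀ i j, i ≤ j → Q i →ₗ[R] Q j) (c : ∀ j, Q j →ₗ[R] M)
    (hc : ∀ i j h x, c j (t i j h x) = c i x) (hsurj : ∀ y, ∃ j x, c j x = y)
    (hinj : ∀ i x, c i x = 0 → ∃ j, ∃ h : i ≤ j, t i j h x = 0)
    (hQ : ∀ j, EqFlat R (Q j)) : EqFlat R M := by
  classical
  refine EqFlat.of_factor.{u} fun m f x hx => ?_
  choose s y hy using fun i : Fin m => hsurj (f (Pi.single i 1))
  obtain ⟨j, hj⟩ := Finite.exists_le s
  let a : (Fin m → R) →ₗ[R] Q j := Fintype.linearCombination R fun i => t _ _ (hj i) (y i)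
  have ha : ∀ y, c j (a y) = f y := by
    suffices c j ∘ₗ a = f from LinearMap.congr_fun this
    refine LinearMap.pi_ext' fun i => LinearMap.ext_ring ?_
    simp [a, Fintype.linearCombination_apply_single, hc, hy]
  obtain ⟨k, hjk, hk⟩ := hinj j (a x) (by rw [ha, hx])
  exact ⟨Q k, inferInstance, inferInstance, t j k hjk ∘ₗ a, c k, hQ k,
    fun y => by rw [LinearMap.comp_apply, hc, ha], hk⟩

end DirectedColimits

/-! ### Covers by firm flat modules -/

section Generation

variable {R : Type u} [Ring R] {A : TwoSidedIdeal R} {M : Type u} [AddCommGroup M] [Module R M]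

/-- Take the telescope `P → P → ⋯` along `θ`. It is a directed colimit of free modules, each of its
elements comes from `θ P ⊆ A P` one stage later, and `π θ = π` makes `π` descend to it. -/
theorem exists_isFirmFlat_of_endomorphism {P : Type u} [AddCommGroup P] [Module R P]
    [Module.Free R P] (θ : P →ₗ[R] P) (hθ : ∀ x, θ x ∈ idealSpan A P) (π : P →ₗ[R] M)
    (hπθ : ∀ x, π (θ x) = π x) (hπ : Function.Surjective π) :
    ∃ (G : Type u) (_ : AddCommGroup G) (_ : Module R G) (γ : G →ₗ[R] M),
      IsFirmFlat A G ∧ Function.Surjective γ := by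
  let f : ∀ i j : ℕ, i ≤ j → P →ₗ[R] P := fun i j _ => θ ^ (j - i)
  have : DirectedSystem (fun _ : ℕ => P) fun i j h => f i j h :=
    ⟨fun i x => by simp [f], fun i j k hij hjk x => by
      simp only [f]
      rw [← Module.End.mul_apply, ← pow_add]
      congr 2
      omega⟩
  let G := Module.DirectLimit (fun _ : ℕ => P) f
  let c : ∀ i : ℕ, P →ₗ[R] G := Module.DirectLimit.of R ℕ (fun _ => P) f
  have hπf : ∀ n x, π ((θ ^ n) x) = π x := by
    intro n
    induction n with
    | zero => simp
    | succ n ih => intro x; rw [pow_succ, Module.End.mul_apply, ih, hπθ]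
  have hsurj : ∀ y : G, ∃ j x, c j x = y := fun y => Module.DirectLimit.exists_of y
  refine ⟨G, inferInstance, inferInstance,
    Module.DirectLimit.lift R ℕ (fun _ => P) f (fun _ => π) (fun i j h x => hπf _ x),
    ⟨?_, eq_top_iff.2 fun y _ => ?_⟩, fun m => ?_⟩
  · exact EqFlat.of_directed (fun _ : ℕ => P) f c
      (fun i j h x => Module.DirectLimit.of_f (hij := h)) hsurj
      (fun i x hx => Module.DirectLimit.of.zero_exact hx) fun _ => EqFlat.of_free
  · obtain ⟨j, x, rfl⟩ := hsurj y
    have h1 : c (j + 1) (f j (j + 1) (Nat.le_succ j) x) = c j x :=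
      Module.DirectLimit.of_f (hij := Nat.le_succ j)
    rw [← h1]
    refine map_mem_idealSpan _ ?_
    simp only [f, Nat.add_sub_cancel_left, pow_one]
    exact hθ x
  · obtain ⟨x, rfl⟩ := hπ m
    exact ⟨c 0 x, Module.DirectLimit.lift_of _ _ _⟩

/-- A module with `A M = M` is a quotient of a flat module with the same property. -/
theorem exists_isFirmFlat_surjective (hM : idealSpan A M = ⊤) :
    ∃ (G : Type u) (_ : AddCommGroup G) (_ : Module R G) (γ : G →ₗ[R] M),
      IsFirmFlat A G ∧ Function.Surjective γ := by
  let π : (M →₀ R) →ₗ[R] M := Finsupp.linearCombination R id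
  have hπ : Function.Surjective π := fun m => ⟨Finsupp.single m 1, by simp [π]⟩
  -- As `A M = M`, each basis vector of the free module on `M` can be replaced by an element of `A
  -- P` with the same image; this defines the endomorphism of the telescope.
  choose t ht htm using fun m : M => exists_mem_idealSpan_of_surjective (A := A) hπ (y := m)
    (hM ▸ Submodule.mem_top)
  refine exists_isFirmFlat_of_endomorphism (Finsupp.linearCombination R t) (fun x => ?_) π
    (fun x => ?_) hπ
  · rw [Finsupp.linearCombination_apply]
    exact sum_mem fun m _ => Submodule.smul_mem _ _ (ht m)
  · induction x using Finsupp.induction_linear with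
    | zero => simp
    | add x y hx hy => simp only [map_add, hx, hy]
    | single m r => simp only [Finsupp.linearCombination_single, map_smul, htm, π, id]

end Generation

/-! ### Small pure submodules by a Löwenheim–Skolem argument -/

section Purity

variable {R : Type u} [Ring R] {A : TwoSidedIdeal R} {M : Type u} [AddCommGroup M] [Module R M]

/-- A submodule is pure if finite systems of linear equations with constants in it which are
solvable in the ambient module are solvable in it. -/
def IsPure (N : Submodule R M) : Prop :=
  ∀ (r n : ℕ) (α : (Fin r → R) →ₗ[R] (Fin n → R)) (g : (Fin n → R) →ₗ[R] M),
    (∀ x, g (α x) ∈ N) → ∃ g' : (Fin n → R) →ₗ[R] N, ∀ x, (g' (α x) : M) = g (α x)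

theorem IsPure.isFirmFlat {N : Submodule R M} (hN : IsPure N) (hM : IsFirmFlat A M) :
    IsFirmFlat A N := by
  refine ⟨fun m f x hx => ?_, eq_top_iff.2 fun y _ => ?_⟩
  · obtain ⟨n, a, g, hg, ha⟩ := hM.1 m (N.subtype ∘ₗ f) x (by simp [hx])
    obtain ⟨g', hg'⟩ := hN m n a g (fun x => by rw [hg]; exact (f x).2)
    exact ⟨n, a, g', fun y => Subtype.ext (by rw [hg', hg]; rfl), ha⟩
  · obtain ⟨n, a, f, ha, hf⟩ := exists_linearMap_of_mem_idealSpan (A := A) (x := (y : M))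
      (hM.2 ▸ Submodule.mem_top)
    -- The system is the single equation `f a = y` with `f` unknown. A solution in `N` exhibits `y`
    -- as an element of `A N`.
    obtain ⟨g', hg'⟩ := hN 1 n (LinearMap.toSpanSingleton R _ a ∘ₗ LinearMap.proj 0) f (fun x => by
      simp only [LinearMap.comp_apply, LinearMap.toSpanSingleton_apply, map_smul, hf]
      exact N.smul_mem _ y.2)
    have h := hg' 1
    simp only [LinearMap.comp_apply, LinearMap.proj_apply, Pi.one_apply,
      LinearMap.toSpanSingleton_apply, one_smul, hf] at h
    rw [← Subtype.ext h]
    exact map_mem_idealSpan_of_coord g' ha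

/-- A relation in the quotient lifts to `f₁ x ∈ N`. Purity solves `g' x = f₁ x` inside `N`, so `f₁ -
g'` has the honest relation `x` in `M` and induces the original map on the quotient. -/
theorem IsPure.isFirmFlat_quotient {N : Submodule R M} (hN : IsPure N) (hM : IsFirmFlat A M) :
    IsFirmFlat A (M ⧸ N) := by
  refine ⟨fun m f x hx => ?_, idealSpan_eq_top_of_surjective N.mkQ_surjective hM.2⟩
  obtain ⟨f₁, hf₁⟩ := exists_lift_of_surjective N.mkQ_surjective f
  have hx' : f₁ x ∈ N := by rw [← Submodule.Quotient.mk_eq_zero, ← N.mkQ_apply, hf₁, hx]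
  obtain ⟨g', hg'⟩ := hN 1 m (LinearMap.toSpanSingleton R _ x ∘ₗ LinearMap.proj 0) f₁ (fun z => by
    simp only [LinearMap.comp_apply, LinearMap.toSpanSingleton_apply, map_smul]
    exact N.smul_mem _ hx')
  have h := hg' 1
  simp only [LinearMap.comp_apply, LinearMap.proj_apply, Pi.one_apply,
    LinearMap.toSpanSingleton_apply, one_smul] at h
  obtain ⟨n, a, g, hg, ha⟩ := hM.1 m (f₁ - N.subtype ∘ₗ g') x (by simp [h])
  refine ⟨n, a, N.mkQ ∘ₗ g, fun y => ?_, ha⟩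
  rw [LinearMap.comp_apply, hg, LinearMap.sub_apply, map_sub, hf₁]
  simp

/-- The language with a function symbol for each coordinate of a solution of a finite system of
linear equations over `R`. -/
def solutionLanguage (R : Type u) : FirstOrder.Language.{u, 0} where
  Functions k := Σ r : ℕ, Σ n : ℕ, (Fin r → Fin n → R) × (Fin r → Fin k → R) × Fin n
  Relations _ := Empty

/-- The solvability of a system of linear equations with parameters `v`. -/
def IsSolution {r n k : ℕ} (a : Fin r → Fin n → R) (p : Fin r → Fin k → R) (v : Fin k → M)
    (y : Fin n → M) : Prop :=
  ∀ i, ∑ j, a i j • y j = ∑ l, p i l • v l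

open Classical in
/-- Modules interpret the symbols of `solutionLanguage` by chosen solutions. -/
instance solutionStructure (R : Type u) [Ring R] (M : Type u) [AddCommGroup M] [Module R M] :
    (solutionLanguage R).Structure M where
  funMap := fun {_} s v =>
    if h : ∃ y, IsSolution s.2.2.1 s.2.2.2.1 v y then h.choose s.2.2.2.2 else 0
  RelMap := fun {_} s _ => s.elim

theorem exists_isSolution_mem (S : (solutionLanguage R).Substructure M) {r n k : ℕ}
    (a : Fin r → Fin n → R) (p : Fin r → Fin k → R) (v : Fin k → M) (hv : ∀ l, v l ∈ S)
    (h : ∃ y, IsSolution a p v y) : ∃ y, IsSolution a p v y ∧ ∀ j, y j ∈ S := by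
  refine ⟨h.choose, h.choose_spec, fun j => ?_⟩
  classical
  have := S.fun_mem (n := k) ⟨r, n, a, p, j⟩ v hv
  change (if h : ∃ y, IsSolution a p v y then h.choose j else 0) ∈ S at this
  rwa [dif_pos h] at this

/-- A substructure closed under solutions of linear systems, as a submodule. -/
def substructureToSubmodule (S : (solutionLanguage R).Substructure M) : Submodule R M where
  carrier := S
  zero_mem' := by
    -- The module operations are themselves solutions of one-variable systems: `y = 0` here, then `y
    -- = x + x'` and `y = c • x`.
    obtain ⟨y, hy, hyS⟩ := exists_isSolution_mem S (r := 1) (n := 1) (k := 0)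
      (fun _ _ => 1) (fun _ _ => 1) Fin.elim0 (fun l => l.elim0) ⟨0, fun i => by simp⟩
    have := hy 0
    simp only [one_smul, Finset.univ_unique, Finset.sum_singleton, Finset.univ_eq_empty,
      Finset.sum_empty] at this
    rw [← this]
    exact hyS _
  add_mem' := by
    intro x x' hx hx'
    obtain ⟨y, hy, hyS⟩ := exists_isSolution_mem S (r := 1) (n := 1) (k := 2)
      (fun _ _ => 1) (fun _ _ => 1) ![x, x'] (fun l => by fin_cases l <;> assumption)
      ⟨fun _ => x + x', fun i => by simp⟩
    have := hy 0
    simp only [one_smul, Finset.univ_unique, Finset.sum_singleton, Fin.sum_univ_two,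
      Matrix.cons_val_zero, Matrix.cons_val_one] at this
    rw [← this]
    exact hyS _
  smul_mem' := by
    intro c x hx
    obtain ⟨y, hy, hyS⟩ := exists_isSolution_mem S (r := 1) (n := 1) (k := 1)
      (fun _ _ => 1) (fun _ _ => c) (fun _ => x) (fun _ => hx) ⟨fun _ => c • x, fun i => by simp⟩
    have := hy 0
    simp only [one_smul, Finset.univ_unique, Finset.sum_singleton] at this
    rw [← this]
    exact hyS _

theorem isPure_substructureToSubmodule (S : (solutionLanguage R).Substructure M) :
    IsPure (substructureToSubmodule S) := by
  classical
  intro r n α g hg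
  have hsum : ∀ (f : (Fin n → R) →ₗ[R] M) x, f x = ∑ j, x j • f (Pi.single j 1) := by
    intro f x
    conv_lhs => rw [← Finset.univ_sum_single x, map_sum]
    refine Finset.sum_congr rfl fun i _ => ?_
    rw [← map_smul, ← Pi.single_smul, smul_eq_mul, mul_one]
  -- The rows are the images of the standard vectors under `α`, and the identity matrix makes the
  -- parameters the right-hand sides `g (α e_i)`, which lie in `S`.
  obtain ⟨y, hy, hyS⟩ := exists_isSolution_mem S (fun i => α (Pi.single i 1))
    (fun i l => (Pi.single i 1 : Fin r → R) l) (fun i => g (α (Pi.single i 1)))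
    (fun i => hg _) ⟨fun j => g (Pi.single j 1), fun i => by
      rw [← hsum]
      simp [Pi.single_apply, ite_smul]⟩
  let g' : (Fin n → R) →ₗ[R] substructureToSubmodule S :=
    Fintype.linearCombination R fun j => (⟨y j, hyS j⟩ : substructureToSubmodule S)
  refine ⟨g', ?_⟩
  suffices (substructureToSubmodule S).subtype ∘ₗ g' ∘ₗ α = g ∘ₗ α from LinearMap.congr_fun this
  refine LinearMap.pi_ext' fun i => LinearMap.ext_ring ?_
  have := hy i
  simp only [Pi.single_apply, ite_smul, one_smul, zero_smul, Finset.sum_ite_eq',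
    Finset.mem_univ, if_true] at this
  simp [g', Fintype.linearCombination_apply, this]

open Cardinal in
theorem mk_sigma_nat_le {κ : Cardinal.{u}} (hκ : ℵ₀ ≤ κ) (F : ℕ → Type u) (hF : ∀ n, #(F n) ≤ κ) :
    #(Σ n, F n) ≤ κ := by
  rw [mk_sigma]
  refine (sum_le_sum _ (fun _ => κ) hF).trans ?_
  rw [sum_const]
  simpa using mul_le_of_le hκ hκ le_rfl

open Cardinal in
theorem mk_fun_fin_le {κ : Cardinal.{u}} (hκ : ℵ₀ ≤ κ) {F : Type u} (hF : #F ≤ κ) (n : ℕ) :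
    #(Fin n → F) ≤ κ := by
  simp only [mk_pi, prod_const, lift_uzero, mk_fin, lift_natCast]
  exact (power_le_power_right hF).trans (power_nat_le hκ)

open Cardinal in
theorem mk_solutionLanguage_le {R : Type u} {κ : Cardinal.{u}} (hκ : ℵ₀ ≤ κ) (hR : #R ≤ κ) :
    #(Σ k, (solutionLanguage R).Functions k) ≤ κ := by
  refine mk_sigma_nat_le hκ _ fun k => mk_sigma_nat_le hκ _ fun r =>
    mk_sigma_nat_le hκ _ fun n => ?_
  rw [mk_prod, mk_prod]
  simp only [lift_uzero, lift_id]
  refine mul_le_of_le hκ (mk_fun_fin_le hκ (mk_fun_fin_le hκ hR n) r)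
    (mul_le_of_le hκ (mk_fun_fin_le hκ (mk_fun_fin_le hκ hR k) r) ?_)
  simpa using (natCast_lt_aleph0 (n := n)).le.trans hκ

open Cardinal in
/-- Each small subset of a flat module is contained in a small pure submodule. -/
theorem exists_small_isPure {κ : Cardinal.{u}} (hκ : ℵ₀ ≤ κ) (hR : #R ≤ κ) (S : Set M)
    (hS : #S ≤ κ) : ∃ N : Submodule R M, S ⊆ N ∧ IsPure N ∧ #N ≤ κ := by
  let T := FirstOrder.Language.Substructure.closure (solutionLanguage R) S
  refine ⟨substructureToSubmodule T, FirstOrder.Language.Substructure.subset_closure,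
    isPure_substructureToSubmodule T, ?_⟩
  have h := FirstOrder.Language.Substructure.lift_card_closure_le (L := solutionLanguage R) (s := S)
  simp only [lift_id] at h
  exact h.trans (max_le hκ (add_le_of_le hκ hS (mk_solutionLanguage_le hκ hR)))

open Cardinal in
/-- Each small subset of a module with `A M = M` is in the range of a small flat module. -/
theorem exists_small_isFirmFlat {κ : Cardinal.{u}} (hκ : ℵ₀ ≤ κ) (hR : #R ≤ κ)
    (hM : idealSpan A M = ⊤) (S : Set M) (hS : #S ≤ κ) :
    ∃ (G : Type u) (_ : AddCommGroup G) (_ : Module R G) (γ : G →ₗ[R] M),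
      IsFirmFlat A G ∧ #G ≤ κ ∧ ∀ s ∈ S, ∃ g, γ g = s := by
  obtain ⟨G, _, _, γ, hG, hγ⟩ := exists_isFirmFlat_surjective hM
  choose l hl using hγ
  obtain ⟨N, hSN, hN, hNκ⟩ := exists_small_isPure hκ hR (l '' S) (mk_image_le.trans hS)
  exact ⟨N, inferInstance, inferInstance, γ ∘ₗ N.subtype, hN.isFirmFlat hG, hNκ,
    fun s hs => ⟨⟨l s, hSN ⟨s, hs, rfl⟩⟩, hl s⟩⟩

end Purity

end HUnitary
end

noncomputable section

namespace HUnitary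

/-! ### Monomorphisms with firm flat cokernel: composition and pushouts -/

section FirmMonomorphisms

open Limits

variable {R : Type u} [Ring R] (A : TwoSidedIdeal R)

/-- Injective maps whose cokernel is flat and firm. -/
def firmMono : MorphismProperty (ModuleCat.{u} R) := fun _ Y f =>
  Function.Injective f.hom ∧ IsFirmFlat A (Y ⧸ LinearMap.range f.hom)

variable {A}

theorem firmMono_of_exact {X Y : ModuleCat.{u} R} {f : X ⟶ Y} {M : Type u} [AddCommGroup M]
    [Module R M] {p : Y →ₗ[R] M} (hf : Function.Injective f.hom) (hp : Function.Surjective p)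
    (hfp : ∀ y, p y = 0 ↔ ∃ x, f.hom x = y) (hM : IsFirmFlat A M) : firmMono A f := by
  refine ⟨hf, ?_⟩
  have h : LinearMap.range f.hom = LinearMap.ker p := Submodule.ext fun y => (hfp y).symm
  exact hM.of_equiv ((Submodule.quotEquivOfEq _ _ h).trans (p.quotKerEquivOfSurjective hp)).symm

theorem firmMono_of_isIso {X Y : ModuleCat.{u} R} (f : X ⟶ Y) [IsIso f] : firmMono A f := by
  have h := (ConcreteCategory.isIso_iff_bijective f).1 inferInstance
  exact firmMono_of_exact (M := PUnit.{u + 1}) (p := 0) h.1 (fun _ => ⟨0, rfl⟩)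
    (fun y => ⟨fun _ => h.2 y, fun _ => rfl⟩) isFirmFlat_of_subsingleton

instance : (firmMono A).IsMultiplicative where
  id_mem X := firmMono_of_isIso _
  comp_mem {X Y Z} f g hf hg := by
    let p : (Y ⧸ LinearMap.range f.hom) →ₗ[R] (Z ⧸ LinearMap.range (f ≫ g).hom) :=
      Submodule.mapQ _ _ g.hom (by rintro _ ⟨x, rfl⟩; exact ⟨x, rfl⟩)
    let q : (Z ⧸ LinearMap.range (f ≫ g).hom) →ₗ[R] (Z ⧸ LinearMap.range g.hom) :=
      Submodule.factor (by rintro _ ⟨x, rfl⟩; exact ⟨f x, rfl⟩)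
    refine ⟨hg.1.comp hf.1, hf.2.of_extension (i := p) (p := q) ?_ ?_ ?_ hg.2⟩
    · rw [injective_iff_map_eq_zero]
      intro y hy
      obtain ⟨y, rfl⟩ := Submodule.mkQ_surjective _ y
      obtain ⟨x, hx⟩ := (Submodule.Quotient.mk_eq_zero _).1 hy
      exact (Submodule.Quotient.mk_eq_zero _).2 ⟨x, hg.1 hx⟩
    · intro z
      obtain ⟨z, rfl⟩ := Submodule.mkQ_surjective _ z
      constructor
      · intro h
        obtain ⟨y, hy⟩ := (Submodule.Quotient.mk_eq_zero _).1 h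
        exact ⟨Submodule.Quotient.mk y, congrArg Submodule.Quotient.mk hy⟩
      · rintro ⟨y, hy⟩
        obtain ⟨y, rfl⟩ := Submodule.mkQ_surjective _ y
        rw [← hy]
        exact (Submodule.Quotient.mk_eq_zero _).2 ⟨y, rfl⟩
    · exact Submodule.factor_surjective _

instance : (firmMono A).RespectsIso :=
  MorphismProperty.respectsIso_of_isStableUnderComposition fun _ _ f (_ : IsIso f) =>
    firmMono_of_isIso f

theorem firmMono_le_monomorphisms : firmMono A ≤ MorphismProperty.monomorphisms _ :=
  fun _ _ f hf => (ModuleCat.mono_iff_injective f).2 hf.1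

instance : (firmMono A).IsStableUnderCobaseChange where
  of_isPushout {X X' Y Y' f g g' f'} sq hf := by
    have hf' : Mono g' := (MorphismProperty.monomorphisms _).of_isPushout sq
      (firmMono_le_monomorphisms _ hf)
    have hfg : LinearMap.range g'.hom ⊔ LinearMap.range f'.hom = ⊤ := by
      -- Joint surjectivity of the two pushout legs: the quotient map by the sum of their ranges
      -- vanishes on both legs.
      have : ModuleCat.ofHom (LinearMap.range g'.hom ⊔ LinearMap.range f'.hom).mkQ = 0 := by
        refine sq.hom_ext ?_ ?_ <;> ext y <;> refine (Submodule.Quotient.mk_eq_zero _).2 ?_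
        · exact Submodule.mem_sup_left ⟨y, rfl⟩
        · exact Submodule.mem_sup_right ⟨y, rfl⟩
      rw [← Submodule.ker_mkQ (LinearMap.range g'.hom ⊔ LinearMap.range f'.hom)]
      exact LinearMap.ker_eq_top.2 (ModuleCat.hom_ext_iff.1 this)
    let p := sq.desc 0 (ModuleCat.ofHom (LinearMap.range f.hom).mkQ) (by
      ext x
      exact ((Submodule.Quotient.mk_eq_zero (LinearMap.range f.hom)).2 ⟨x, rfl⟩).symm)
    have hp (x) : p.hom (f'.hom x) = (LinearMap.range f.hom).mkQ x :=
      ConcreteCategory.congr_hom (sq.inr_desc _ _ _) x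
    have hp' (x) : p.hom (g'.hom x) = 0 := ConcreteCategory.congr_hom (sq.inl_desc _ _ _) x
    refine firmMono_of_exact (p := p.hom) ((ModuleCat.mono_iff_injective _).1 hf') ?_ ?_ hf.2
    · intro y
      obtain ⟨y, rfl⟩ := Submodule.mkQ_surjective _ y
      exact ⟨_, hp y⟩
    · intro y
      constructor
      · intro hy
        obtain ⟨_, ⟨x, rfl⟩, _, ⟨x', rfl⟩, rfl⟩ :=
          Submodule.mem_sup.1 (hfg ▸ Submodule.mem_top : y ∈ _)
        rw [map_add, hp', zero_add, hp] at hy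
        obtain ⟨z, rfl⟩ := (Submodule.Quotient.mk_eq_zero _).1 hy
        exact ⟨x + g.hom z, by
          rw [map_add]
          exact congrArg (_ + ·) (ConcreteCategory.congr_hom sq.w z)⟩
      · rintro ⟨x, rfl⟩
        exact hp' x

end FirmMonomorphisms

end HUnitary
end

noncomputable section

namespace HUnitary

/-! ### Monomorphisms with firm flat cokernel: coproducts and transfinite compositions -/

section FirmMonoColimits

open Limits

variable {R : Type u} [Ring R] {A : TwoSidedIdeal R}

/-- The maps `i j ∘ p j` play the role of projections to summands. Finitely many of them reproduce
`f` on the standard vectors, and the relation is trivialised in each of these components separately.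
-/
theorem EqFlat.of_finite_decomposition {M : Type u} [AddCommGroup M] [Module R M] {J : Type u}
    (Q : J → Type u) [∀ j, AddCommGroup (Q j)] [∀ j, Module R (Q j)] (i : ∀ j, Q j →ₗ[R] M)
    (p : ∀ j, M →ₗ[R] Q j)
    (h : ∀ x, ∃ S : Finset J, ∀ T : Finset J, S ⊆ T → ∑ j ∈ T, i j (p j x) = x)
    (hQ : ∀ j, EqFlat R (Q j)) : EqFlat R M := by
  classical
  refine EqFlat.of_factor.{u} fun m f x hx => ?_
  choose S hS using fun k : Fin m => h (f (Pi.single k 1))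
  let T := Finset.univ.biUnion S
  choose n a g hg ha using fun j => hQ j m (p j ∘ₗ f) x (by simp [hx])
  refine ⟨(j : T) → (Fin (n j) → R), inferInstance, inferInstance, LinearMap.pi fun j => a j,
    ∑ j : T, i j ∘ₗ g j ∘ₗ LinearMap.proj j, .of_free, fun y => ?_, ?_⟩
  · suffices (∑ j : T, i j ∘ₗ g j ∘ₗ LinearMap.proj j) ∘ₗ (LinearMap.pi fun j : T => a j) = f from
      LinearMap.congr_fun this y
    refine LinearMap.pi_ext' fun k => LinearMap.ext_ring ?_
    have := hS k T (Finset.subset_biUnion_of_mem S (Finset.mem_univ k))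
    rw [← Finset.sum_coe_sort] at this
    simpa [hg] using this
  · ext1 j
    exact ha j

instance : MorphismProperty.IsStableUnderCoproducts.{u} (firmMono A) where
  isStableUnderCoproductsOfShape J := by
    classical
    refine .mk _ J fun X Y _ _ f hf => ?_
    have hmono : Mono (Limits.Sigma.map f) :=
      have (j : J) : Mono (f j) := firmMono_le_monomorphisms _ (hf j)
      inferInstance
    let φ := Limits.Sigma.map f
    have hdec (x : (∐ Y : ModuleCat.{u} R)) : ∃ S : Finset J, ∀ T : Finset J, S ⊆ T →
        ∑ j ∈ T, (Sigma.ι Y j).hom ((Sigma.π Y j).hom x) = x := by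
      let W : Submodule R (∐ Y : ModuleCat.{u} R) :=
        { carrier := {x | ∃ S : Finset J, ∀ T : Finset J, S ⊆ T →
            ∑ j ∈ T, (Sigma.ι Y j).hom ((Sigma.π Y j).hom x) = x}
          zero_mem' := ⟨∅, by simp⟩
          add_mem' := by
            rintro x y ⟨S, hS⟩ ⟨S', hS'⟩
            refine ⟨S ∪ S', fun T hT => ?_⟩
            simp only [map_add, Finset.sum_add_distrib]
            rw [hS T (Finset.union_subset_left hT), hS' T (Finset.union_subset_right hT)]
          smul_mem' := by
            rintro r x ⟨S, hS⟩
            refine ⟨S, fun T hT => ?_⟩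
            simp only [map_smul]
            rw [← Finset.smul_sum, hS T hT] }
      have hW : ModuleCat.ofHom W.mkQ = 0 := by
        refine Sigma.hom_ext _ _ fun j => ?_
        ext y
        refine (Submodule.Quotient.mk_eq_zero _).2 ⟨{j}, fun T hT => ?_⟩
        rw [Finset.sum_eq_single_of_mem j (hT (Finset.mem_singleton_self j))]
        · exact congrArg (Sigma.ι Y j).hom
            (ConcreteCategory.congr_hom (Sigma.ι_π_eq_id Y j) y)
        · intro k _ hk
          have := ConcreteCategory.congr_hom (Sigma.ι_π_of_ne Y hk.symm) y
          exact (congrArg (Sigma.ι Y k).hom this).trans (map_zero _)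
      have : x ∈ LinearMap.ker W.mkQ := LinearMap.mem_ker.2 (ConcreteCategory.congr_hom hW x)
      rwa [Submodule.ker_mkQ] at this

    let i (j : J) : (Y j ⧸ LinearMap.range (f j).hom) →ₗ[R]
        ((∐ Y : ModuleCat.{u} R) ⧸ LinearMap.range φ.hom) :=
      Submodule.mapQ _ _ (Sigma.ι Y j).hom (by
        rintro _ ⟨x, rfl⟩
        exact ⟨(Sigma.ι X j).hom x, ConcreteCategory.congr_hom (Sigma.ι_map f j) x⟩)
    have hπ (j : J) : φ ≫ Sigma.π Y j = Sigma.π X j ≫ f j := by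
      refine Sigma.hom_ext _ _ fun k => ?_
      by_cases hk : k = j
      · subst hk
        simp [φ]
      · simp [φ, Sigma.ι_π_of_ne_assoc _ hk, Sigma.ι_π_of_ne _ hk]
    let p (j : J) : ((∐ Y : ModuleCat.{u} R) ⧸ LinearMap.range φ.hom) →ₗ[R]
        (Y j ⧸ LinearMap.range (f j).hom) :=
      Submodule.mapQ _ _ (Sigma.π Y j).hom (by
        rintro _ ⟨x, rfl⟩
        exact ⟨(Sigma.π X j).hom x, (ConcreteCategory.congr_hom (hπ j) x).symm⟩)
    have hip (x) : ∃ S : Finset J, ∀ T : Finset J, S ⊆ T → ∑ j ∈ T, i j (p j x) = x := by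
      obtain ⟨x, rfl⟩ := Submodule.mkQ_surjective _ x
      obtain ⟨S, hS⟩ := hdec x
      refine ⟨S, fun T hT => ?_⟩
      conv_rhs => rw [← hS T hT]
      rw [map_sum]
      rfl
    refine ⟨(ModuleCat.mono_iff_injective _).1 hmono,
      .of_finite_decomposition _ i p hip fun j => (hf j).2.1, ?_⟩
    refine eq_top_iff.2 fun x _ => ?_
    obtain ⟨S, hS⟩ := hip x
    rw [← hS S subset_rfl]
    exact Submodule.sum_mem _ fun j _ =>
      map_mem_idealSpan (i j) ((hf j).2.2 ▸ Submodule.mem_top)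

/-- The cokernel of the colimit map is the directed colimit of the cokernels: an element that
becomes zero there already does so at a later stage. -/
theorem firmMono_isStableUnderColimitsOfShape (J : Type u) [LinearOrder J] [Nonempty J] :
    (firmMono A).IsStableUnderColimitsOfShape J where
  condition X Y c c' hc hc' f hf φ hφ := by
    have hmono : Mono φ := by
      refine MorphismProperty.IsStableUnderColimitsOfShape.condition
        (W := MorphismProperty.monomorphisms (ModuleCat.{u} R)) X Y c c' hc hc' f
        (fun j => firmMono_le_monomorphisms _ (hf j)) φ hφ
    have hφ' (j) (x : X.obj j) : φ.hom ((c.ι.app j).hom x) = (c'.ι.app j).hom ((f.app j).hom x) :=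
      ConcreteCategory.congr_hom (hφ j) x
    let t (i j : J) (h : i ≤ j) : (Y.obj i ⧸ LinearMap.range (f.app i).hom) →ₗ[R]
        (Y.obj j ⧸ LinearMap.range (f.app j).hom) :=
      Submodule.mapQ _ _ (Y.map (homOfLE h)).hom (by
        rintro _ ⟨x, rfl⟩
        exact ⟨(X.map (homOfLE h)).hom x,
          ConcreteCategory.congr_hom (f.naturality (homOfLE h)) x⟩)
    let q (j) : (Y.obj j ⧸ LinearMap.range (f.app j).hom) →ₗ[R] (c'.pt ⧸ LinearMap.range φ.hom) :=
      Submodule.mapQ _ _ (c'.ι.app j).hom (by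
        rintro _ ⟨x, rfl⟩
        exact ⟨(c.ι.app j).hom x, hφ' j x⟩)
    have hsurj (y) : ∃ j x, q j x = y := by
      obtain ⟨y, rfl⟩ := Submodule.mkQ_surjective _ y
      obtain ⟨j, x, rfl⟩ := Concrete.isColimit_exists_rep Y hc' y
      exact ⟨j, Submodule.Quotient.mk x, rfl⟩
    refine ⟨(ModuleCat.mono_iff_injective _).1 hmono, .of_directed _ t q ?_ hsurj ?_
      fun j => (hf j).2.1, idealSpan_eq_top_of_jointly_surjective fun y => ?_⟩
    · intro i j h x
      obtain ⟨x, rfl⟩ := Submodule.mkQ_surjective _ x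
      exact congrArg Submodule.Quotient.mk (ConcreteCategory.congr_hom (c'.w (homOfLE h)) x)
    · intro i x hx
      obtain ⟨x, rfl⟩ := Submodule.mkQ_surjective _ x
      obtain ⟨y, hy⟩ := (Submodule.Quotient.mk_eq_zero _).1 hx
      obtain ⟨k, y, rfl⟩ := Concrete.isColimit_exists_rep X hc y
      rw [hφ'] at hy
      obtain ⟨l, g, g', h⟩ := Concrete.isColimit_exists_of_rep_eq Y hc' _ _ hy
      refine ⟨l, leOfHom g', (Submodule.Quotient.mk_eq_zero _).2 ⟨(X.map g).hom y, ?_⟩⟩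
      exact (ConcreteCategory.congr_hom (f.naturality g) y).trans h
    · obtain ⟨j, x, rfl⟩ := hsurj y
      exact ⟨_, _, _, q j, x, (hf j).2.2, rfl⟩

instance (J : Type u) [LinearOrder J] [SuccOrder J] [OrderBot J] [WellFoundedLT J] :
    (firmMono A).IsStableUnderTransfiniteCompositionOfShape J :=
  .of_isStableUnderColimitsOfShape fun J _ _ _ _ => firmMono_isStableUnderColimitsOfShape J

end FirmMonoColimits

end HUnitary
end

noncomputable section

namespace HUnitary

/-! ### The small object argument -/

section SmallObjectArgument

open Limits MorphismProperty

variable {R : Type u} [Ring R] (A : TwoSidedIdeal R) (B : Type u)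

/-- Pairs of submodules `V ⊆ (B →₀ R) ⧸ U` with flat and firm cokernel. -/
def FirmSubquotient : Type u :=
  Σ U : Submodule R (B →₀ R), {V : Submodule R ((B →₀ R) ⧸ U) // IsFirmFlat A (_ ⧸ V)}

/-- The inclusion of `V` in `(B →₀ R) ⧸ U`. -/
def firmInclusion (i : FirmSubquotient A B) :
    ModuleCat.of R i.2.1 ⟶ ModuleCat.of R ((B →₀ R) ⧸ i.1) :=
  ModuleCat.ofHom i.2.1.subtype

theorem firmInclusion_le : ofHoms (firmInclusion A B) ≤ firmMono A := by
  rintro _ _ _ ⟨i⟩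
  exact firmMono_of_exact (p := i.2.1.mkQ) Subtype.val_injective i.2.1.mkQ_surjective
    (fun y => (Submodule.Quotient.mk_eq_zero _).trans
      ⟨fun h => ⟨⟨y, h⟩, rfl⟩, by rintro ⟨x, rfl⟩; exact x.2⟩) i.2.2

theorem coproducts_pushouts_firmInclusion_le :
    (coproducts.{u} (ofHoms (firmInclusion A B))).pushouts ≤ firmMono A := by
  refine (pushouts_monotone (coproducts_monotone (firmInclusion_le A B))).trans ?_
  rw [pushouts_le_iff, coproducts_eq_self]

/-- The transition maps of the cellular compositions are monomorphisms. In a Grothendieck abelian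
category, Hom out of an object commutes with such colimits once the cardinal exceeds its number of
subobjects; one regular cardinal above all sources works for the whole set. -/
theorem exists_isCardinalForSmallObjectArgument :
    ∃ (κ : Cardinal.{u}) (_ : Fact κ.IsRegular) (_ : OrderBot κ.ord.ToType),
      IsCardinalForSmallObjectArgument (ofHoms (firmInclusion A B)) κ := by
  obtain ⟨κ, hκ', hκ⟩ := HasCardinalLT.exists_regular_cardinal.{u}
    (Σ i : FirmSubquotient A B, Subobject (ModuleCat.of R i.2.1))
  have : Fact κ.IsRegular := ⟨hκ'⟩
  have : Nonempty κ.ord.ToType := by simpa using hκ'.ne_zero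
  have := WellFoundedLT.toOrderBot κ.ord.ToType
  refine ⟨κ, inferInstance, inferInstance,
    { preservesColimit := fun {A' B' X Y} i hi f hf => ?_ }⟩
  have hmono (j j' : κ.ord.ToType) (φ : j ⟶ j') : Mono (hf.F.map φ) := by
    let hf' : (monomorphisms (ModuleCat.{u} R)).TransfiniteCompositionOfShape κ.ord.ToType f :=
      { toTransfiniteCompositionOfShape := hf.toTransfiniteCompositionOfShape
        map_mem := fun j hj => by
          have := (hf.attachCells j hj).pushouts_coproducts
          simp only [ofHoms_homFamily] at this
          exact firmMono_le_monomorphisms _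
            (coproducts_pushouts_firmInclusion_le A B _ this) }
    exact hf'.mem_map φ
  obtain ⟨i⟩ := hi
  exact IsGrothendieckAbelian.preservesColimit_coyoneda_obj_of_mono _ (κ := κ)
    (hκ.of_injective (fun s => (⟨i, s⟩ : Σ i : FirmSubquotient A B,
      Subobject (ModuleCat.of R i.2.1))) (fun _ _ h => eq_of_heq (Sigma.mk.inj h).2))

variable {A} (M : Type u) [AddCommGroup M] [Module R M]

/-- Factor `M → 0`: the first factor is built from pushouts of coproducts of the test inclusions, so
its cokernel is firm flat, and the lifting property of the second factor is the extension property.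
-/
theorem exists_firmMono_extension :
    ∃ (C : Type u) (_ : AddCommGroup C) (_ : Module R C) (η : M →ₗ[R] C),
      Function.Injective η ∧ IsFirmFlat A (C ⧸ LinearMap.range η) ∧
      ∀ (U : Submodule R (B →₀ R)) (V : Submodule R ((B →₀ R) ⧸ U)), IsFirmFlat A (_ ⧸ V) →
        ∀ φ : V →ₗ[R] C, ∃ ψ : ((B →₀ R) ⧸ U) →ₗ[R] C, ∀ x : V, ψ x = φ x := by
  obtain ⟨κ, _, _, _⟩ := exists_isCardinalForSmallObjectArgument A B
  let f : ModuleCat.of R M ⟶ ModuleCat.of R PUnit.{u + 1} := 0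
  let I := ofHoms (firmInclusion A B)
  have h := SmallObject.transfiniteCompositionsOfShape_ιObj I κ f
  have h' : firmMono A (SmallObject.ιObj I κ f) :=
    transfiniteCompositionsOfShape_le _ _ _
      (transfiniteCompositionsOfShape_monotone _ (coproducts_pushouts_firmInclusion_le A B) _ h)
  refine ⟨(SmallObject.obj I κ f : ModuleCat.{u} R), _, _, (SmallObject.ιObj I κ f).hom, h'.1, h'.2,
    fun U V hV φ => ?_⟩
  have := SmallObject.rlp_πObj I κ f (firmInclusion A B ⟨U, V, hV⟩) ⟨_⟩
  have sq : CommSq (ModuleCat.ofHom φ) (firmInclusion A B ⟨U, V, hV⟩) (SmallObject.πObj I κ f) 0 :=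
    ⟨by ext⟩
  exact ⟨sq.lift.hom, fun x => ConcreteCategory.congr_hom sq.fac_left x⟩

end SmallObjectArgument

end HUnitary
end

noncomputable section

namespace HUnitary

/-! ### From extension of small maps to retractions -/

section Zorn

variable {R : Type u} [Ring R] {A : TwoSidedIdeal R}

theorem IsFirmFlat.quotient_of_exact {M N : Type*} [AddCommGroup M] [Module R M] [AddCommGroup N]
    [Module R N] {D : Submodule R M} {p : M →ₗ[R] N} (hN : IsFirmFlat A N)
    (hp : Function.Surjective p) (hD : ∀ x, p x = 0 ↔ x ∈ D) : IsFirmFlat A (M ⧸ D) := by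
  have h : D = LinearMap.ker p := Submodule.ext fun y => (hD y).symm
  exact hN.of_equiv ((Submodule.quotEquivOfEq _ _ h).trans (p.quotKerEquivOfSurjective hp)).symm

variable (A) in
/-- Maps to `C` extend along the inclusions of submodules with flat and firm cokernel in
quotients of the free module on `B`. -/
def ExtendsSmall (B C : Type u) [AddCommGroup C] [Module R C] : Prop :=
  ∀ (U : Submodule R (B →₀ R)) (V : Submodule R ((B →₀ R) ⧸ U)), IsFirmFlat A (_ ⧸ V) →
    ∀ φ : V →ₗ[R] C, ∃ ψ : ((B →₀ R) ⧸ U) →ₗ[R] C, ∀ x : V, ψ x = φ x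

variable {C N : Type u} [AddCommGroup C] [Module R C] [AddCommGroup N] [Module R N]

-- A module with at most as many elements as `B` is a quotient of the free module on `B`, so it
-- occurs up to isomorphism among the test inclusions.
open Cardinal in
theorem ExtendsSmall.exists_extension {B : Type u} (hC : ExtendsSmall A B C) {G : Type u}
    [AddCommGroup G] [Module R G] (hG : #G ≤ #B) (K : Submodule R G) (hK : IsFirmFlat A (G ⧸ K))
    (φ : K →ₗ[R] C) : ∃ ψ : G →ₗ[R] C, ∀ x : K, ψ x = φ x := by
  obtain ⟨e⟩ := hG
  let q : (B →₀ R) →ₗ[R] G := Finsupp.linearCombination R (Function.invFun e)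
  have hq : Function.Surjective q := fun g => by
    obtain ⟨b, rfl⟩ := Function.invFun_surjective e.injective g
    exact ⟨Finsupp.single b 1, by simp [q]⟩
  let ε := q.quotKerEquivOfSurjective hq
  obtain ⟨ψ, hψ⟩ := hC (LinearMap.ker q) (K.comap ε.toLinearMap)
    (hK.quotient_of_exact (p := K.mkQ ∘ₗ ε.toLinearMap) (K.mkQ_surjective.comp ε.surjective)
      fun x => Submodule.Quotient.mk_eq_zero _)
    (φ ∘ₗ ε.toLinearMap.restrict (p := K.comap ε.toLinearMap) (q := K) fun _ h => h)
  refine ⟨ψ ∘ₗ ε.symm.toLinearMap, fun x => ?_⟩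
  refine (hψ ⟨ε.symm x, by simp⟩).trans (congrArg φ (Subtype.ext ?_))
  exact ε.apply_symm_apply _

/-- The one-step extension in the proof of `ExtendsSmall.exists_retraction`. -/
theorem ExtendsSmall.exists_lt {κ : Cardinal.{u}} (hκ : Cardinal.aleph0 ≤ κ)
    (hR : Cardinal.mk R ≤ κ) {B : Type u} (hB : κ = Cardinal.mk B) (hC : ExtendsSmall A B C)
    (r : N →ₗ.[R] C) (hr : IsFirmFlat A (N ⧸ r.domain)) (hr' : idealSpan A r.domain = ⊤) {x : N}
    (hx : x ∉ r.domain) : ∃ r' : N →ₗ.[R] C, r < r' ∧ IsFirmFlat A (N ⧸ r'.domain) ∧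
      idealSpan A r'.domain = ⊤ := by
  classical
  -- The domain grows to the preimage `D` of a small pure submodule `S` containing the class of `x`;
  -- purity keeps both `S` and the new quotient firm flat.
  obtain ⟨S, hxS, hS, hSκ⟩ := exists_small_isPure (M := N ⧸ r.domain) hκ hR {r.domain.mkQ x}
    ((Cardinal.mk_singleton _).trans_le (Cardinal.one_le_aleph0.trans hκ))
  have hSf := hS.isFirmFlat hr
  let D := S.comap r.domain.mkQ
  have hle : r.domain ≤ D := fun y hy => by
    have h0 : r.domain.mkQ y = 0 := (Submodule.Quotient.mk_eq_zero _).2 hy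
    exact (h0 ▸ S.zero_mem : r.domain.mkQ y ∈ S)
  let π : D →ₗ[R] S := r.domain.mkQ.restrict fun _ h => h
  have hπ : Function.Surjective π := fun s => by
    obtain ⟨y, hy⟩ := r.domain.mkQ_surjective s
    exact ⟨⟨y, show r.domain.mkQ y ∈ S from hy ▸ s.2⟩, Subtype.ext hy⟩
  have hπ0 (y : D) : π y = 0 ↔ (y : N) ∈ r.domain := by
    rw [Subtype.ext_iff]
    exact Submodule.Quotient.mk_eq_zero _
  have hD : idealSpan A D = ⊤ := idealSpan_eq_top_of_extension (i := Submodule.inclusion hle)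
    (fun y hy => ⟨⟨y, (hπ0 y).1 hy⟩, rfl⟩) hπ hr' hSf.2
  choose l hl using hπ
  -- `D` need not be small, but a small `G` mapping to `D` already covers `S`. The kernel `K` of `G
  -- → S` maps into the old domain, so the partial map on `K` extends over `G`.
  obtain ⟨G, _, _, γ, hG, hGκ, hγ⟩ := exists_small_isFirmFlat hκ hR hD (Set.range l)
    (Cardinal.mk_range_le.trans hSκ)
  have hπγ : Function.Surjective (π ∘ₗ γ) := fun s => by
    obtain ⟨g, hg⟩ := hγ (l s) ⟨s, rfl⟩
    exact ⟨g, by rw [LinearMap.comp_apply, hg, hl]⟩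
  let K := LinearMap.ker (π ∘ₗ γ)
  let γ' : K →ₗ[R] r.domain := (D.subtype ∘ₗ γ).restrict fun k hk => (hπ0 (γ k)).1 hk
  obtain ⟨ψ, hψ⟩ := hC.exists_extension (hB ▸ hGκ) K
    (hSf.quotient_of_exact (p := π ∘ₗ γ) hπγ fun _ => Iff.rfl) (r.toFun ∘ₗ γ')
  let σ : (r.domain × G) →ₗ[R] D := (Submodule.inclusion hle).coprod γ
  have hσ : Function.Surjective σ := fun d => by
    obtain ⟨g, hg⟩ := hπγ (π d)
    have hd : π (d - γ g) = 0 := by rw [map_sub, sub_eq_zero]; exact hg.symm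
    exact ⟨(⟨_, (hπ0 _).1 hd⟩, g), Subtype.ext (sub_add_cancel (d : N) (γ g))⟩
  -- `D` is the old domain and `G` glued along `K`; the two maps agree there and descend to `D`.
  obtain ⟨ρ, hρ⟩ := exists_comp_eq_of_ker_le hσ (r.toFun.coprod ψ) (by
    rintro ⟨d, g⟩ h
    have h' : (d : N) + γ g = 0 := congrArg Subtype.val h
    have hg : g ∈ K := (hπ0 (γ g)).2 (by
      rw [← neg_eq_of_add_eq_zero_right h']
      exact neg_mem d.2)
    have hd : γ' ⟨g, hg⟩ = -d := Subtype.ext (neg_eq_of_add_eq_zero_right h').symm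
    have := hψ ⟨g, hg⟩
    rw [LinearMap.comp_apply, hd, map_neg] at this
    rw [LinearMap.coprod_apply, this, add_neg_cancel])
  refine ⟨⟨D, ρ⟩, lt_of_le_of_ne ⟨hle, fun y z hyz => ?_⟩ ?_,
    (hS.isFirmFlat_quotient hr).quotient_of_exact (p := S.mkQ ∘ₗ r.domain.mkQ)
      (S.mkQ_surjective.comp r.domain.mkQ_surjective) fun _ => Submodule.Quotient.mk_eq_zero _, hD⟩
  · have : z = σ (y, 0) := Subtype.ext (by simp [σ, hyz])
    change r.toFun y = ρ z
    rw [this, hρ]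
    simp
  · intro h
    have : x ∈ D := hxS rfl
    rw [h] at hx
    exact hx this

theorem IsFirmFlat.sSup_domain {c : Set (N →ₗ.[R] C)} (hc : DirectedOn (· ≤ ·) c)
    (hne : c.Nonempty) (h : ∀ r ∈ c, IsFirmFlat A (N ⧸ r.domain))
    (h' : ∀ r ∈ c, idealSpan A r.domain = ⊤) :
    IsFirmFlat A (N ⧸ (LinearPMap.sSup c hc).domain) ∧
      idealSpan A (LinearPMap.sSup c hc).domain = ⊤ := by
  have : Nonempty c := hne.to_subtype
  have : IsDirected c (· ≤ ·) := ⟨fun r s => by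
    obtain ⟨t, ht, hrt, hst⟩ := hc r r.2 s s.2
    exact ⟨⟨t, ht⟩, hrt, hst⟩⟩
  have hle (r : c) : r.1.domain ≤ (LinearPMap.sSup c hc).domain := (LinearPMap.le_sSup hc r.2).1
  refine ⟨⟨.of_directed (fun r : c => N ⧸ r.1.domain)
    (fun r s hrs => Submodule.factor (show r.1.domain ≤ s.1.domain from
      LinearPMap.domain_mono.monotone hrs)) (fun r => Submodule.factor (hle r)) ?_ ?_ ?_
    fun r => (h r r.2).1, ?_⟩, ?_⟩
  · intro r s hrs x
    obtain ⟨x, rfl⟩ := Submodule.mkQ_surjective _ x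
    rfl
  · intro x
    obtain ⟨x, rfl⟩ := Submodule.mkQ_surjective _ x
    exact ⟨Classical.arbitrary c, Submodule.Quotient.mk x, rfl⟩
  · intro r x hx
    obtain ⟨x, rfl⟩ := Submodule.mkQ_surjective _ x
    obtain ⟨s, hs, hxs⟩ := (LinearPMap.mem_domain_sSup_iff hne hc).1
      ((Submodule.Quotient.mk_eq_zero _).1 hx)
    obtain ⟨t, ht, hrt, hst⟩ := hc r r.2 s hs
    exact ⟨⟨t, ht⟩, hrt, (Submodule.Quotient.mk_eq_zero _).2 (hst.1 hxs)⟩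
  · obtain ⟨r⟩ := hne.to_subtype
    exact idealSpan_eq_top_of_surjective (Submodule.factor_surjective (hle r)) (h r r.2).2
  · refine idealSpan_eq_top_of_jointly_surjective fun ⟨x, hx⟩ => ?_
    obtain ⟨s, hs, hxs⟩ := (LinearPMap.mem_domain_sSup_iff hne hc).1 hx
    exact ⟨_, _, _, Submodule.inclusion (hle ⟨s, hs⟩), ⟨x, hxs⟩, h' s hs, rfl⟩

/-- Zorn's lemma is applied to partial retractions whose domain `D` satisfies `A D = D` and has firm
flat quotient `N / D`. Both conditions pass to unions of chains and allow a further step unless `D`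
is everything. -/
theorem ExtendsSmall.exists_retraction {B : Type u} (hB : Cardinal.aleph0 ≤ Cardinal.mk B)
    (hR : Cardinal.mk R ≤ Cardinal.mk B) (hC : ExtendsSmall A B C) (hAC : idealSpan A C = ⊤)
    {i : C →ₗ[R] N} (hi : Function.Injective i) (hN : IsFirmFlat A (N ⧸ LinearMap.range i)) :
    ∃ r : N →ₗ[R] C, ∀ c, r (i c) = c := by
  let e := LinearEquiv.ofInjective i hi
  let r₀ : N →ₗ.[R] C := ⟨LinearMap.range i, e.symm.toLinearMap⟩
  obtain ⟨r, hr₀, ⟨hr, hr'⟩, hmax⟩ := zorn_le_nonempty₀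
    {r : N →ₗ.[R] C | IsFirmFlat A (N ⧸ r.domain) ∧ idealSpan A r.domain = ⊤}
    (fun c hc hchain y hy => ⟨LinearPMap.sSup c hchain.directedOn,
      IsFirmFlat.sSup_domain _ ⟨y, hy⟩ (fun r hr => (hc hr).1) (fun r hr => (hc hr).2),
      fun z hz => LinearPMap.le_sSup _ hz⟩)
    r₀ ⟨hN, idealSpan_eq_top_of_surjective e.surjective hAC⟩
  have htop (x : N) : x ∈ r.domain := by
    by_contra hx
    obtain ⟨r', hlt, hr'⟩ := hC.exists_lt hB hR rfl r hr hr' hx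
    exact hlt.not_ge (hmax hr' hlt.le)
  refine ⟨r.toFun ∘ₗ LinearMap.id.codRestrict r.domain htop, fun c => ?_⟩
  have := hr₀.2 (x := e c) (y := ⟨i c, htop _⟩) rfl
  exact this.symm.trans (e.symm_apply_apply c)

end Zorn

end HUnitary
end

noncomputable section

namespace HUnitary

/-! ### The cotorsion pair of firm flat and cotorsion modules -/

section Cotorsion

variable {R : Type u} [Ring R] (A : TwoSidedIdeal R)

/-- `IsHUnitary` for unbundled modules. -/
abbrev HU (M : Type u) [AddCommGroup M] [Module R M] : Prop := IsHUnitary A (ModuleCat.of R M)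

/-- h-unitary modules `C` which are direct summands of any module `N ⊇ C` with `N / C` flat and
firm. -/
def IsCotorsion (C : Type u) [AddCommGroup C] [Module R C] : Prop :=
  HU A C ∧ ∀ (N : Type u) [AddCommGroup N] [Module R N] (i : C →ₗ[R] N), Function.Injective i →
    IsFirmFlat A (N ⧸ LinearMap.range i) → ∃ r : N →ₗ[R] C, ∀ c, r (i c) = c

variable {A} {K X F C D E : Type u} [AddCommGroup K] [Module R K] [AddCommGroup X] [Module R X]
  [AddCommGroup F] [Module R F] [AddCommGroup C] [Module R C] [AddCommGroup D] [Module R D]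
  [AddCommGroup E] [Module R E]

theorem HU.two_of_three {i : K →ₗ[R] X} {p : X →ₗ[R] F} (hF : HU A F) (hi : Function.Injective i)
    (hip : ∀ x, p x = 0 ↔ ∃ y, i y = x) (hp : Function.Surjective p) : HU A K ↔ HU A X :=
  isHUnitary_two_of_three (M' := ModuleCat.of R K) (M := ModuleCat.of R X)
    (M'' := ModuleCat.of R F) (f := i) (g := p) hi hip hp hF

theorem IsFirmFlat.hu (h : IsFirmFlat A F) : HU A F :=
  isHUnitary_of_isFirmFlat (M := ModuleCat.of R F) h

theorem HU.of_equiv (h : HU A K) (e : K ≃ₗ[R] X) : HU A X :=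
  isHUnitary_of_linearEquiv (M' := ModuleCat.of R K) (M := ModuleCat.of R X) e h

theorem HU.idealSpan_eq_top (h : HU A K) : idealSpan A K = ⊤ :=
  IsHUnitary.idealSpan_eq_top (M := ModuleCat.of R K) h

/-- The pushout of two linear maps. -/
theorem exists_pushout (φ : K →ₗ[R] C) (j : K →ₗ[R] X) :
    ∃ (N : Type u) (_ : AddCommGroup N) (_ : Module R N) (i : C →ₗ[R] N) (x : X →ₗ[R] N),
      (∀ n, ∃ c y, i c + x y = n) ∧ ∀ c y, i c + x y = 0 ↔ ∃ k, c = φ k ∧ y = -j k := by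
  let W := LinearMap.range (φ.prod (-j))
  refine ⟨(C × X) ⧸ W, inferInstance, inferInstance, W.mkQ ∘ₗ LinearMap.inl R C X,
    W.mkQ ∘ₗ LinearMap.inr R C X, fun n => ?_, fun c y => ?_⟩
  · obtain ⟨⟨c, y⟩, rfl⟩ := W.mkQ_surjective n
    exact ⟨c, y, by rw [LinearMap.comp_apply, LinearMap.comp_apply, ← map_add]; simp⟩
  · rw [LinearMap.comp_apply, LinearMap.comp_apply, ← map_add]
    refine (Submodule.Quotient.mk_eq_zero W).trans ?_
    simp only [W, LinearMap.mem_range, LinearMap.prod_apply, Function.prod, LinearMap.inl_apply,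
      LinearMap.inr_apply, Prod.mk_add_mk, add_zero, zero_add, Prod.mk.injEq, LinearMap.neg_apply]
    exact exists_congr fun k => and_congr eq_comm eq_comm

/-- The cokernel of a pushout. -/
theorem exists_pushout_cokernel {N : Type u} [AddCommGroup N] [Module R N] {i : C →ₗ[R] N}
    {x : X →ₗ[R] N} {φ : K →ₗ[R] C} {j : K →ₗ[R] X} {p : X →ₗ[R] F}
    (hN : ∀ n, ∃ c y, i c + x y = n) (h : ∀ c y, i c + x y = 0 ↔ ∃ k, c = φ k ∧ y = -j k)
    (hj : Function.Injective j) (hjp : ∀ x, p x = 0 ↔ ∃ y, j y = x) (hp : Function.Surjective p) :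
    Function.Injective i ∧ ∃ q : N →ₗ[R] F, Function.Surjective q ∧
      (∀ n, q n = 0 ↔ ∃ c, i c = n) ∧ ∀ y, q (x y) = p y := by
  have hs : Function.Surjective (i.coprod x) := fun n => by
    obtain ⟨c, y, h⟩ := hN n
    exact ⟨(c, y), by simpa using h⟩
  obtain ⟨q, hq⟩ := exists_comp_eq_of_ker_le hs ((0 : C →ₗ[R] F).coprod p) (by
    rintro ⟨c, y⟩ hcy
    obtain ⟨k, -, rfl⟩ := (h c y).1 (by simpa using hcy)
    simp [(hjp (j k)).2 ⟨k, rfl⟩])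
  have hqx (y) : q (x y) = p y := by simpa using hq (0, y)
  have hqi (c) : q (i c) = 0 := by simpa using hq (c, 0)
  refine ⟨?_, q, fun f => ?_, fun n => ⟨fun hn => ?_, ?_⟩, hqx⟩
  · rw [injective_iff_map_eq_zero]
    intro c hc
    obtain ⟨k, rfl, hk⟩ := (h c 0).1 (by simp [hc])
    have : k = 0 := hj (by rw [map_zero, ← neg_eq_zero, ← hk])
    simp [this]
  · obtain ⟨y, rfl⟩ := hp f
    exact ⟨x y, hqx y⟩
  · obtain ⟨c, y, rfl⟩ := hN n
    rw [map_add, hqi, zero_add, hqx] at hn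
    obtain ⟨k, rfl⟩ := (hjp y).1 hn
    have := (h (-φ k) (j k)).2 ⟨-k, by simp, by simp⟩
    exact ⟨c + φ k, by
      rw [map_neg, neg_add_eq_zero] at this
      rw [map_add, this]⟩
  · rintro ⟨c, rfl⟩
    exact hqi c

/-- Pushing the sequence out along `φ` gives an extension of `F` by `C`; its retraction restricts to
the required map on `X`. -/
theorem IsCotorsion.exists_extension (hC : IsCotorsion A C) {j : K →ₗ[R] X} {p : X →ₗ[R] F}
    (hF : IsFirmFlat A F) (hj : Function.Injective j) (hjp : ∀ x, p x = 0 ↔ ∃ y, j y = x)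
    (hp : Function.Surjective p) (φ : K →ₗ[R] C) : ∃ ψ : X →ₗ[R] C, ∀ k, ψ (j k) = φ k := by
  obtain ⟨N, _, _, i, x, hN, h⟩ := exists_pushout φ j
  obtain ⟨hi, q, hq, hiq, -⟩ := exists_pushout_cokernel hN h hj hjp hp
  obtain ⟨r, hr⟩ := hC.2 N i hi (hF.quotient_of_exact hq hiq)
  refine ⟨r ∘ₗ x, fun k => ?_⟩
  have := (h (φ (-k)) (j k)).2 ⟨-k, rfl, by simp⟩
  rw [map_neg, map_neg, neg_add_eq_zero] at this
  rw [LinearMap.comp_apply, ← this, hr]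

/-- Pulling the sequence back along `g` gives an extension of `F` by `C`; it splits, and the
splitting projects to `D`. -/
theorem IsCotorsion.exists_lift {i : C →ₗ[R] D} {q : D →ₗ[R] E} (hC : IsCotorsion A C)
    (hi : Function.Injective i) (hiq : ∀ x, q x = 0 ↔ ∃ y, i y = x) (hq : Function.Surjective q)
    (hF : IsFirmFlat A F) (g : F →ₗ[R] E) : ∃ h : F →ₗ[R] D, ∀ x, q (h x) = g x := by
  let P := LinearMap.ker (g.coprod (-q))
  have hP (z : P) : q z.1.2 = g z.1.1 := by
    have := z.2
    rw [LinearMap.mem_ker, LinearMap.coprod_apply, LinearMap.neg_apply, add_neg_eq_zero] at this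
    exact this.symm
  let π : P →ₗ[R] F := LinearMap.fst R F D ∘ₗ P.subtype
  have hπ : Function.Surjective π := fun f => by
    obtain ⟨y, hy⟩ := hq (g f)
    exact ⟨⟨(f, y), by simp [P, hy]⟩, rfl⟩
  let ι : C →ₗ[R] P := (LinearMap.inr R F D ∘ₗ i).codRestrict P fun c => by
    simp [P, (hiq (i c)).2 ⟨c, rfl⟩]
  obtain ⟨r, hr⟩ := hC.2 P ι (fun c c' h => hi (congrArg (fun z : P => z.1.2) h))
    (hF.quotient_of_exact hπ fun z => by
      constructor
      · intro hz
        obtain ⟨c, hc⟩ := (hiq z.1.2).1 (by rw [hP]; exact (congrArg g hz).trans (map_zero g))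
        exact ⟨c, Subtype.ext (Prod.ext hz.symm hc)⟩
      · rintro ⟨c, rfl⟩
        rfl)
  obtain ⟨h, hh⟩ := exists_comp_eq_of_ker_le hπ (LinearMap.snd R F D ∘ₗ P.subtype - i ∘ₗ r) (by
    intro z hz
    obtain ⟨c, hc⟩ := (hiq z.1.2).1 (by rw [hP]; exact (congrArg g hz).trans (map_zero g))
    have : ι c = z := Subtype.ext (Prod.ext hz.symm hc)
    rw [← this, LinearMap.sub_apply, LinearMap.comp_apply, LinearMap.comp_apply, hr]
    exact sub_self _)
  refine ⟨h, fun f => ?_⟩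
  obtain ⟨z, rfl⟩ := hπ f
  rw [hh, LinearMap.sub_apply, map_sub, LinearMap.comp_apply i, (hiq (i (r z))).2 ⟨_, rfl⟩,
    sub_zero]
  exact hP z

theorem IsCotorsion.of_equiv (hC : IsCotorsion A C) (e : C ≃ₗ[R] D) : IsCotorsion A D := by
  refine ⟨hC.1.of_equiv e, fun N _ _ i hi hN => ?_⟩
  obtain ⟨r, hr⟩ := hC.2 N (i ∘ₗ e.toLinearMap) (hi.comp e.injective)
    (by rwa [LinearMap.range_comp_of_range_eq_top _ e.range])
  refine ⟨e.toLinearMap ∘ₗ r, fun d => ?_⟩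
  have := hr (e.symm d)
  simp only [LinearMap.comp_apply, LinearEquiv.coe_coe, LinearEquiv.apply_symm_apply] at this ⊢
  rw [this, e.apply_symm_apply]

theorem isCotorsion_of_subsingleton [Subsingleton C] : IsCotorsion A C :=
  ⟨IsFirmFlat.hu isFirmFlat_of_subsingleton, fun _ _ _ _ _ _ => ⟨0, fun _ => Subsingleton.elim _ _⟩⟩

/-- Extend `q` to `π : N → E`. Then `N = ker π + D` and `ker π / C ≅ N / D`, so `ker π` retracts
onto `C`, and this retraction glues with the identity of `D`. -/
theorem IsCotorsion.of_extension {i : C →ₗ[R] D} {q : D →ₗ[R] E} (hC : IsCotorsion A C)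
    (hE : IsCotorsion A E) (hi : Function.Injective i) (hiq : ∀ x, q x = 0 ↔ ∃ y, i y = x)
    (hq : Function.Surjective q) : IsCotorsion A D := by
  refine ⟨(hE.1.two_of_three hi hiq hq).1 hC.1, fun N _ _ e he hN => ?_⟩
  have hex (n : N) : (LinearMap.range e).mkQ n = 0 ↔ ∃ d, e d = n :=
    Submodule.Quotient.mk_eq_zero _
  obtain ⟨π, hπ⟩ := hE.exists_extension hN he hex (Submodule.mkQ_surjective _) q
  let ι : C →ₗ[R] LinearMap.ker π := (e ∘ₗ i).codRestrict _ fun c => by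
    simp [hπ, (hiq (i c)).2 ⟨c, rfl⟩]
  have hsum (n : N) : ∃ (m : LinearMap.ker π) (d : D), (m : N) + e d = n := by
    obtain ⟨d, hd⟩ := hq (π n)
    exact ⟨⟨n - e d, by simp [hπ, hd]⟩, d, sub_add_cancel _ _⟩
  obtain ⟨r, hr⟩ := hC.exists_extension (j := ι)
    (p := (LinearMap.range e).mkQ ∘ₗ (LinearMap.ker π).subtype) hN
    (fun c c' h => hi (he (congrArg Subtype.val h)))
    (fun n => by
      refine (hex n).trans ⟨?_, ?_⟩
      · rintro ⟨d, hd⟩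
        obtain ⟨c, rfl⟩ := (hiq d).1 (by rw [← hπ, hd]; exact n.2)
        exact ⟨c, Subtype.ext hd⟩
      · rintro ⟨c, rfl⟩
        exact ⟨i c, rfl⟩)
    (fun y => by
      obtain ⟨n, rfl⟩ := Submodule.mkQ_surjective _ y
      obtain ⟨m, d, rfl⟩ := hsum n
      exact ⟨m, by
        rw [map_add, (hex (e d)).2 ⟨d, rfl⟩, add_zero]
        rfl⟩) LinearMap.id
  obtain ⟨ρ, hρ⟩ := exists_comp_eq_of_ker_le (π := (LinearMap.ker π).subtype.coprod e)
    (fun n => by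
      obtain ⟨m, d, h⟩ := hsum n
      exact ⟨(m, d), by simpa using h⟩)
    ((i ∘ₗ r).coprod LinearMap.id) (by
      rintro ⟨m, d⟩ h
      replace h : (m : N) + e d = 0 := by simpa using h
      have hd : q d = 0 := by
        have := congrArg π h
        rw [map_add, m.2, zero_add, hπ, map_zero] at this
        exact this
      obtain ⟨c, rfl⟩ := (hiq d).1 hd
      have : m = ι (-c) := Subtype.ext (by
        rw [eq_neg_of_add_eq_zero_left h, map_neg]
        rfl)
      rw [LinearMap.coprod_apply, this, LinearMap.comp_apply, hr]
      simp)
  refine ⟨ρ, fun d => ?_⟩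
  simpa using hρ (0, d)

/-- The hereditary property, without second Ext groups. Cover `N` by a firm flat `G`; the kernel `K`
of `G → N / E` is firm flat, so `K → E` lifts to `D` because `C` is cotorsion. The lift extends to
`G` because `D` is cotorsion, and its composite to `E` descends to `N`. -/
theorem IsCotorsion.of_coresolution {i : C →ₗ[R] D} {q : D →ₗ[R] E} (hC : IsCotorsion A C)
    (hD : IsCotorsion A D) (hE : HU A E) (hi : Function.Injective i)
    (hiq : ∀ x, q x = 0 ↔ ∃ y, i y = x) (hq : Function.Surjective q) : IsCotorsion A E := by
  refine ⟨hE, fun N _ _ e he hN => ?_⟩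
  have hex (n : N) : (LinearMap.range e).mkQ n = 0 ↔ ∃ d, e d = n :=
    Submodule.Quotient.mk_eq_zero _
  obtain ⟨G, _, _, γ, hG, hγ⟩ := exists_isFirmFlat_surjective
    (idealSpan_eq_top_of_extension (fun n => (hex n).1) (Submodule.mkQ_surjective _)
      hE.idealSpan_eq_top hN.2)
  let K := LinearMap.ker ((LinearMap.range e).mkQ ∘ₗ γ)
  have hsurj : Function.Surjective ((LinearMap.range e).mkQ ∘ₗ γ) :=
    (Submodule.mkQ_surjective _).comp hγ
  have hKex (g : G) : ((LinearMap.range e).mkQ ∘ₗ γ) g = 0 ↔ ∃ k, K.subtype k = g :=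
    ⟨fun h => ⟨⟨g, h⟩, rfl⟩, by rintro ⟨k, rfl⟩; exact k.2⟩
  have hK : IsFirmFlat A K := .of_ker Subtype.val_injective hKex hsurj hG hN.1
  obtain ⟨k, hk⟩ := exists_lift_of_injective he (γ ∘ₗ K.subtype) fun x => (hex _).1 x.2
  obtain ⟨l, hl⟩ := hC.exists_lift hi hiq hq hK k
  obtain ⟨L, hL⟩ := hD.exists_extension hN Subtype.val_injective hKex hsurj l
  obtain ⟨r, hr⟩ := exists_comp_eq_of_ker_le hγ (q ∘ₗ L) fun g hg => by
    have hgK : g ∈ K := by simp [K, hg]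
    have h0 : k ⟨g, hgK⟩ = 0 := he (by rw [hk, map_zero]; exact hg)
    exact (congrArg q (hL ⟨g, hgK⟩)).trans ((hl _).trans h0)
  refine ⟨r, fun x => ?_⟩
  obtain ⟨g, hg⟩ := hγ (e x)
  have hgK : g ∈ K := (hex (γ g)).2 ⟨x, hg.symm⟩
  rw [← hg, hr]
  refine (congrArg q (hL ⟨g, hgK⟩)).trans ((hl _).trans (he ?_))
  rw [hk]
  exact hg

theorem HU.exists_special_preenvelope (hX : HU A X) :
    ∃ (C : Type u) (_ : AddCommGroup C) (_ : Module R C) (η : X →ₗ[R] C),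
      Function.Injective η ∧ IsFirmFlat A (C ⧸ LinearMap.range η) ∧ IsCotorsion A C := by
  -- The index set `ℕ × R` is infinite and at least as large as `R`, as the Zorn argument requires.
  obtain ⟨C, _, _, η, hη, hF, hC⟩ := exists_firmMono_extension (A := A) (ℕ × R) X
  have hCu : HU A C := (hF.hu.two_of_three hη (fun n => Submodule.Quotient.mk_eq_zero _)
    (Submodule.mkQ_surjective _)).1 hX
  refine ⟨C, _, _, η, hη, hF, hCu, fun N _ _ i hi hN =>
    ExtendsSmall.exists_retraction (B := ℕ × R) ?_ ?_ hC hCu.idealSpan_eq_top hi hN⟩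
  · exact Cardinal.aleph0_le_mk _
  · exact Cardinal.mk_le_of_injective (f := fun r => ((0 : ℕ), r)) (Prod.mk_right_injective 0)

/-- Salce's trick: embed the kernel of a firm flat cover `G → X` in a cotorsion `C` with firm flat
cokernel. The pushout is an extension of that cokernel by `G`, hence firm flat, and maps onto `X`
with kernel `C`. -/
theorem HU.exists_special_precover (hX : HU A X) :
    ∃ (F : Type u) (_ : AddCommGroup F) (_ : Module R F) (p : F →ₗ[R] X),
      Function.Surjective p ∧ IsFirmFlat A F ∧ IsCotorsion A (LinearMap.ker p) := by
  obtain ⟨G, _, _, γ, hG, hγ⟩ := exists_isFirmFlat_surjective hX.idealSpan_eq_top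
  have hex (g : G) : γ g = 0 ↔ ∃ k, (LinearMap.ker γ).subtype k = g :=
    ⟨fun h => ⟨⟨g, h⟩, rfl⟩, by rintro ⟨k, rfl⟩; exact k.2⟩
  obtain ⟨C, _, _, η, hη, hF, hC⟩ := HU.exists_special_preenvelope
    ((hX.two_of_three Subtype.val_injective hex hγ).2 hG.hu)
  obtain ⟨N, _, _, i, x, hN, h⟩ := exists_pushout η (LinearMap.ker γ).subtype
  obtain ⟨hi, q, hq, hiq, -⟩ := exists_pushout_cokernel hN h Subtype.val_injective hex hγ
  obtain ⟨hx, q', hq', hxq', -⟩ := exists_pushout_cokernel (i := x) (x := i)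
    (φ := (LinearMap.ker γ).subtype) (j := η) (p := (LinearMap.range η).mkQ)
    (fun n => by
      obtain ⟨c, y, h⟩ := hN n
      exact ⟨y, c, by rw [add_comm, h]⟩)
    (fun y c => by
      rw [add_comm, h]
      exact ⟨fun ⟨k, hk, hk'⟩ => ⟨-k, by simp [hk'], by simp [hk]⟩,
        fun ⟨k, hk, hk'⟩ => ⟨-k, by simp [hk'], by simp [hk]⟩⟩)
    hη (fun n => Submodule.Quotient.mk_eq_zero _) (Submodule.mkQ_surjective _)
  refine ⟨N, _, _, q, hq, .of_extension hx hxq' hq' hG hF, hC.of_equiv ?_⟩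
  exact (LinearEquiv.ofInjective i hi).trans
    (LinearEquiv.ofEq _ _ (Submodule.ext fun n => (hiq n).symm))

/-- Two-out-of-three makes the middle term of an extension of a firm flat module by `C`
automatically h-unitary, so that condition on `N` can be dropped. -/
theorem isHUnitaryCotorsion_iff {C : ModuleCat.{u} R} :
    IsHUnitaryCotorsion A C ↔ IsCotorsion A C := by
  refine and_congr_right fun hC => ⟨fun h N _ _ i hi hN => ?_, fun h F hF N _ i p hi hip hp => ?_⟩
  · have hex (n : N) : (LinearMap.range i).mkQ n = 0 ↔ ∃ d, i d = n :=
      Submodule.Quotient.mk_eq_zero _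
    obtain ⟨s, hs⟩ := h (ModuleCat.of R (N ⧸ LinearMap.range i)) (isHUnitaryFlat_iff.2 hN)
      (ModuleCat.of R N) ((hN.hu.two_of_three hi hex (Submodule.mkQ_surjective _)).1 hC) i
      (LinearMap.range i).mkQ hi hex (Submodule.mkQ_surjective _)
    obtain ⟨r, hr⟩ := exists_lift_of_injective hi
      (LinearMap.id - (s : _ →ₗ[R] N) ∘ₗ (LinearMap.range i).mkQ) fun n => (hex _).1 (by
        have := LinearMap.congr_fun hs ((LinearMap.range i).mkQ n)
        exact (map_sub _ _ _).trans (sub_eq_zero.2 this.symm))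
    refine ⟨r, fun c => hi ?_⟩
    rw [hr, LinearMap.sub_apply, LinearMap.comp_apply, (hex (i c)).2 ⟨c, rfl⟩, map_zero, sub_zero]
    rfl
  · obtain ⟨r, hr⟩ := h N i hi ((isHUnitaryFlat_iff.1 hF).quotient_of_exact hp hip)
    obtain ⟨s, hs⟩ := exists_comp_eq_of_ker_le hp (LinearMap.id - i ∘ₗ r) (by
      intro n hn
      obtain ⟨c, rfl⟩ := (hip n).1 hn
      simp [hr])
    refine ⟨s, LinearMap.ext fun x => ?_⟩
    obtain ⟨n, rfl⟩ := hp x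
    rw [LinearMap.comp_apply, hs, LinearMap.sub_apply, map_sub, LinearMap.comp_apply,
      (hip (i (r n))).2 ⟨_, rfl⟩, sub_zero]
    rfl

end Cotorsion

end HUnitary
end

noncomputable section

namespace HUnitary

/-- A two-sided recursion: a state at `n` extends to a family of states indexed by the integers in
which consecutive states are related. -/
theorem exists_int_family {S : ℤ → Type*} (r : ∀ p, S p → S (p + 1) → Prop) (n : ℤ) (s : S n)
    (up : ∀ p s, ∃ s', r p s s') (down : ∀ p s', ∃ s, r p s s') :
    ∃ t : ∀ p, S p, t n = s ∧ ∀ p, r p (t p) (t (p + 1)) := by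
  choose u hu using up
  -- The downward step from `p` lands in `S (p - 1)`, while `r (p - 1)` expects its second argument
  -- in `S (p - 1 + 1)`; hence the cast.
  have down' (p) (s' : S p) : ∃ s : S (p - 1), ∀ h : p - 1 + 1 = p,
      r (p - 1) s (cast (congrArg S h.symm) s') := by
    obtain ⟨p, rfl⟩ : ∃ q, p = q + 1 := ⟨p - 1, by lia⟩
    obtain ⟨s, hs⟩ := down p s'
    obtain ⟨q, hq⟩ : ∃ q, q = p + 1 - 1 := ⟨_, rfl⟩
    rw [← hq]
    obtain rfl : q = p := by lia
    exact ⟨s, fun _ => hs⟩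
  choose d hd using down'
  let t (p : ℤ) : S p := Int.inductionOn' p n s (fun k _ => u k) (fun k _ => d k)
  refine ⟨t, Int.inductionOn'_self, fun p => ?_⟩
  rcases le_or_gt n p with h | h
  · have : t (p + 1) = u p (t p) := Int.inductionOn'_add_one h
    exact this ▸ hu p (t p)
  · obtain ⟨q, rfl⟩ : ∃ q, p = q - 1 := ⟨p + 1, by lia⟩
    have : t (q - 1) = d q (t q) := Int.inductionOn'_sub_one (by lia)
    rw [this]
    have hq : q - 1 + 1 = q := by lia
    have key := hd q (t q) hq
    have hcast (a) (ha : a = q) : cast (congrArg S ha.symm) (t q) = t a := by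
      subst ha
      rfl
    rwa [hcast _ hq] at key

/-! ### Exact sequences indexed by the integers and null-homotopies -/

section ExactFamilies

variable {R : Type u} [Ring R] {A : TwoSidedIdeal R} {X C : ℤ → Type u} [∀ i, AddCommGroup (X i)]
  [∀ i, Module R (X i)] [∀ i, AddCommGroup (C i)] [∀ i, Module R (C i)]

/-- Exactness of a sequence of linear maps indexed by the integers. -/
def IsExactFamily (d : ∀ i, X i →ₗ[R] X (i + 1)) : Prop :=
  ∀ i x, d (i + 1) x = 0 ↔ ∃ y, d i y = x

variable {d : ∀ i, X i →ₗ[R] X (i + 1)} {e : ∀ i, C i →ₗ[R] C (i + 1)}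

/-- The differential of an exact sequence as a map onto the cycles. -/
def IsExactFamily.toCycles (hd : IsExactFamily d) (i : ℤ) :
    X i →ₗ[R] LinearMap.ker (d (i + 1)) :=
  (d i).codRestrict _ fun x => (hd i _).2 ⟨x, rfl⟩

theorem IsExactFamily.toCycles_surjective (hd : IsExactFamily d) (i : ℤ) :
    Function.Surjective (hd.toCycles i) := fun z => by
  obtain ⟨y, hy⟩ := (hd i z).1 z.2
  exact ⟨y, Subtype.ext hy⟩

theorem IsExactFamily.toCycles_eq_zero (hd : IsExactFamily d) (i : ℤ) (x : X i) :
    hd.toCycles i x = 0 ↔ ∃ z, (LinearMap.ker (d i)).subtype z = x :=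
  Subtype.ext_iff.trans ⟨fun h => ⟨⟨x, h⟩, rfl⟩, by rintro ⟨z, rfl⟩; exact z.2⟩

theorem IsExactFamily.hu (hd : IsExactFamily d) (hX : ∀ i, HU A (LinearMap.ker (d i))) (i : ℤ) :
    HU A (X i) :=
  ((hX (i + 1)).two_of_three Subtype.val_injective (hd.toCycles_eq_zero i)
    (hd.toCycles_surjective i)).1 (hX i)

theorem IsExactFamily.isFirmFlat (hd : IsExactFamily d)
    (hX : ∀ i, IsFirmFlat A (LinearMap.ker (d i))) (i : ℤ) : IsFirmFlat A (X i) :=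
  .of_extension Subtype.val_injective (hd.toCycles_eq_zero i) (hd.toCycles_surjective i) (hX i)
    (hX (i + 1))

theorem IsExactFamily.isCotorsion (hd : IsExactFamily d)
    (hX : ∀ i, IsCotorsion A (LinearMap.ker (d i))) (i : ℤ) : IsCotorsion A (X i) :=
  .of_extension (hX i) (hX (i + 1)) Subtype.val_injective (hd.toCycles_eq_zero i)
    (hd.toCycles_surjective i)

/-- Maps of degree `n` which commute with the differentials, from an exact sequence with flat and
firm cycles to one with cotorsion cycles, are null-homotopic. -/
theorem exists_nullhomotopy (hd : IsExactFamily d) (he : IsExactFamily e)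
    (hX : ∀ i, IsFirmFlat A (LinearMap.ker (d i))) (hC : ∀ i, IsCotorsion A (LinearMap.ker (e i)))
    (n : ℤ) (f : ∀ p q, p + n = q → X p →ₗ[R] C q)
    (hf : ∀ p q h h' x, e q (f p q h x) = f (p + 1) (q + 1) h' (d p x)) :
    ∃ t : ∀ p q, p + n = q + 1 → X p →ₗ[R] C q, ∀ p q h h' x,
      f p (q + 1) h x = e q (t p q h x) + t (p + 1) (q + 1) h' (d p x) := by
  -- First solve the problem on cycles: `f` maps cycles to cycles, lifts through the differential
  -- since its kernel is cotorsion, and the lift extends to `X p` since `C q` is cotorsion and `X p`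
  -- modulo cycles is firm flat.
  have hv (p q) (h : p + n = q + 1) : ∃ v : X p →ₗ[R] C q, ∀ x, d p x = 0 →
      e q (v x) = f p (q + 1) h x := by
    let g : LinearMap.ker (d p) →ₗ[R] LinearMap.ker (e (q + 1)) :=
      (f p (q + 1) h).restrict fun x hx => by
        rw [LinearMap.mem_ker, hf _ _ _ (by lia), hx, map_zero]
    obtain ⟨u, hu⟩ := (hC q).exists_lift Subtype.val_injective (he.toCycles_eq_zero q)
      (he.toCycles_surjective q) (hX p) g
    obtain ⟨v, hv⟩ := (he.isCotorsion hC q).exists_extension (hX (p + 1)) Subtype.val_injective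
      (hd.toCycles_eq_zero p) (hd.toCycles_surjective p) u
    exact ⟨v, fun x hx => (congrArg (e q) (hv ⟨x, hx⟩)).trans (congrArg Subtype.val (hu ⟨x, hx⟩))⟩
  choose v hv using hv
  -- The error `f - e v - v d` vanishes on cycles and takes values in cycles, so it factors through
  -- `ker (d (p + 1))`, a firm flat module, and lifts through `e q`.
  have hc (p q) (h : p + n = q + 1) : ∃ c : LinearMap.ker (d (p + 1)) →ₗ[R] C q,
      ∀ h' x, e q (c (hd.toCycles p x)) =
        f p (q + 1) h x - e q (v p q h x) - v (p + 1) (q + 1) h' (d p x) := by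
    have h' : p + 1 + n = q + 1 + 1 := by omega
    let w := f p (q + 1) h - e q ∘ₗ v p q h - v (p + 1) (q + 1) h' ∘ₗ d p
    have hd0 (x) : d (p + 1) (d p x) = 0 := (hd p _).2 ⟨x, rfl⟩
    have hw (x) : e (q + 1) (w x) = 0 := by
      change e (q + 1) (f p (q + 1) h x - e q (v p q h x) - v (p + 1) (q + 1) h' (d p x)) = 0
      rw [map_sub, map_sub, (he q (e q _)).2 ⟨_, rfl⟩, hv _ _ _ _ (hd0 x), hf _ _ _ h', sub_zero,
        sub_self]
    obtain ⟨w', hw'⟩ := exists_comp_eq_of_ker_le (hd.toCycles_surjective p)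
      (w.codRestrict (LinearMap.ker (e (q + 1))) hw) fun x hx => by
        obtain ⟨z, rfl⟩ := (hd.toCycles_eq_zero p x).1 hx
        have hz : d p ((LinearMap.ker (d p)).subtype z) = 0 := z.2
        refine Subtype.ext ?_
        change f p (q + 1) h _ - e q (v p q h _) - v (p + 1) (q + 1) h' (d p _) = 0
        rw [hz, hv _ _ _ _ hz, sub_self, map_zero, sub_zero]
    obtain ⟨c, hc⟩ := (hC q).exists_lift Subtype.val_injective (he.toCycles_eq_zero q)
      (he.toCycles_surjective q) (hX (p + 1)) w'
    exact ⟨c, fun _ x => congrArg Subtype.val ((hc _).trans (hw' x))⟩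
  choose c hc using hc
  refine ⟨fun p q h => v p q h + c p q h ∘ₗ hd.toCycles p, fun p q h h' x => ?_⟩
  -- The correction is precomposed with the differential, so it contributes only to the `e t` term
  -- and not to the `t d` term.
  have h0 : hd.toCycles (p + 1) (d p x) = 0 := Subtype.ext ((hd p _).2 ⟨x, rfl⟩)
  simp only [LinearMap.add_apply, LinearMap.comp_apply, map_add, hc p q h h', h0, map_zero]
  abel

end ExactFamilies

/-! ### Translation to cochain complexes and the Hom complex -/

section CochainComplexes

variable {R : Type u} [Ring R] {A : TwoSidedIdeal R} {X Y : CochainComplex (ModuleCat.{u} R) ℤ}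

theorem acyclic_iff : X.Acyclic ↔ IsExactFamily fun i => (X.d i (i + 1)).hom := by
  have h (i : ℤ) : X.ExactAt (i + 1) ↔ ∀ x, (X.d (i + 1) (i + 1 + 1)).hom x = 0 ↔
      ∃ y, (X.d i (i + 1)).hom y = x := by
    rw [X.exactAt_iff' i (i + 1) (i + 1 + 1) (by simp) (by simp),
      ShortComplex.moduleCat_exact_iff]
    refine forall_congr' fun x => ⟨fun h => ⟨h, ?_⟩, fun h => h.1⟩
    rintro ⟨y, rfl⟩
    exact ConcreteCategory.congr_hom (X.d_comp_d i (i + 1) (i + 1 + 1)) y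
  refine ⟨fun hX i => (h i).1 (hX _), fun hX i => ?_⟩
  obtain ⟨i, rfl⟩ : ∃ j, i = j + 1 := ⟨i - 1, by lia⟩
  exact (h i).2 (hX i)

theorem exactComplexes_iff : exactComplexes A X ↔ X.Acyclic ∧
    ∀ i, HU A (LinearMap.ker (X.d i (i + 1)).hom) := by
  refine ⟨fun h => ⟨h.2, fun i => (h.1 i).1⟩, fun ⟨h, hX⟩ => ⟨fun i => ⟨hX i, ?_, ?_⟩, h⟩⟩
  · exact (acyclic_iff.1 h).hu hX i
  · refine (hX (i + 1)).of_equiv (LinearEquiv.ofEq _ _ (Submodule.ext fun x => ?_))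
    exact acyclic_iff.1 h i x

theorem flatComplexes_iff : flatComplexes A X ↔ X.Acyclic ∧
    ∀ i, IsFirmFlat A (LinearMap.ker (X.d i (i + 1)).hom) := by
  refine ⟨fun h => ⟨h.1.2, fun i => isHUnitaryFlat_iff.1 (h.2 i)⟩, fun ⟨h, hX⟩ =>
    ⟨exactComplexes_iff.2 ⟨h, fun i => (hX i).hu⟩, fun i => isHUnitaryFlat_iff.2 (hX i)⟩⟩

theorem cotorsionComplexes_iff : cotorsionComplexes A X ↔ X.Acyclic ∧
    ∀ i, IsCotorsion A (LinearMap.ker (X.d i (i + 1)).hom) := by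
  refine ⟨fun h => ⟨h.1.2, fun i => isHUnitaryCotorsion_iff.1 (h.2 i)⟩, fun ⟨h, hX⟩ =>
    ⟨exactComplexes_iff.2 ⟨h, fun i => (hX i).1⟩, fun i => isHUnitaryCotorsion_iff.2 (hX i)⟩⟩

open CochainComplex CochainComplex.HomComplex in
theorem homComplex_acyclic_iff : (HomComplex X Y).Acyclic ↔
    ∀ (n : ℤ) (z : Cochain X Y n), δ n (n + 1) z = 0 →
      ∃ s : Cochain X Y (n - 1), δ (n - 1) n s = z := by
  refine forall_congr' fun n => ?_
  rw [(HomComplex X Y).exactAt_iff' (n - 1) n (n + 1) (by simp) (by simp),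
    ShortComplex.ab_exact_iff]
  rfl

open CochainComplex CochainComplex.HomComplex in
theorem homComplex_acyclic (hX : flatComplexes A X) (hY : cotorsionComplexes A Y) :
    (HomComplex X Y).Acyclic := by
  rw [flatComplexes_iff, acyclic_iff] at hX
  rw [cotorsionComplexes_iff, acyclic_iff] at hY
  rw [homComplex_acyclic_iff]
  intro n z hz
  let ε : ℤ := n.negOnePow
  have hε : ε * ε = 1 := by
    simp only [ε, ← Units.val_mul, Int.units_mul_self, Units.val_one]
  have hε' (M : Type u) [AddCommGroup M] (x : M) : ε • ε • x = x := by
    rw [smul_smul, hε, one_smul]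
  -- A cocycle of degree `n` commutes with the differentials up to `(-1)ⁿ`. Putting this sign into
  -- the differential of `Y` makes it commute strictly and leaves the cycles unchanged.
  let e (i : ℤ) : Y.X i →ₗ[R] Y.X (i + 1) := ε • (Y.d i (i + 1)).hom
  have hker (i : ℤ) : LinearMap.ker (e i) = LinearMap.ker (Y.d i (i + 1)).hom := by
    ext x
    refine ⟨fun h => ?_, fun h => ?_⟩
    · have := congrArg (ε • ·) (LinearMap.mem_ker.1 h)
      simpa [e, hε'] using this
    · simp only [LinearMap.mem_ker, e, LinearMap.smul_apply] at h ⊢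
      rw [h, smul_zero]
  have he : IsExactFamily e := fun i x => by
    have h1 : e (i + 1) x = 0 ↔ (Y.d (i + 1) (i + 1 + 1)).hom x = 0 := by
      rw [← LinearMap.mem_ker, hker, LinearMap.mem_ker]
    rw [h1, hY.1]
    constructor <;> rintro ⟨y, rfl⟩ <;> refine ⟨ε • y, ?_⟩
    · simp [e, hε']
    · simp [e]
  obtain ⟨t, ht⟩ := exists_nullhomotopy hX.1 he hX.2 (fun i => by rw [hker]; exact hY.2 i) n
    (fun p q h => (z.v p q h).hom) fun p q h h' x => by
      have := Cochain.congr_v hz p (q + 1) (by lia)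
      rw [δ_v n (n + 1) rfl z p (q + 1) (by lia) q (p + 1) (by lia) rfl, Cochain.zero_v] at this
      rw [Int.negOnePow_succ, Units.smul_def, Units.val_neg, neg_smul, ← sub_eq_add_neg,
        sub_eq_zero] at this
      have hx := ConcreteCategory.congr_hom this x
      have hx' : (Y.d q (q + 1)).hom ((z.v p q h).hom x) =
        ε • (z.v (p + 1) (q + 1) h').hom ((X.d p (p + 1)).hom x) := hx
      rw [LinearMap.smul_apply, hx', hε']
  refine ⟨Cochain.mk fun p q h => ModuleCat.ofHom (ε • t p q (by omega)), ?_⟩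
  ext p q h x
  obtain ⟨q, rfl⟩ : ∃ r, q = r + 1 := ⟨q - 1, by omega⟩
  rw [δ_v (n - 1) n (by omega) _ p (q + 1) h q (p + 1) (by omega) rfl, Cochain.mk_v, Cochain.mk_v,
    Units.smul_def]
  have hx := ht p q h (by omega) x
  refine Eq.trans ?_ hx.symm
  change (Y.d q (q + 1)).hom (ε • t p q h x) +
    ε • ε • t (p + 1) (q + 1) _ ((X.d p (p + 1)).hom x) = _
  rw [hε', map_zsmul]
  rfl

open CochainComplex CochainComplex.HomComplex in
theorem exists_homotopy_of_homComplex_acyclic (h : (HomComplex X Y).Acyclic) (f : X ⟶ Y) :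
    ∃ s : ∀ q, X.X (q + 1) →ₗ[R] Y.X q, ∀ q x, (f.f (q + 1)).hom x =
      (Y.d q (q + 1)).hom (s q x) + s (q + 1) ((X.d (q + 1) (q + 1 + 1)).hom x) := by
  obtain ⟨s, hs⟩ := homComplex_acyclic_iff.1 h 0 (Cochain.ofHom f) (δ_ofHom f)
  refine ⟨fun q => (s.v (q + 1) q (by lia)).hom, fun q x => ?_⟩
  have := Cochain.congr_v hs (q + 1) (q + 1) (by lia)
  rw [δ_v (0 - 1) 0 (by lia) s (q + 1) (q + 1) (by lia) q (q + 1 + 1) (by lia) rfl,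
    Cochain.ofHom_v] at this
  rw [← this]
  simp

end CochainComplexes

end HUnitary
end

noncomputable section

namespace HUnitary

/-! ### Splicing short exact sequences into exact complexes -/

section Gluing

variable {R : Type u} [Ring R] {A : TwoSidedIdeal R} {Z X : ℤ → ModuleCat.{u} R}
  {i : ∀ p, Z p →ₗ[R] X p} {π : ∀ p, X p →ₗ[R] Z (p + 1)}

/-- The complex obtained by splicing short exact sequences. -/
def splice (i : ∀ p, Z p →ₗ[R] X p) (π : ∀ p, X p →ₗ[R] Z (p + 1))
    (hiπ : ∀ p x, π p x = 0 ↔ ∃ z, i p z = x) : CochainComplex (ModuleCat.{u} R) ℤ :=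
  CochainComplex.of X (fun p => ModuleCat.ofHom (i (p + 1) ∘ₗ π p)) fun p => by
    ext x
    have : π (p + 1) (i (p + 1) (π p x)) = 0 := (hiπ _ _).2 ⟨_, rfl⟩
    exact (congrArg (i (p + 1 + 1)) this).trans (map_zero _)

variable {hiπ : ∀ p x, π p x = 0 ↔ ∃ z, i p z = x}

theorem splice_d (p : ℤ) :
    (splice i π hiπ).d p (p + 1) = ModuleCat.ofHom (i (p + 1) ∘ₗ π p) :=
  CochainComplex.of_d (V := ModuleCat.{u} R) X (fun p => ModuleCat.ofHom (i (p + 1) ∘ₗ π p)) p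

theorem splice_d_apply (p : ℤ) (x : X p) :
    ((splice i π hiπ).d p (p + 1)).hom x = i (p + 1) (π p x) :=
  ConcreteCategory.congr_hom (splice_d p) x

theorem splice_d_eq_zero_iff (hi : ∀ p, Function.Injective (i p)) (p : ℤ) (x : X p) :
    ((splice i π hiπ).d p (p + 1)).hom x = 0 ↔ ∃ z, i p z = x := by
  refine Iff.trans ?_ (hiπ p x)
  refine ⟨fun h => hi (p + 1) (((splice_d_apply p x).symm.trans h).trans (map_zero _).symm),
    fun h => (splice_d_apply p x).trans ?_⟩
  rw [h]
  exact map_zero _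

theorem splice_acyclic (hi : ∀ p, Function.Injective (i p)) (hπ : ∀ p, Function.Surjective (π p)) :
    (splice i π hiπ).Acyclic := by
  refine acyclic_iff.2 fun p (x : X (p + 1)) => (splice_d_eq_zero_iff hi (p + 1) x).trans ?_
  constructor
  · rintro ⟨z, rfl⟩
    obtain ⟨y, rfl⟩ := hπ _ z
    exact ⟨y, splice_d_apply p y⟩
  · rintro ⟨y, rfl⟩
    exact ⟨π p y, (splice_d_apply p y).symm⟩

/-- The cycles of a spliced complex. -/
def spliceCycles (hi : ∀ p, Function.Injective (i p)) (p : ℤ) :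
    Z p ≃ₗ[R] LinearMap.ker ((splice i π hiπ).d p (p + 1)).hom :=
  (LinearEquiv.ofInjective (i p) (hi p)).trans
    (LinearEquiv.ofEq _ _ (Submodule.ext fun x => (splice_d_eq_zero_iff hi p x).symm))

theorem splice_mem_flatComplexes (hi : ∀ p, Function.Injective (i p))
    (hπ : ∀ p, Function.Surjective (π p)) (hZ : ∀ p, IsFirmFlat A (Z p)) :
    flatComplexes A (splice i π hiπ) :=
  flatComplexes_iff.2 ⟨splice_acyclic hi hπ, fun p => (hZ p).of_equiv (spliceCycles hi p)⟩

theorem splice_mem_cotorsionComplexes (hi : ∀ p, Function.Injective (i p))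
    (hπ : ∀ p, Function.Surjective (π p)) (hZ : ∀ p, IsCotorsion A (Z p)) :
    cotorsionComplexes A (splice i π hiπ) :=
  cotorsionComplexes_iff.2 ⟨splice_acyclic hi hπ, fun p => (hZ p).of_equiv (spliceCycles hi p)⟩

end Gluing

/-! ### Exact dg-cotorsion complexes have cotorsion cycles -/

section Lifting

variable {R : Type u} [Ring R] {A : TwoSidedIdeal R} {Y : CochainComplex (ModuleCat.{u} R) ℤ}

variable (A Y) in
/-- A map from a flat and firm module to the cycles of a complex. -/
structure FlatCycle (p : ℤ) where
  /-- the source of the map -/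
  Z : ModuleCat.{u} R
  /-- the map -/
  g : Z →ₗ[R] Y.X p
  isFirmFlat : IsFirmFlat A Z
  d_g : ∀ z, (Y.d p (p + 1)).hom (g z) = 0

/-- A map of short exact sequences connecting two objects of `FlatCycle`. -/
def FlatCycle.Rel (p : ℤ) (s : FlatCycle A Y p) (s' : FlatCycle A Y (p + 1)) : Prop :=
  ∃ (X : ModuleCat.{u} R) (i : s.Z →ₗ[R] X) (π : X →ₗ[R] s'.Z) (φ : X →ₗ[R] Y.X p),
    Function.Injective i ∧ (∀ x, π x = 0 ↔ ∃ z, i z = x) ∧ Function.Surjective π ∧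
      (∀ z, φ (i z) = s.g z) ∧ ∀ x, (Y.d p (p + 1)).hom (φ x) = s'.g (π x)

theorem FlatCycle.exists_rel_right (p : ℤ) (s : FlatCycle A Y p) : ∃ s', s.Rel p s' :=
  ⟨⟨ModuleCat.of R PUnit, 0, isFirmFlat_of_subsingleton (M := PUnit), fun _ => map_zero _⟩,
    s.Z, LinearMap.id, 0, s.g, fun _ _ h => h, fun x => ⟨fun _ => ⟨x, rfl⟩, fun _ => rfl⟩,
    fun _ => ⟨0, rfl⟩, fun _ => rfl, s.d_g⟩

/-- Pull `Y p → ker d` back along `s'.g`. The result is an extension of `s'.Z` by h-unitary cycles,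
so a firm flat `G` covers it, and the kernel of `G → s'.Z` is firm flat. -/
theorem FlatCycle.exists_rel_left (hY : IsExactFamily fun i => (Y.d i (i + 1)).hom)
    (hYu : ∀ i, HU A (LinearMap.ker (Y.d i (i + 1)).hom)) (p : ℤ) (s' : FlatCycle A Y (p + 1)) :
    ∃ s, FlatCycle.Rel p s s' := by
  let d := (Y.d p (p + 1)).hom
  let E := LinearMap.ker (s'.g.coprod (-d))
  have hE (z : E) : d z.1.2 = s'.g z.1.1 := by
    have := z.2
    rw [LinearMap.mem_ker, LinearMap.coprod_apply, LinearMap.neg_apply, add_neg_eq_zero] at this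
    exact this.symm
  let q : E →ₗ[R] s'.Z := LinearMap.fst R s'.Z (Y.X p) ∘ₗ E.subtype
  have hq : Function.Surjective q := fun z => by
    obtain ⟨y, hy⟩ := (hY p _).1 (s'.d_g z)
    exact ⟨⟨(z, y), by
      rw [LinearMap.mem_ker, LinearMap.coprod_apply, LinearMap.neg_apply, ← hy]
      exact add_neg_cancel _⟩, rfl⟩
  let ι : LinearMap.ker d →ₗ[R] E :=
    (LinearMap.inr R s'.Z (Y.X p) ∘ₗ (LinearMap.ker d).subtype).codRestrict E fun c => by
      simp [E]
  have hE' : idealSpan A E = ⊤ := idealSpan_eq_top_of_extension (i := ι) (p := q)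
    (fun z hz => ⟨⟨z.1.2, by
      rw [LinearMap.mem_ker, hE]
      exact (congrArg s'.g hz).trans (map_zero _)⟩, Subtype.ext (Prod.ext hz.symm rfl)⟩) hq
    (hYu p).idealSpan_eq_top s'.isFirmFlat.2
  obtain ⟨G, _, _, γ, hG, hγ⟩ := exists_isFirmFlat_surjective hE'
  let K := LinearMap.ker (q ∘ₗ γ)
  have hK (g : G) : (q ∘ₗ γ) g = 0 ↔ ∃ k, K.subtype k = g :=
    ⟨fun h => ⟨⟨g, h⟩, rfl⟩, by rintro ⟨k, rfl⟩; exact k.2⟩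
  let φ : G →ₗ[R] Y.X p := LinearMap.snd R s'.Z (Y.X p) ∘ₗ E.subtype ∘ₗ γ
  exact ⟨⟨ModuleCat.of R K, φ ∘ₗ K.subtype,
    .of_ker Subtype.val_injective hK (hq.comp hγ) hG s'.isFirmFlat.1, fun k => by
      refine (hE (γ k)).trans ((congrArg s'.g k.2).trans (map_zero _))⟩,
    ModuleCat.of R G, K.subtype, q ∘ₗ γ, φ, Subtype.val_injective, hK, hq.comp hγ, fun _ => rfl,
    fun x => hE (γ x)⟩

/-- Grow `g` into a chain map from an h-unitary flat complex having `F` as a cycle module, with zero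
cycle modules available to the right. A null-homotopy restricted to those cycles loses its `s d`
term and is a lift of `g`. -/
theorem exists_lift_of_homComplex_acyclic (hY : IsExactFamily fun i => (Y.d i (i + 1)).hom)
    (hYu : ∀ i, HU A (LinearMap.ker (Y.d i (i + 1)).hom))
    (h : ∀ X, flatComplexes A X → (CochainComplex.HomComplex X Y).Acyclic) {F : Type u}
    [AddCommGroup F] [Module R F] (hF : IsFirmFlat A F) (m : ℤ) (g : F →ₗ[R] Y.X (m + 1))
    (hg : ∀ x, (Y.d (m + 1) (m + 1 + 1)).hom (g x) = 0) :
    ∃ l : F →ₗ[R] Y.X m, ∀ x, (Y.d m (m + 1)).hom (l x) = g x := by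
  obtain ⟨t, ht, hrel⟩ := exists_int_family FlatCycle.Rel (m + 1)
    (⟨ModuleCat.of R F, g, hF, hg⟩ : FlatCycle A Y (m + 1)) FlatCycle.exists_rel_right
    (FlatCycle.exists_rel_left hY hYu)
  choose X i π φ hi hiπ hπ hφi hφ using hrel
  let f : splice i π hiπ ⟶ Y :=
    { f := fun p => ModuleCat.ofHom (φ p)
      comm' := by
        rintro p _ rfl
        rw [splice_d]
        ext x
        exact (hφ p x).trans (hφi _ _).symm }
  obtain ⟨s, hs⟩ := exists_homotopy_of_homComplex_acyclic
    (h _ (splice_mem_flatComplexes hi hπ fun p => (t p).isFirmFlat)) f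
  have key (z : (t (m + 1)).Z) : (Y.d m (m + 1)).hom (s m (i (m + 1) z)) = (t (m + 1)).g z := by
    have := hs m (i (m + 1) z)
    rw [(splice_d_eq_zero_iff hi (m + 1) (i (m + 1) z)).2 ⟨z, rfl⟩, map_zero, add_zero] at this
    exact this.symm.trans (hφi _ z)
  have key' : ∃ l : (t (m + 1)).Z →ₗ[R] Y.X m, ∀ x, (Y.d m (m + 1)).hom (l x) = (t (m + 1)).g x :=
    ⟨s m ∘ₗ i (m + 1), key⟩
  rw [ht] at key'
  exact key'

theorem cotorsionComplexes_of_dgCotorsionComplexes (h : dgCotorsionComplexes A Y)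
    (hY : exactComplexes A Y) : cotorsionComplexes A Y := by
  rw [exactComplexes_iff] at hY
  have hYe := acyclic_iff.1 hY.1
  refine cotorsionComplexes_iff.2 ⟨hY.1, fun n => ⟨hY.2 n, fun N _ _ e he hN => ?_⟩⟩
  let d (n : ℤ) := (Y.d n (n + 1)).hom
  have hex (n : N) : (LinearMap.range e).mkQ n = 0 ↔ ∃ d, e d = n :=
    Submodule.Quotient.mk_eq_zero _
  -- The inclusion of the cycles extends to `ψ : N → Y n`. The defect `d ψ` lives on the cokernel
  -- and lifts through `d`; subtracting the lift gives a retraction onto the cycles.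
  obtain ⟨ψ, hψ⟩ := (isHUnitaryCotorsion_iff.1 (h.2.1 n)).exists_extension hN he hex
    (Submodule.mkQ_surjective _) (LinearMap.ker (d n)).subtype
  obtain ⟨g, hg⟩ := exists_comp_eq_of_ker_le (Submodule.mkQ_surjective (LinearMap.range e))
    (d n ∘ₗ ψ) fun x hx => by
      obtain ⟨z, rfl⟩ := (hex x).1 hx
      exact (congrArg (d n) (hψ z)).trans z.2
  obtain ⟨l, hl⟩ := exists_lift_of_homComplex_acyclic hYe hY.2 h.2.2 hN n g fun x => by
    obtain ⟨x, rfl⟩ := Submodule.mkQ_surjective _ x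
    rw [hg]
    exact (hYe n _).2 ⟨_, rfl⟩
  refine ⟨(ψ - l ∘ₗ (LinearMap.range e).mkQ).codRestrict _ fun x => ?_, fun z => ?_⟩
  · rw [LinearMap.mem_ker, LinearMap.sub_apply, map_sub, sub_eq_zero]
    exact (hg x).symm.trans (hl _).symm
  · refine Subtype.ext ?_
    change ψ (e z) - l ((LinearMap.range e).mkQ (e z)) = z
    rw [(hex _).2 ⟨z, rfl⟩, map_zero, sub_zero, hψ]
    rfl

end Lifting

/-! ### Exact dg-flat complexes have flat cycles -/

section Extending

variable {R : Type u} [Ring R] {A : TwoSidedIdeal R} {X : CochainComplex (ModuleCat.{u} R) ℤ}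

variable (A X) in
/-- A map from the cycles of a complex to a cotorsion module. -/
structure CotorsionCycle (p : ℤ) where
  /-- the target of the map -/
  C : ModuleCat.{u} R
  /-- the map -/
  g : LinearMap.ker (X.d p (p + 1)).hom →ₗ[R] C
  isCotorsion : IsCotorsion A C

/-- A map of short exact sequences connecting two objects of `CotorsionCycle`. -/
def CotorsionCycle.Rel (hX : IsExactFamily fun i => (X.d i (i + 1)).hom) (p : ℤ)
    (s : CotorsionCycle A X p) (s' : CotorsionCycle A X (p + 1)) : Prop :=
  ∃ (D : ModuleCat.{u} R) (i : s.C →ₗ[R] D) (π : D →ₗ[R] s'.C) (φ : X.X p →ₗ[R] D),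
    Function.Injective i ∧ (∀ x, π x = 0 ↔ ∃ z, i z = x) ∧ Function.Surjective π ∧
      (∀ z : LinearMap.ker (X.d p (p + 1)).hom, φ z = i (s.g z)) ∧
        ∀ x, π (φ x) = s'.g (hX.toCycles p x)

theorem CotorsionCycle.exists_rel_left (hX : IsExactFamily fun i => (X.d i (i + 1)).hom) (p : ℤ)
    (s' : CotorsionCycle A X (p + 1)) : ∃ s, CotorsionCycle.Rel hX p s s' :=
  ⟨⟨ModuleCat.of R PUnit, 0, isCotorsion_of_subsingleton (C := PUnit)⟩, s'.C, 0, LinearMap.id,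
    s'.g ∘ₗ hX.toCycles p, fun _ _ _ => rfl,
    fun _ => ⟨fun h => ⟨0, h.symm⟩, fun ⟨_, h⟩ => h.symm⟩, fun x => ⟨x, rfl⟩,
    fun z => (congrArg s'.g ((hX.toCycles_eq_zero p z).2 ⟨z, rfl⟩)).trans (map_zero _),
    fun _ => rfl⟩

/-- Push `X p` out along `s.g`, giving an h-unitary extension `E` of the next cycles by `s.C`, and
embed `E` in a cotorsion `D`. The quotient `D / s.C` is an extension of the firm flat `D / E` by
those cycles, hence h-unitary, and then cotorsion by `IsCotorsion.of_coresolution`. -/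
theorem CotorsionCycle.exists_rel_right (hX : IsExactFamily fun i => (X.d i (i + 1)).hom)
    (hXu : ∀ i, HU A (LinearMap.ker (X.d i (i + 1)).hom)) (p : ℤ) (s : CotorsionCycle A X p) :
    ∃ s', s.Rel hX p s' := by
  obtain ⟨E, _, _, i, x, hE, h⟩ := exists_pushout s.g (LinearMap.ker (X.d p (p + 1)).hom).subtype
  obtain ⟨hi, q, hq, hiq, hqx⟩ := exists_pushout_cokernel hE h Subtype.val_injective
    (hX.toCycles_eq_zero p) (hX.toCycles_surjective p)
  obtain ⟨D, _, _, η, hη, hF, hD⟩ :=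
    (((hXu (p + 1)).two_of_three hi hiq hq).1 s.isCotorsion.1).exists_special_preenvelope
  let W := LinearMap.range (η ∘ₗ i)
  have hW (y : D) : W.mkQ y = 0 ↔ ∃ c, (η ∘ₗ i) c = y := Submodule.Quotient.mk_eq_zero _
  obtain ⟨g, hg⟩ := exists_comp_eq_of_ker_le hq (W.mkQ ∘ₗ η) fun e he => by
    obtain ⟨c, rfl⟩ := (hiq e).1 he
    exact (hW _).2 ⟨c, rfl⟩
  have hgi : Function.Injective g := by
    rw [injective_iff_map_eq_zero]
    intro z hz
    obtain ⟨e, rfl⟩ := hq z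
    rw [hg] at hz
    obtain ⟨c, hc⟩ := (hW _).1 hz
    exact (hiq e).2 ⟨c, hη hc⟩
  have hWη : W ≤ LinearMap.range η := by
    rintro _ ⟨c, rfl⟩
    exact ⟨i c, rfl⟩
  have hgex (y) : Submodule.factor hWη y = 0 ↔ ∃ z, g z = y := by
    obtain ⟨y, rfl⟩ := W.mkQ_surjective y
    constructor
    · intro hy
      obtain ⟨e, rfl⟩ := (Submodule.Quotient.mk_eq_zero _).1 hy
      exact ⟨q e, hg e⟩
    · rintro ⟨z, hz⟩
      obtain ⟨e, rfl⟩ := hq z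
      rw [← hz, hg]
      exact (Submodule.Quotient.mk_eq_zero _).2 ⟨e, rfl⟩
  have hu : HU A (D ⧸ W) :=
    (hF.hu.two_of_three hgi hgex (Submodule.factor_surjective hWη)).1 (hXu (p + 1))
  refine ⟨⟨ModuleCat.of R (D ⧸ W), g, s.isCotorsion.of_coresolution hD hu (hη.comp hi) hW
    W.mkQ_surjective⟩, ModuleCat.of R D, η ∘ₗ i, W.mkQ, η ∘ₗ x, hη.comp hi, hW, W.mkQ_surjective,
    fun z => congrArg η ?_, fun y => ?_⟩
  · have := (h (s.g (-z)) z).2 ⟨-z, rfl, by simp⟩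
    rw [map_neg, map_neg, neg_add_eq_zero] at this
    exact this.symm
  · rw [← hqx]
    exact (hg _).symm

/-- Dually, `g` grows into a chain map to a cotorsion complex having `C` as a cycle module. On
cycles the null-homotopy reads `φ = i π s`, so `π s` extends `g`. -/
theorem exists_extension_of_homComplex_acyclic (hX : IsExactFamily fun i => (X.d i (i + 1)).hom)
    (hXu : ∀ i, HU A (LinearMap.ker (X.d i (i + 1)).hom))
    (h : ∀ C, cotorsionComplexes A C → (CochainComplex.HomComplex X C).Acyclic) {C : Type u}
    [AddCommGroup C] [Module R C] (hC : IsCotorsion A C) (m : ℤ)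
    (g : LinearMap.ker (X.d (m + 1) (m + 1 + 1)).hom →ₗ[R] C) :
    ∃ l : X.X (m + 1) →ₗ[R] C, ∀ z : LinearMap.ker (X.d (m + 1) (m + 1 + 1)).hom, l z = g z := by
  obtain ⟨t, ht, hrel⟩ := exists_int_family (CotorsionCycle.Rel hX) (m + 1)
    (⟨ModuleCat.of R C, g, hC⟩ : CotorsionCycle A X (m + 1))
    (CotorsionCycle.exists_rel_right hX hXu) (CotorsionCycle.exists_rel_left hX)
  choose D i π φ hi hiπ hπ hφi hφ using hrel
  let f : X ⟶ splice i π hiπ :=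
    { f := fun p => ModuleCat.ofHom (φ p)
      comm' := by
        rintro p _ rfl
        rw [splice_d]
        ext x
        change i (p + 1) (π p (φ p x)) = _
        rw [hφ, ← hφi]
        rfl }
  obtain ⟨s, hs⟩ := exists_homotopy_of_homComplex_acyclic
    (h _ (splice_mem_cotorsionComplexes hi hπ fun p => (t p).isCotorsion)) f
  have key : ∃ l : X.X (m + 1) →ₗ[R] (t (m + 1)).C,
      ∀ z : LinearMap.ker (X.d (m + 1) (m + 1 + 1)).hom, l z = (t (m + 1)).g z := by
    refine ⟨π m ∘ₗ s m, fun z => hi (m + 1) ?_⟩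
    have := hs m z
    rw [z.2, map_zero, add_zero] at this
    exact (splice_d_apply m (s m z)).symm.trans (this.symm.trans (hφi _ z))
  rw [ht] at key
  exact key

theorem flatComplexes_of_dgFlatComplexes (h : dgFlatComplexes A X) (hX : exactComplexes A X) :
    flatComplexes A X := by
  rw [exactComplexes_iff] at hX
  have hXe := acyclic_iff.1 hX.1
  refine flatComplexes_iff.2 ⟨hX.1, fun n => ?_⟩
  obtain ⟨m, rfl⟩ : ∃ m, n = m + 1 + 1 := ⟨n - 2, by lia⟩
  obtain ⟨F, _, _, q, hq, hF, hC⟩ := (hX.2 (m + 1 + 1)).exists_special_precover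
  -- The differential onto the cycles lifts to the precover `F`. On the previous cycles the lift
  -- lands in `ker q`; extending that restriction to the whole term and subtracting it yields a
  -- section of `q`.
  obtain ⟨l, hl⟩ := hC.exists_lift (i := (LinearMap.ker q).subtype) Subtype.val_injective
    (fun x => ⟨fun h => ⟨⟨x, h⟩, rfl⟩, by rintro ⟨k, rfl⟩; exact k.2⟩) hq
    (isHUnitaryFlat_iff.1 (h.2.1 (m + 1))) (hXe.toCycles (m + 1))
  obtain ⟨e, he⟩ := exists_extension_of_homComplex_acyclic hXe hX.2 h.2.2 hC m
    (l.restrict (p := LinearMap.ker (X.d (m + 1) (m + 1 + 1)).hom) (q := LinearMap.ker q)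
      fun z hz => by
        rw [LinearMap.mem_ker, hl]
        exact (hXe.toCycles_eq_zero (m + 1) z).2 ⟨⟨z, hz⟩, rfl⟩)
  obtain ⟨σ, hσ⟩ := exists_comp_eq_of_ker_le (hXe.toCycles_surjective (m + 1))
    (l - (LinearMap.ker q).subtype ∘ₗ e) fun x hx => by
      obtain ⟨z, rfl⟩ := (hXe.toCycles_eq_zero (m + 1) x).1 hx
      exact sub_eq_zero.2 (congrArg Subtype.val (he z)).symm
  refine ⟨hF.1.of_retract σ q fun z => ?_, (hX.2 _).idealSpan_eq_top⟩
  obtain ⟨x, rfl⟩ := hXe.toCycles_surjective (m + 1) z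
  rw [hσ, LinearMap.sub_apply, map_sub, hl]
  exact sub_eq_self.2 (e x).2

end Extending

/-! ### The two equalities -/

theorem dgFlatComplexes_inf_exactComplexes {R : Type u} [Ring R] (A : TwoSidedIdeal R) :
    dgFlatComplexes A ⊓ exactComplexes A = flatComplexes A := by
  refine le_antisymm (fun X h => flatComplexes_of_dgFlatComplexes h.1 h.2) fun X h =>
    ⟨⟨h.1.1, fun n => ?_, fun C hC => homComplex_acyclic h hC⟩, h.1⟩
  have h' := flatComplexes_iff.1 h
  exact isHUnitaryFlat_iff.2 ((acyclic_iff.1 h'.1).isFirmFlat h'.2 n)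

theorem dgCotorsionComplexes_inf_exactComplexes {R : Type u} [Ring R] (A : TwoSidedIdeal R) :
    dgCotorsionComplexes A ⊓ exactComplexes A = cotorsionComplexes A := by
  refine le_antisymm (fun X h => cotorsionComplexes_of_dgCotorsionComplexes h.1 h.2) fun X h =>
    ⟨⟨h.1.1, fun n => ?_, fun C hC => homComplex_acyclic hC h⟩, h.1⟩
  have h' := cotorsionComplexes_iff.1 h
  exact isHUnitaryCotorsion_iff.2 ((acyclic_iff.1 h'.1).isCotorsion h'.2 n)

end HUnitary
end

theorem mainTheorem6 (R : Type u) [Ring R] (A : TwoSidedIdeal R) :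
    HUnitary.dgFlatComplexes A ⊓ HUnitary.exactComplexes A = HUnitary.flatComplexes A ∧
      HUnitary.dgCotorsionComplexes A ⊓ HUnitary.exactComplexes A =
        HUnitary.cotorsionComplexes A :=
  ⟨HUnitary.dgFlatComplexes_inf_exactComplexes A,
    HUnitary.dgCotorsionComplexes_inf_exactComplexes A⟩
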